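/- Let $K=\mathbb{Q}(\sqrt{-\Delta})$ ($\Delta$ a positive integer) be an imaginary quadratic field, $p\neq 2$ a prime with $\left(\frac{-\Delta}{p}\right)=-1$ (so $p$ is inert in $K$), and $N\ge 1$ an integer prime to $p$. Let $G=GSp_6$, with $G(\mathbb{Q})$ acting through similitudes of positive multiplier on the Siegel domain $\mathcal D$ (the $GSp_6(\mathbb{R})^+$-conjugacy class of the standard $h_X$), let $\mathcal K\subset G(\hat{\mathbb{Z}})$ be a subgroup containing all elements of $G(\hat{\mathbb Z})$ congruent to $1$ modulo $N$, and let $X=[\mathcal D\times \mathcal K\backslash G(\mathbb{A}_f)]/G(\mathbb{Q})$ be the corresponding Siegel variety of genus $3$. Let $E=\mathrm{diag}(1,1,-1)$, let $G_V=GU(2,1)$ be the group of $\mathfrak g=h+k\sqrt{-\Delta}$ with $\mathfrak gE\bar{\mathfrak g}^t=\lambda E$, embedded in $G$ by $$\alpha(\mathfrak g)=\begin{pmatrix} h& kE\\ -\Delta Ek& EhE\end{pmatrix},$$ let $\mathcal D_V\subset\mathcal D$ be the $\alpha(G_V(\mathbb{R}))$-conjugacy class of $\alpha\circ h_V$, $h_V(z)=\mathrm{diag}(z,z,\bar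 z)$, and let $V\subset X$ be the image of $\mathcal D_V\times \alpha(G_V(\mathbb{A}_f))$. Let $\tau_p=\mathrm{diag}(1,1,1,p,p,p)$, placed at $p$, let $\mathcal K_p=\mathcal K\cap\tau_p^{-1}\mathcal K\tau_p$, let $X_p$ be the Shimura variety of level $\mathcal K_p$, with the projections $\pi_1[t,x]=[t,x]$ and $\pi_2[t,x]=[t,\tau_px]$ to $X$ that define the Hecke correspondence $T_p$, and put $\Gamma=\mathcal K\cap G(\mathbb{Q})$, $\Gamma_p=\mathcal K_p\cap G(\mathbb{Q})$. For $s\in\Gamma$ let $V_{p,s}^s\subset X_p$ be the image of $s(\mathcal D_V)\times s\,\alpha(G_V(\mathbb{A}_f))\,s^{-1}$. Two elements $r_1,r_2\in\Gamma$ are called D-equivalent if for some $s\in\Gamma$ the variety $V_{p,s}^s$ contains the images in $X_p$ of both $r_1(\mathcal D_V)\times 1$ and $r_2(\mathcal D_V)\times 1$. Let $S(3)=GSp_6(\mathbb{Z}_p)\backslash GSp_6(\mathbb{Z}_p)\tau_pGSp_6(\mathbb{Z}_p)$; D-equivalence is transported to $S(3)$ by the bijection $\Gamma_p\backslash\Gamma\to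 S(3)$, $r\mapsto GSp_6(\mathbb{Z}_p)\tau_pr$. The component of $T_p(V)$ attached to the class of $\sigma\leftrightarrow r$ is $\pi_2(V^r_{p,r})$. For $\sigma\in S(3)$ let $W_\sigma\subset\mathbb{F}_p^6$ be the row space of $\sigma$ modulo $p$, let $\sqrt{-\Delta}$ act on row vectors by right multiplication by $\alpha(\sqrt{-\Delta})$, and put $\mathfrak D_j=\{\sigma\in S(3): \dim_{\mathbb{F}_p}(\mathbb{F}_{p^2}W_\sigma)=j\}$. The open part of $S(3)$ consists of the classes of $\sigma(s)=\begin{pmatrix}1&s\\0&p\end{pmatrix}$ with $s\in M_3(\mathbb{Z})$ symmetric. A class of D-equivalence (a part) is called good if it is contained in $\mathfrak D_6$, trivial if it is contained in $\mathfrak D_3$, and bad if it is contained in $\mathfrak D_j$ for some $j\ne 3,6$; the components of $T_p(V)$ are named accordingly. Theorem. (1) Any two elements of the open part of $S(3)$ that lie in $\mathfrak D_4$ are D-equivalent. (2) There are exactly one good and exactly one bad part of $S(3)$, no trivial part, and every part is good or bad. Accordingly $T_p(V)$ has exactly one good component and exactly one bad component, and no component of $T_p(V)$ is equal to $V$. 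-/

import Mathlib

noncomputable section

namespace PicardHecke

open Matrix

instance primesFact (q : Nat.Primes) : Fact (q : ℕ).Prime := ⟨q.2⟩

/-- Index set of `6 × 6` matrices, seen as `2 × 2` matrices of `3 × 3` blocks. -/
abbrev Idx : Type := Fin 3 ⊕ Fin 3

/-! ### The groups `GSp₆` and `GU(2,1)` -/

/-- The standard alternating matrix, with blocks `0, 1, -1, 0`. -/
def stdJ (R : Type*) [CommRing R] : Matrix Idx Idx R := fromBlocks 0 1 (-1) 0

/-- The group `GSp₆(R)` of symplectic similitudes. -/
def GSp (R : Type*) [CommRing R] : Subgroup (GL Idx R) where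
  carrier := {g | ∃ c : Rˣ, (g : Matrix Idx Idx R) * stdJ R * (g : Matrix Idx Idx R)ᵀ
    = (c : R) • stdJ R}
  one_mem' := ⟨1, by simp⟩
  mul_mem' := by
    rintro a b ⟨c, hc⟩ ⟨d, hd⟩
    refine ⟨c * d, ?_⟩
    calc ((a * b : GL Idx R) : Matrix Idx Idx R) * stdJ R
          * ((a * b : GL Idx R) : Matrix Idx Idx R)ᵀ
        = (a : Matrix Idx Idx R) * ((b : Matrix Idx Idx R) * stdJ R
          * (b : Matrix Idx Idx R)ᵀ) * (a : Matrix Idx Idx R)ᵀ := by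
          simp only [Units.val_mul, transpose_mul, Matrix.mul_assoc]
      _ = ((c * d : Rˣ) : R) • stdJ R := by
          rw [hd, Matrix.mul_smul, Matrix.smul_mul, hc, smul_smul, Units.val_mul, mul_comm]
  inv_mem' := by
    rintro a ⟨c, hc⟩
    refine ⟨c⁻¹, ?_⟩
    have h1 : ((a⁻¹ : GL Idx R) : Matrix Idx Idx R) * (a : Matrix Idx Idx R) = 1 := by
      rw [← Units.val_mul, inv_mul_cancel, Units.val_one]
    have h2 : (a : Matrix Idx Idx R)ᵀ * ((a⁻¹ : GL Idx R) : Matrix Idx Idx R)ᵀ = 1 := by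
      rw [← transpose_mul, h1, transpose_one]
    have h3 : (c : R) • (((a⁻¹ : GL Idx R) : Matrix Idx Idx R) * stdJ R
        * ((a⁻¹ : GL Idx R) : Matrix Idx Idx R)ᵀ) = stdJ R := by
      rw [← Matrix.smul_mul, ← Matrix.mul_smul, ← hc]
      calc _ = (((a⁻¹ : GL Idx R) : Matrix Idx Idx R) * (a : Matrix Idx Idx R)) * stdJ R
            * ((a : Matrix Idx Idx R)ᵀ * ((a⁻¹ : GL Idx R) : Matrix Idx Idx R)ᵀ) := by
            simp only [Matrix.mul_assoc]
        _ = stdJ R := by rw [h1, h2, Matrix.one_mul, Matrix.mul_one]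
    calc _ = ((c⁻¹ : Rˣ) : R) • ((c : R) • (((a⁻¹ : GL Idx R) : Matrix Idx Idx R) * stdJ R
        * ((a⁻¹ : GL Idx R) : Matrix Idx Idx R)ᵀ)) := by
          rw [smul_smul, Units.inv_mul, one_smul]
      _ = _ := by rw [h3]

/-- Over an ordered field: the subgroup of the similitudes with positive multiplier. -/
def GSpPos (F : Type*) [Field F] [LinearOrder F] [IsStrictOrderedRing F] :
    Subgroup (GL Idx F) where
  carrier := {g | ∃ c : F, 0 < c ∧ (g : Matrix Idx Idx F) * stdJ F * (g : Matrix Idx Idx F)ᵀ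
    = c • stdJ F}
  one_mem' := ⟨1, one_pos, by simp⟩
  mul_mem' := by
    rintro a b ⟨c, hc0, hc⟩ ⟨d, hd0, hd⟩
    refine ⟨c * d, mul_pos hc0 hd0, ?_⟩
    calc ((a * b : GL Idx F) : Matrix Idx Idx F) * stdJ F
          * ((a * b : GL Idx F) : Matrix Idx Idx F)ᵀ
        = (a : Matrix Idx Idx F) * ((b : Matrix Idx Idx F) * stdJ F
          * (b : Matrix Idx Idx F)ᵀ) * (a : Matrix Idx Idx F)ᵀ := by
          simp only [Units.val_mul, transpose_mul, Matrix.mul_assoc]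
      _ = (c * d) • stdJ F := by
          rw [hd, Matrix.mul_smul, Matrix.smul_mul, hc, smul_smul, mul_comm]
  inv_mem' := by
    rintro a ⟨c, hc0, hc⟩
    refine ⟨c⁻¹, inv_pos.mpr hc0, ?_⟩
    have h1 : ((a⁻¹ : GL Idx F) : Matrix Idx Idx F) * (a : Matrix Idx Idx F) = 1 := by
      rw [← Units.val_mul, inv_mul_cancel, Units.val_one]
    have h2 : (a : Matrix Idx Idx F)ᵀ * ((a⁻¹ : GL Idx F) : Matrix Idx Idx F)ᵀ = 1 := by
      rw [← transpose_mul, h1, transpose_one]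
    have h3 : c • (((a⁻¹ : GL Idx F) : Matrix Idx Idx F) * stdJ F
        * ((a⁻¹ : GL Idx F) : Matrix Idx Idx F)ᵀ) = stdJ F := by
      rw [← Matrix.smul_mul, ← Matrix.mul_smul, ← hc]
      calc _ = (((a⁻¹ : GL Idx F) : Matrix Idx Idx F) * (a : Matrix Idx Idx F)) * stdJ F
            * ((a : Matrix Idx Idx F)ᵀ * ((a⁻¹ : GL Idx F) : Matrix Idx Idx F)ᵀ) := by
            simp only [Matrix.mul_assoc]
        _ = stdJ F := by rw [h1, h2, Matrix.one_mul, Matrix.mul_one]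
    calc _ = c⁻¹ • (c • (((a⁻¹ : GL Idx F) : Matrix Idx Idx F) * stdJ F
        * ((a⁻¹ : GL Idx F) : Matrix Idx Idx F)ᵀ)) := by
          rw [smul_smul, inv_mul_cancel₀ hc0.ne', one_smul]
      _ = _ := by rw [h3]

/-- The matrix `E₂₁ = diag(1, 1, -1)` of the Hermitian form. -/
def E21 (R : Type*) [CommRing R] : Matrix (Fin 3) (Fin 3) R := diagonal ![1, 1, -1]

/-- The embedding `h + k√(-Δ) ↦ α(h + k√(-Δ))` of `M₃(R[√(-Δ)])` into `M₆(R)`. -/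
def alphaMat {R : Type*} [CommRing R] (Δ : ℕ) (h k : Matrix (Fin 3) (Fin 3) R) :
    Matrix Idx Idx R :=
  fromBlocks h (k * E21 R) (-((Δ : R) • (E21 R * k))) (E21 R * h * E21 R)

/-- The image `α(G_V(R)) ⊆ GSp₆(R)` of the unitary similitude group `G_V = GU(2,1)` of
`K = ℚ(√(-Δ))`. The two matrix equations say that `𝔤 = h + k√(-Δ)` satisfies
`𝔤 E₂₁ 𝔤̄ᵗ = c E₂₁`. -/
def GV (Δ : ℕ) (R : Type*) [CommRing R] : Set (GL Idx R) :=
  {g | ∃ (h k : Matrix (Fin 3) (Fin 3) R) (c : Rˣ),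
    (g : Matrix Idx Idx R) = alphaMat Δ h k ∧
    h * E21 R * hᵀ + (Δ : R) • (k * E21 R * kᵀ) = (c : R) • E21 R ∧
    k * E21 R * hᵀ = h * E21 R * kᵀ}

/-! ### Hermitian symmetric domains

A homomorphism `h : ℂˣ → GSp₆(ℝ)` with `h(a + bi) = a + b h(i)` is given by the matrix `h(i)`. -/

/-- `h_X(i)` for the standard `h_X`, namely the block matrix `0, 1, -1, 0`. -/
def hX : GL Idx ℝ :=
  ⟨fromBlocks 0 1 (-1) 0, fromBlocks 0 (-1) 1 0,
    by simp [fromBlocks_multiply], by simp [fromBlocks_multiply]⟩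

/-- The Siegel domain `𝒟`: the `GSp₆(ℝ)⁺`-conjugacy class of `h_X`. -/
def siegelDomain : Set (GL Idx ℝ) := {J | ∃ g ∈ GSpPos ℝ, J = g * hX * g⁻¹}

/-- `α(h_V(i))` for the standard `h_V(z) = diag(z, z, z̄)`: here `h_V(i) = i E₂₁ = k√(-Δ)` with
`k = E₂₁/√Δ`, and the matrix is `α(0 + k√(-Δ))`. -/
def hVMat (Δ : ℕ) : Matrix Idx Idx ℝ := alphaMat Δ 0 ((Real.sqrt Δ)⁻¹ • E21 ℝ)

/-- The domain `𝒟_V ⊆ 𝒟`: the `α(G_V(ℝ))`-conjugacy class of `α ∘ h_V`. -/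
def picardDomain (Δ : ℕ) : Set (GL Idx ℝ) :=
  {J | ∃ g ∈ GV Δ ℝ, (J : Matrix Idx Idx ℝ)
    = (g : Matrix Idx Idx ℝ) * hVMat Δ * ((g⁻¹ : GL Idx ℝ) : Matrix Idx Idx ℝ)}

/-! ### Adelic groups and level subgroups -/

/-- The group `∏_q GL₆(ℚ_q)`, in which all adelic groups below lie. -/
abbrev ProdGL : Type := ∀ q : Nat.Primes, GL Idx ℚ_[q]

/-- `GSp₆(ℤ_q)` as a subgroup of `GL₆(ℚ_q)`. -/
def GSpZ (q : Nat.Primes) : Subgroup (GL Idx ℚ_[q]) :=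
  (GSp ℤ_[q]).map (GeneralLinearGroup.map PadicInt.Coe.ringHom)

/-- `GSp₆(𝔸_f)`: the restricted product of the groups `GSp₆(ℚ_q)` with respect to `GSp₆(ℤ_q)`. -/
def GSpAf : Subgroup ProdGL where
  carrier := {x | (∀ q : Nat.Primes, x q ∈ GSp ℚ_[q]) ∧ ∀ᶠ q in Filter.cofinite, x q ∈ GSpZ q}
  one_mem' := ⟨fun q => one_mem _, Filter.Eventually.of_forall fun q => one_mem _⟩
  mul_mem' := fun ha hb => ⟨fun q => mul_mem (ha.1 q) (hb.1 q), by
    filter_upwards [ha.2, hb.2] with q h1 h2 using mul_mem h1 h2⟩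
  inv_mem' := fun ha => ⟨fun q => inv_mem (ha.1 q), by
    filter_upwards [ha.2] with q h1 using inv_mem h1⟩

/-- `α(G_V(𝔸_f))`. -/
def GVAf (Δ : ℕ) : Set ProdGL := {x | x ∈ GSpAf ∧ ∀ q : Nat.Primes, x q ∈ GV Δ ℚ_[q]}

/-- The diagonal embedding of `GL₆(ℚ)`. -/
def diagEmb : GL Idx ℚ →* ProdGL :=
  MonoidHom.mk' (fun g q => GeneralLinearGroup.map (Rat.castHom ℚ_[q]) g)
    (fun a b => by funext q; exact map_mul _ a b)

/-- `GL₆(ℚ) → GL₆(ℝ)`. -/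
def realEmb : GL Idx ℚ →* GL Idx ℝ := GeneralLinearGroup.map (Rat.castHom ℝ)

/-- `𝒦` is a subgroup of level `N` of `GSp₆(𝔸_f)`: it lies in `∏_q GSp₆(ℤ_q)` and contains all
elements of this product that are congruent to `1` modulo `N`. -/
structure IsLevelSubgroup (N : ℕ) (𝒦 : Subgroup ProdGL) : Prop where
  le_integral : ∀ x ∈ 𝒦, ∀ q, x q ∈ GSpZ q
  principal_le : ∀ x : ProdGL, (∀ q, x q ∈ GSpZ q) →
    (∀ (q : Nat.Primes) (i j : Idx), ‖((x q : Matrix Idx Idx ℚ_[q]) - 1) i j‖ ≤ ‖(N : ℚ_[q])‖) → x ∈ 𝒦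

/-- `Γ = 𝒦 ∩ G(ℚ)`, where `G(ℚ)` denotes the group of similitudes with positive multiplier
(the ones that preserve `𝒟`). -/
def Gam (𝒦 : Subgroup ProdGL) : Subgroup (GL Idx ℚ) := GSpPos ℚ ⊓ 𝒦.comap diagEmb

/-! ### Shimura varieties -/

/-- `𝒟 × GSp₆(𝔸_f)`. -/
abbrev Pts : Type := siegelDomain × GSpAf

/-- `(J, x) ∼ (γ⁻¹Jγ, k x γ)` for `k ∈ U`, `γ ∈ G(ℚ)`. -/
def shSetoid (U : Subgroup ProdGL) : Setoid Pts where
  r P Q := ∃ k ∈ U, ∃ γ ∈ GSpPos ℚ,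
    (Q.1 : GL Idx ℝ) = (realEmb γ)⁻¹ * P.1 * realEmb γ ∧
    (Q.2 : ProdGL) = k * P.2 * diagEmb γ
  iseqv :=
    { refl := fun P => ⟨1, one_mem _, 1, one_mem _, by simp, by simp⟩
      symm := by
        rintro P Q ⟨k, hk, γ, hγ, h1, h2⟩
        refine ⟨k⁻¹, inv_mem hk, γ⁻¹, inv_mem hγ, ?_, ?_⟩
        · rw [h1, map_inv]; group
        · rw [h2, map_inv]; group
      trans := by
        rintro P Q S ⟨k, hk, γ, hγ, h1, h2⟩ ⟨k', hk', γ', hγ', h1', h2'⟩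
        refine ⟨k' * k, mul_mem hk' hk, γ * γ', mul_mem hγ hγ', ?_, ?_⟩
        · rw [h1', h1, map_mul]; group
        · rw [h2', h2, map_mul]; group }

/-- The (complex points of the) Shimura variety `[𝒟 × U \ GSp₆(𝔸_f)] / G(ℚ)` of level `U`. -/
def Sh (U : Subgroup ProdGL) : Type := Quotient (shSetoid U)

/-- The image in the Shimura variety of level `U` of a set of pairs `(J, x)`. -/
def shImage (U : Subgroup ProdGL) (A : Set (GL Idx ℝ × ProdGL)) : Set (Sh U) :=
  {y | ∃ P : Pts, ((P.1 : GL Idx ℝ), (P.2 : ProdGL)) ∈ A ∧ y = Quotient.mk (shSetoid U) P}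

/-- The matrix `τ_p = diag(1, 1, 1, p, p, p)`. -/
def tau (p : Nat.Primes) : GL Idx ℚ_[p] :=
  GeneralLinearGroup.mkOfDetNeZero (fromBlocks 1 0 0 ((p : ℚ_[p]) • 1)) (by
    have : (p : ℕ) ≠ 0 := p.2.ne_zero
    simp [det_fromBlocks_zero₂₁, this])

/-- `τ_p` as an element of `GSp₆(𝔸_f)` concentrated at the place `p`. -/
def tauA (p : Nat.Primes) : ProdGL := Pi.mulSingle p (tau p)

/-- The level subgroup `𝒦_p = 𝒦 ∩ τ_p⁻¹ 𝒦 τ_p` of the source `X_p` of the Hecke correspondence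
`T_p` on the Siegel variety `X = Sh 𝒦`. Its two projections to `X` are
`π₁ [J, x] = [J, x]` and `π₂ [J, x] = [J, τ_p x]`. -/
def levelP (p : Nat.Primes) (𝒦 : Subgroup ProdGL) : Subgroup ProdGL :=
  𝒦 ⊓ 𝒦.comap (MulAut.conj (tauA p)).toMonoidHom

/-- The Shimura subvariety `V ⊆ X`. -/
def subV (Δ : ℕ) (𝒦 : Subgroup ProdGL) : Set (Sh 𝒦) :=
  shImage 𝒦 {P | P.1 ∈ picardDomain Δ ∧ P.2 ∈ GVAf Δ}

/-- The irreducible component of `π₁⁻¹(V_c)` that corresponds to the class of `r ∈ Γ` in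
`Γ_p \ Γ`: the image in `X_p` of `r(𝒟_V) × {1}`. Here `V_c`, the image of `𝒟_V × {1}`, is the
principal irreducible component of `V`. -/
def irrComp (Δ : ℕ) (p : Nat.Primes) (𝒦 : Subgroup ProdGL) (r : GL Idx ℚ) :
    Set (Sh (levelP p 𝒦)) :=
  shImage (levelP p 𝒦)
    {P | ∃ J ∈ picardDomain Δ, P = (realEmb r * J * (realEmb r)⁻¹, 1)}

/-- The points `(sJs⁻¹, s g s⁻¹)` of `s(𝒟_V) × G_V(𝔸_f)^s`. -/
def conjPts (Δ : ℕ) (s : GL Idx ℚ) : Set (GL Idx ℝ × ProdGL) :=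
  {P | ∃ J ∈ picardDomain Δ, ∃ g ∈ GVAf Δ,
    P = (realEmb s * J * (realEmb s)⁻¹, diagEmb s * g * (diagEmb s)⁻¹)}

/-- The Shimura subvariety `V_{p,s}^s` of `X_p`. -/
def subVps (Δ : ℕ) (p : Nat.Primes) (𝒦 : Subgroup ProdGL) (s : GL Idx ℚ) :
    Set (Sh (levelP p 𝒦)) :=
  shImage (levelP p 𝒦) (conjPts Δ s)

/-- The Shimura subvariety `π₂(V_{p,s}^s)` of `T_p(V) ⊆ X`. -/
def heckeSubvariety (Δ : ℕ) (p : Nat.Primes) (𝒦 : Subgroup ProdGL) (s : GL Idx ℚ) :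
    Set (Sh 𝒦) :=
  shImage 𝒦 {P | ∃ Q ∈ conjPts Δ s, P = (Q.1, tauA p * Q.2)}

/-- D-equivalence of two elements of `Γ`: some Shimura subvariety `V_{p,s}^s`, `s ∈ Γ`, contains
both of the corresponding irreducible components. -/
def DEquivGam (Δ : ℕ) (p : Nat.Primes) (𝒦 : Subgroup ProdGL) (r₁ r₂ : GL Idx ℚ) : Prop :=
  ∃ s ∈ Gam 𝒦, irrComp Δ p 𝒦 r₁ ⊆ subVps Δ p 𝒦 s ∧ irrComp Δ p 𝒦 r₂ ⊆ subVps Δ p 𝒦 s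

/-! ### The set `S(3)` and its partitions -/

/-- The double coset `GSp₆(ℤ_p) τ_p GSp₆(ℤ_p)`. The set `S(3)` is its set of cosets
`GSp₆(ℤ_p) σ`; all the notions below depend on `σ` only through this coset. -/
def heckeSet (p : Nat.Primes) : Set (GL Idx ℚ_[p]) :=
  {σ | ∃ k₁ ∈ GSpZ p, ∃ k₂ ∈ GSpZ p, σ = k₁ * tau p * k₂}

/-- `r ∈ Γ` and `σ` correspond to each other under the bijection
`Γ_p \ Γ → S(3)`, `r ↦ GSp₆(ℤ_p) τ_p r`. -/
def Corr (p : Nat.Primes) (𝒦 : Subgroup ProdGL) (σ : GL Idx ℚ_[p]) (r : GL Idx ℚ) : Prop :=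
  r ∈ Gam 𝒦 ∧ ∃ k ∈ GSpZ p, k * σ = tau p * diagEmb r p

/-- D-equivalence of two elements of `S(3)`. -/
def DEquiv (Δ : ℕ) (p : Nat.Primes) (𝒦 : Subgroup ProdGL) (σ₁ σ₂ : GL Idx ℚ_[p]) : Prop :=
  ∃ r₁ r₂, Corr p 𝒦 σ₁ r₁ ∧ Corr p 𝒦 σ₂ r₂ ∧ DEquivGam Δ p 𝒦 r₁ r₂

/-- The isotropic subspace `W_σ` of `(A_t)_p = 𝔽_p⁶` (row vectors): the span of the rows of the
reduction modulo `p` of the (integral) matrix `σ`. -/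
def W (p : Nat.Primes) (σ : GL Idx ℚ_[p]) : Submodule (ZMod p) (Idx → ZMod p) :=
  Submodule.span (ZMod p) {v | ∃ M : Matrix Idx Idx ℤ_[p],
    M.map (PadicInt.Coe.ringHom) = (σ : Matrix Idx Idx ℚ_[p]) ∧
    ∃ i, v = fun j => PadicInt.toZMod (M i j)}

/-- The space `𝔽_{p²} W_σ = W_σ + √(-Δ) W_σ`, where `√(-Δ)` acts on row vectors by right
multiplication by `α(√(-Δ))`. -/
def FW (Δ : ℕ) (p : Nat.Primes) (σ : GL Idx ℚ_[p]) : Submodule (ZMod p) (Idx → ZMod p) :=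
  W p σ ⊔ (W p σ).map (Matrix.vecMulLinear (alphaMat Δ 0 1 : Matrix Idx Idx (ZMod p)))

/-- The part `𝔇_j` of `S(3)`: `dim (𝔽_{p²} W_σ) = j`. -/
def frakD (Δ : ℕ) (p : Nat.Primes) (j : ℕ) : Set (GL Idx ℚ_[p]) :=
  {σ | σ ∈ heckeSet p ∧ Module.finrank (ZMod p) (FW Δ p σ) = j}

/-- The element `σ(s)`, with blocks `1, s, 0, p`, of the open part of `S(3)`, for a symmetric
integer matrix `s`. -/
def sigmaOpen (p : Nat.Primes) (s : Matrix (Fin 3) (Fin 3) ℤ) : GL Idx ℚ_[p] :=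
  GeneralLinearGroup.mkOfDetNeZero
    (fromBlocks 1 (s.map (Int.cast : ℤ → ℚ_[p])) 0 ((p : ℚ_[p]) • 1)) (by
      have : (p : ℕ) ≠ 0 := p.2.ne_zero
      simp [det_fromBlocks_zero₂₁, this])

/-- The set of parts of the D-partition of `S(3)`. -/
def DParts (Δ : ℕ) (p : Nat.Primes) (𝒦 : Subgroup ProdGL) : Set (Set (GL Idx ℚ_[p])) :=
  {A | ∃ σ ∈ heckeSet p, A = {σ' | σ' ∈ heckeSet p ∧ DEquiv Δ p 𝒦 σ σ'}}

/-- The good parts of the D-partition are those contained in `𝔇_6`. -/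
def IsGoodPart (Δ : ℕ) (p : Nat.Primes) (𝒦 : Subgroup ProdGL) (A : Set (GL Idx ℚ_[p])) : Prop :=
  A ∈ DParts Δ p 𝒦 ∧ A ⊆ frakD Δ p 6

/-- The bad parts of the D-partition are those contained in some `𝔇_j`, `j ≠ 3, 6`. -/
def IsBadPart (Δ : ℕ) (p : Nat.Primes) (𝒦 : Subgroup ProdGL) (A : Set (GL Idx ℚ_[p])) : Prop :=
  A ∈ DParts Δ p 𝒦 ∧ ∃ j, j ≠ 3 ∧ j ≠ 6 ∧ A ⊆ frakD Δ p j

/-- The trivial parts of the D-partition are those contained in `𝔇_3`. -/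
def IsTrivialPart (Δ : ℕ) (p : Nat.Primes) (𝒦 : Subgroup ProdGL) (A : Set (GL Idx ℚ_[p])) :
    Prop :=
  A ∈ DParts Δ p 𝒦 ∧ A ⊆ frakD Δ p 3

/-- `Y` is the component `T_p(V)_A` of `T_p(V)` that corresponds to the part `A` of the
D-partition. -/
def IsComponentOf (Δ : ℕ) (p : Nat.Primes) (𝒦 : Subgroup ProdGL) (A : Set (GL Idx ℚ_[p]))
    (Y : Set (Sh 𝒦)) : Prop :=
  ∃ σ ∈ A, ∃ r, Corr p 𝒦 σ r ∧ Y = heckeSubvariety Δ p 𝒦 r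

end PicardHecke

end

open PicardHecke

/-! Put d(σ) = dim 𝔽_{p²}W_σ. The D-partition of S(3) is the partition by d, and d takes exactly the
values 6 and 4; all the claims follow from this and from a generic-point argument that excludes V.

Values of d. W_σ is a Lagrangian subspace of 𝔽_p⁶ and determines the coset of σ
(`exists_mul_eq_of_W_eq`). Since p is inert, the intersection of W_σ with √(-Δ)W_σ is a vector space
over 𝔽_{p²}. Its 𝔽_p-dimension is even and at most 3, hence 0 or 2, and d is 6 minus this dimension
(`IsLagrangian.finrank_sup`). Both values occur (`frakD_six_nonempty`, `frakD_four_nonempty`).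

Equal d implies D-equivalence. Over 𝔽_p a Witt-type theorem holds: each Lagrangian subspace has a
normal form in a frame adapted to the Hermitian form, so two of them with the same d are conjugate
under a unitary similitude (`IsLagrangian.exists_similitude`). Hensel's lemma lifts this similitude
to ℤ_p (`exists_lift_similitude`). As p does not divide N, 𝒦 is maximal at p, and the lift gives an
element of 𝒦_p that moves one irreducible component into the Shimura subvariety of the other
(`exists_levelP_of_spanDim_eq`, `irrComp_subset_subVps`). The same element identifies the images
under π₂. Representatives in Γ come from strong approximation, made explicit by unipotent matrices
(`exists_corr`).

D-equivalence implies equal d. There is a point J of 𝒟_V such that all rational matrices commuting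
with J lie in K. Hence a rational δ that conjugates J back into 𝒟_V commutes with √(-Δ)
(`exists_generic_point`). If the component of r lies in the subvariety of s, then following J
produces an integral p-adic matrix that commutes with √(-Δ) and takes the W of s to the W of r, so d
agrees (`spanDim_eq_of_irrComp_subset`). If a component were equal to V, the same point would give
an element of the Hecke double coset that commutes with √(-Δ); its W would be stable under √(-Δ) and
d would be 3 (`heckeSubvariety_ne_subV`). -/

noncomputable section

namespace PicardHecke

open Matrix

/-! ### The unitary similitude group as a centralizer in `GSp` -/

section Ring

variable {R : Type*} [CommRing R]

/-- The matrix `α(√(-Δ))`. -/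
def rootMat (Δ : ℕ) (R : Type*) [CommRing R] : Matrix Idx Idx R := alphaMat Δ 0 1

theorem rootMat_eq (Δ : ℕ) :
    rootMat Δ R = fromBlocks 0 (E21 R) (-((Δ : R) • E21 R)) 0 := by
  simp [rootMat, alphaMat]

@[simp] theorem E21_mul_self : E21 R * E21 R = 1 := by
  rw [E21, diagonal_mul_diagonal, ← diagonal_one]
  congr 1
  funext i
  fin_cases i <;> simp

@[simp] theorem E21_mul_E21_mul (a : Matrix (Fin 3) (Fin 3) R) : E21 R * (E21 R * a) = a := by
  rw [← Matrix.mul_assoc, E21_mul_self, Matrix.one_mul]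

@[simp] theorem E21_transpose : (E21 R)ᵀ = E21 R := diagonal_transpose _

theorem rootMat_mul_self (Δ : ℕ) : rootMat Δ R * rootMat Δ R = -((Δ : R) • 1) := by
  rw [rootMat_eq, fromBlocks_multiply, ← fromBlocks_one, fromBlocks_smul, fromBlocks_neg]
  simp

@[simp] theorem stdJ_mul_self : stdJ R * stdJ R = -1 := by
  rw [stdJ, fromBlocks_multiply, ← fromBlocks_one, fromBlocks_neg]
  simp

@[simp] theorem stdJ_transpose : (stdJ R)ᵀ = -stdJ R := by
  rw [stdJ, fromBlocks_transpose, fromBlocks_neg]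
  simp

theorem rootMat_mul_stdJ (Δ : ℕ) :
    rootMat Δ R * stdJ R = -(stdJ R * (rootMat Δ R)ᵀ) := by
  rw [rootMat_eq, stdJ, fromBlocks_transpose, fromBlocks_multiply, fromBlocks_multiply,
    fromBlocks_neg]
  simp

theorem stdJ_mul_rootMat (Δ : ℕ) :
    stdJ R * rootMat Δ R = -((rootMat Δ R)ᵀ * stdJ R) := by
  rw [rootMat_eq, stdJ, fromBlocks_transpose, fromBlocks_multiply, fromBlocks_multiply,
    fromBlocks_neg]
  simp

theorem alphaMat_mul_rootMat (Δ : ℕ) (h k : Matrix (Fin 3) (Fin 3) R) :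
    alphaMat Δ h k * rootMat Δ R = rootMat Δ R * alphaMat Δ h k := by
  rw [rootMat_eq, alphaMat, fromBlocks_multiply, fromBlocks_multiply]
  simp [Matrix.mul_assoc]

/-- The relation with `rootMat` determines the lower blocks from the upper ones, so `h` and `k` can
be read off from the first block row. -/
theorem exists_eq_alphaMat {Δ : ℕ} {g : Matrix Idx Idx R}
    (hg : g * rootMat Δ R = rootMat Δ R * g) : ∃ h k, g = alphaMat Δ h k := by
  refine ⟨g.toBlocks₁₁, g.toBlocks₁₂ * E21 R, ?_⟩
  have e := hg
  rw [← fromBlocks_toBlocks g, rootMat_eq, fromBlocks_multiply, fromBlocks_multiply] at e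
  have e2 := congrArg toBlocks₁₂ e
  have e1 := congrArg toBlocks₁₁ e
  simp only [toBlocks_fromBlocks₁₁, toBlocks_fromBlocks₁₂, Matrix.mul_zero, Matrix.zero_mul,
    zero_add, add_zero, Matrix.mul_neg, Matrix.mul_smul] at e1 e2
  conv_lhs => rw [← fromBlocks_toBlocks g]
  rw [alphaMat]
  congr 1
  · rw [Matrix.mul_assoc, E21_mul_self, Matrix.mul_one]
  · rw [← Matrix.mul_smul, ← Matrix.mul_neg, ← Matrix.smul_mul, ← Matrix.neg_mul]
    have := congrArg (fun m => E21 R * m) e1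
    simp only [E21_mul_E21_mul] at this
    rw [← this]
    simp
  · rw [Matrix.mul_assoc, e2, E21_mul_E21_mul]

/-- The blocks of the product on the left are the two components of 𝔤E𝔤̄ᵗ over R, up to sign,
factors `E21` and the scalar Δ. The similitude equation in six variables is therefore the Hermitian
one in three. -/
theorem alphaMat_similitude_iff (Δ : ℕ) (h k : Matrix (Fin 3) (Fin 3) R) (c : R) :
    alphaMat Δ h k * stdJ R * (alphaMat Δ h k)ᵀ = c • stdJ R ↔
      h * E21 R * hᵀ + (Δ : R) • (k * E21 R * kᵀ) = c • E21 R ∧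
        k * E21 R * hᵀ = h * E21 R * kᵀ := by
  have key : alphaMat Δ h k * stdJ R * (alphaMat Δ h k)ᵀ
      = fromBlocks (h * E21 R * kᵀ - k * E21 R * hᵀ)
        ((h * E21 R * hᵀ + (Δ : R) • (k * E21 R * kᵀ)) * E21 R)
        (-(E21 R * (h * E21 R * hᵀ + (Δ : R) • (k * E21 R * kᵀ))))
        ((Δ : R) • (E21 R * (h * E21 R * kᵀ - k * E21 R * hᵀ) * E21 R)) := by
    rw [alphaMat, stdJ, fromBlocks_transpose, fromBlocks_multiply, fromBlocks_multiply]
    congr 1 <;>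
      simp [Matrix.mul_assoc, Matrix.mul_add, Matrix.add_mul, Matrix.mul_sub, Matrix.sub_mul,
        smul_sub] <;> abel
  rw [key, stdJ, fromBlocks_smul, fromBlocks_inj]
  constructor
  · rintro ⟨h1, h2, -, -⟩
    refine ⟨?_, ?_⟩
    · have := congrArg (fun m => m * E21 R) h2
      simpa only [Matrix.mul_assoc, E21_mul_self, Matrix.mul_one, Matrix.smul_mul,
        Matrix.one_mul] using this
    · rw [smul_zero, sub_eq_zero] at h1
      exact h1.symm
  · rintro ⟨h1, h2⟩
    rw [h1, h2]
    simp

/-- This coordinate-free form is the one used from here on: it makes the group structure and the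
compatibility with ring homomorphisms evident. -/
theorem mem_GV_iff {Δ : ℕ} {g : GL Idx R} :
    g ∈ GV Δ R ↔ g ∈ GSp R ∧ (g : Matrix Idx Idx R) * rootMat Δ R = rootMat Δ R * g := by
  constructor
  · rintro ⟨h, k, c, hg, h1, h2⟩
    exact ⟨⟨c, by rw [hg]; exact (alphaMat_similitude_iff Δ h k c).2 ⟨h1, h2⟩⟩,
      by rw [hg, alphaMat_mul_rootMat]⟩
  · rintro ⟨⟨c, hc⟩, hcomm⟩
    obtain ⟨h, k, hg⟩ := exists_eq_alphaMat hcomm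
    rw [hg, alphaMat_similitude_iff] at hc
    exact ⟨h, k, c, hg, hc.1, hc.2⟩

/-- The group of the invertible matrices that commute with `α(√(-Δ))`. -/
def rootCentralizer (Δ : ℕ) (R : Type*) [CommRing R] : Subgroup (GL Idx R) where
  carrier := {g | (g : Matrix Idx Idx R) * rootMat Δ R = rootMat Δ R * g}
  one_mem' := by simp
  mul_mem' := by
    intro a b (ha : _ = _) (hb : _ = _)
    change _ = _
    rw [Units.val_mul, Matrix.mul_assoc, hb, ← Matrix.mul_assoc, ha, Matrix.mul_assoc]
  inv_mem' := by
    intro a (ha : _ = _)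
    have h : Commute (a : Matrix Idx Idx R) (rootMat Δ R) := ha
    exact h.units_inv_left.eq

theorem mem_rootCentralizer {Δ : ℕ} {g : GL Idx R} : g ∈ rootCentralizer Δ R ↔
    (g : Matrix Idx Idx R) * rootMat Δ R = rootMat Δ R * g := Iff.rfl

theorem GV_eq (Δ : ℕ) : GV Δ R = (GSp R ⊓ rootCentralizer Δ R : Subgroup (GL Idx R)) := by
  ext g
  exact mem_GV_iff

/-! ### Compatibility with change of rings -/

section Map

variable {S : Type*} [CommRing S] (f : R →+* S)

@[simp] theorem E21_map : (E21 R).map f = E21 S := by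
  rw [E21, E21, diagonal_map (map_zero f)]
  congr 1
  funext i
  fin_cases i <;> simp

@[simp] theorem rootMat_map (Δ : ℕ) : (rootMat Δ R).map f = rootMat Δ S := by
  rw [rootMat_eq, rootMat_eq, fromBlocks_map, E21_map]
  congr 1
  · simp
  · ext i j
    have := congrFun (congrFun (E21_map f) i) j
    simp only [map_apply] at this
    simp [this]
  · simp

@[simp] theorem stdJ_map : (stdJ R).map f = stdJ S := by
  rw [stdJ, stdJ, fromBlocks_map]
  congr 1 <;> ext i j <;> simp [one_apply, apply_ite f]

theorem map_mem_GSp {g : GL Idx R} (hg : g ∈ GSp R) : GeneralLinearGroup.map f g ∈ GSp S := by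
  obtain ⟨c, hc⟩ := hg
  refine ⟨Units.map f c, ?_⟩
  have := congrArg (fun m => m.map f) hc
  simp only [Matrix.map_mul, transpose_map, stdJ_map] at this
  refine Eq.trans this ?_
  ext i j
  have e := congrFun (congrFun (stdJ_map f) i) j
  rw [map_apply] at e
  simp [e]

theorem map_mem_rootCentralizer {Δ : ℕ} {g : GL Idx R} (hg : g ∈ rootCentralizer Δ R) :
    GeneralLinearGroup.map f g ∈ rootCentralizer Δ S := by
  have := congrArg (fun m => m.map f) (mem_rootCentralizer.1 hg)
  simp only [Matrix.map_mul, rootMat_map] at this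
  exact this

end Map

end Ring

/-! ### The symplectic form, multiplication by √(-Δ), and frames -/

section Form

variable {F : Type*} [Field F]

/-- The alternating form on row vectors given by the standard alternating matrix. -/
def symForm (F : Type*) [Field F] : LinearMap.BilinForm F (Idx → F) := Matrix.toBilin' (stdJ F)

/-- Multiplication by `√(-Δ)` on row vectors. -/
def rootMul (Δ : ℕ) (F : Type*) [Field F] : (Idx → F) →ₗ[F] (Idx → F) :=
  Matrix.vecMulLinear (rootMat Δ F)

theorem rootMul_apply (Δ : ℕ) (x : Idx → F) : rootMul Δ F x = x ᵥ* rootMat Δ F := rfl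

theorem symForm_apply (x y : Idx → F) : symForm F x y = x ⬝ᵥ (stdJ F *ᵥ y) :=
  Matrix.toBilin'_apply' _ _ _

theorem symForm_swap (x y : Idx → F) : symForm F x y = -symForm F y x := by
  rw [symForm_apply, symForm_apply, dotProduct_mulVec, ← mulVec_transpose, stdJ_transpose,
    neg_mulVec, neg_dotProduct, dotProduct_comm]

theorem rootMul_rootMul (Δ : ℕ) (x : Idx → F) :
    rootMul Δ F (rootMul Δ F x) = -((Δ : F) • x) := by
  simp only [rootMul_apply, vecMul_vecMul, rootMat_mul_self, vecMul_neg, vecMul_smul, vecMul_one]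

theorem symForm_rootMul_left (Δ : ℕ) (x y : Idx → F) :
    symForm F (rootMul Δ F x) y = -symForm F x (rootMul Δ F y) := by
  rw [symForm_apply, symForm_apply, rootMul_apply, rootMul_apply, ← dotProduct_mulVec,
    mulVec_mulVec, rootMat_mul_stdJ, ← mulVec_transpose, mulVec_mulVec, neg_mulVec, dotProduct_neg]

theorem symForm_rootMul_comm (Δ : ℕ) (x y : Idx → F) :
    symForm F (rootMul Δ F x) y = symForm F (rootMul Δ F y) x := by
  rw [symForm_rootMul_left, symForm_swap, neg_neg]

theorem symForm_rootMul_rootMul (Δ : ℕ) (x y : Idx → F) :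
    symForm F (rootMul Δ F x) (rootMul Δ F y) = Δ * symForm F x y := by
  rw [symForm_rootMul_left, rootMul_rootMul, map_neg, map_smul, neg_neg, smul_eq_mul]

theorem isUnit_stdJ : IsUnit (stdJ F) :=
  IsUnit.of_mul_eq_one (-stdJ F) (by simp)

theorem symForm_nondegenerate : (symForm F).Nondegenerate :=
  LinearMap.BilinForm.nondegenerate_toBilin'_of_det_ne_zero' _
    ((Matrix.isUnit_iff_isUnit_det _).1 isUnit_stdJ).ne_zero

/-- A hyperbolic family of three vectors over `F[√(-Δ)]`, with Gram matrix `c G` for the Hermitian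
form whose imaginary part is the standard alternating form. -/
structure IsFrame (Δ : ℕ) (G : Matrix (Fin 3) (Fin 3) F) (c : F) (b : Fin 3 → Idx → F) :
    Prop where
  ne_zero : c ≠ 0
  form : ∀ i j, symForm F (b i) (b j) = 0
  gram : ∀ i j, symForm F (rootMul Δ F (b i)) (b j) = c * G i j

/-- The matrix whose rows are the vectors `b i` and `√(-Δ) b i`. -/
def frameMat (Δ : ℕ) (b : Fin 3 → Idx → F) : Matrix Idx Idx F :=
  Matrix.of (Sum.elim b fun i => rootMul Δ F (b i))

theorem frameMat_row_inl (Δ : ℕ) (b : Fin 3 → Idx → F) (i : Fin 3) :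
    (frameMat Δ b).row (Sum.inl i) = b i := rfl

theorem frameMat_row_inr (Δ : ℕ) (b : Fin 3 → Idx → F) (i : Fin 3) :
    (frameMat Δ b).row (Sum.inr i) = rootMul Δ F (b i) := rfl

/-- The block matrix on the right does not depend on the frame. This is why a change of frame
commutes with √(-Δ). -/
theorem frameMat_mul_rootMat (Δ : ℕ) (b : Fin 3 → Idx → F) :
    frameMat Δ b * rootMat Δ F = fromBlocks 0 1 (-((Δ : F) • 1)) 0 * frameMat Δ b := by
  ext i j
  have h : (frameMat Δ b * rootMat Δ F) i j = rootMul Δ F ((frameMat Δ b).row i) j := rfl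
  have e1 (i j) : frameMat Δ b (Sum.inl i) j = b i j := rfl
  have e2 (i j) : frameMat Δ b (Sum.inr i) j = rootMul Δ F (b i) j := rfl
  rw [h]
  rcases i with i | i
  · rw [frameMat_row_inl]
    simp [Matrix.mul_apply, fromBlocks, one_apply, e2]
  · rw [frameMat_row_inr, rootMul_rootMul]
    simp [Matrix.mul_apply, fromBlocks, one_apply, e1]

theorem mul_stdJ_mul_transpose_apply (P : Matrix Idx Idx F) (i j : Idx) :
    (P * stdJ F * Pᵀ) i j = symForm F (P.row i) (P.row j) := by
  rw [symForm_apply, Matrix.mul_assoc, Matrix.mul_apply_eq_vecMul, dotProduct_mulVec]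
  rw [← vecMul_vecMul]
  rfl

theorem IsFrame.mul_stdJ_mul_transpose {Δ : ℕ} {G : Matrix (Fin 3) (Fin 3) F} {c : F}
    {b : Fin 3 → Idx → F} (hb : IsFrame Δ G c b) :
    frameMat Δ b * stdJ F * (frameMat Δ b)ᵀ = c • fromBlocks 0 (-Gᵀ) G 0 := by
  ext i j
  rw [mul_stdJ_mul_transpose_apply]
  rcases i with i | i <;> rcases j with j | j
  · simp [frameMat_row_inl, hb.form]
  · rw [frameMat_row_inl, frameMat_row_inr, symForm_swap, hb.gram]
    simp
  · simp [frameMat_row_inl, frameMat_row_inr, hb.gram]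
  · simp [frameMat_row_inr, hb.form, symForm_rootMul_rootMul]

/-- The Gram matrix of the six rows is invertible, so the rows form a basis. -/
theorem IsFrame.isUnit_frameMat {Δ : ℕ} {G : Matrix (Fin 3) (Fin 3) F} {c : F}
    {b : Fin 3 → Idx → F} (hb : IsFrame Δ G c b) (hG : Gᵀ = G) (hGG : G * G = 1) :
    IsUnit (frameMat Δ b) := by
  refine IsUnit.of_mul_eq_one
    (stdJ F * (frameMat Δ b)ᵀ * (-(c⁻¹ • fromBlocks 0 (-G) G 0))) ?_
  rw [← Matrix.mul_assoc, ← Matrix.mul_assoc, hb.mul_stdJ_mul_transpose, hG]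
  rw [Matrix.mul_neg, Matrix.mul_smul, Matrix.smul_mul, smul_smul, inv_mul_cancel₀ hb.ne_zero,
    one_smul, fromBlocks_multiply, ← fromBlocks_one, fromBlocks_neg]
  simp [hGG]

/-- Two frames with proportional Gram matrices are conjugate under the unitary similitudes. -/
theorem IsFrame.exists_similitude {Δ : ℕ} {G : Matrix (Fin 3) (Fin 3) F} {c₁ c₂ : F}
    {b₁ b₂ : Fin 3 → Idx → F} (h₁ : IsFrame Δ G c₁ b₁) (h₂ : IsFrame Δ G c₂ b₂)
    (hG : Gᵀ = G) (hGG : G * G = 1) :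
    ∃ g ∈ GSp F ⊓ rootCentralizer Δ F, ∀ i, b₁ i ᵥ* (g : Matrix Idx Idx F) = b₂ i := by
  obtain ⟨P₁, hP₁⟩ := h₁.isUnit_frameMat hG hGG
  obtain ⟨P₂, hP₂⟩ := h₂.isUnit_frameMat hG hGG
  have e₁ := h₁.mul_stdJ_mul_transpose
  have e₂ := h₂.mul_stdJ_mul_transpose
  have f₁ := frameMat_mul_rootMat Δ b₁
  have f₂ := frameMat_mul_rootMat Δ b₂
  rw [← hP₁] at e₁ f₁
  rw [← hP₂] at e₂ f₂
  have hi : ((P₁⁻¹ : GL Idx F) : Matrix Idx Idx F) * (P₁ : Matrix Idx Idx F) = 1 := by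
    rw [← Units.val_mul, inv_mul_cancel, Units.val_one]
  have hit : (P₁ : Matrix Idx Idx F)ᵀ * ((P₁⁻¹ : GL Idx F) : Matrix Idx Idx F)ᵀ = 1 := by
    rw [← transpose_mul, hi, transpose_one]
  -- The change of basis from the first frame to the second. The Gram matrices of the rows differ by
  -- the factor `c₂ / c₁`, which becomes the multiplier.
  refine ⟨P₁⁻¹ * P₂, ⟨⟨Units.mk0 (c₂ / c₁) (div_ne_zero h₂.ne_zero h₁.ne_zero), ?_⟩, ?_⟩, ?_⟩
  · rw [Units.val_mul, transpose_mul]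
    have e3 : (P₂ : Matrix Idx Idx F) * stdJ F * (P₂ : Matrix Idx Idx F)ᵀ
        = (c₂ / c₁) • ((P₁ : Matrix Idx Idx F) * stdJ F * (P₁ : Matrix Idx Idx F)ᵀ) := by
      rw [e₁, e₂, smul_smul, div_mul_cancel₀ _ h₁.ne_zero]
    calc _ = ((P₁⁻¹ : GL Idx F) : Matrix Idx Idx F) * ((P₂ : Matrix Idx Idx F) * stdJ F
          * (P₂ : Matrix Idx Idx F)ᵀ) * ((P₁⁻¹ : GL Idx F) : Matrix Idx Idx F)ᵀ := by
          simp only [Matrix.mul_assoc]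
      _ = (c₂ / c₁) • ((((P₁⁻¹ : GL Idx F) : Matrix Idx Idx F) * (P₁ : Matrix Idx Idx F))
          * stdJ F * ((P₁ : Matrix Idx Idx F)ᵀ * ((P₁⁻¹ : GL Idx F) : Matrix Idx Idx F)ᵀ)) := by
          rw [e3, Matrix.mul_smul, Matrix.smul_mul]
          simp only [Matrix.mul_assoc]
      _ = _ := by rw [hi, hit, Matrix.one_mul, Matrix.mul_one, Units.val_mk0]
  · change _ = _
    rw [Units.val_mul, Matrix.mul_assoc, f₂, ← Matrix.mul_assoc, ← Matrix.mul_assoc]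
    congr 1
    calc _ = ((P₁⁻¹ : GL Idx F) : Matrix Idx Idx F) * (fromBlocks 0 1 (-((Δ : F) • 1)) 0
          * (P₁ : Matrix Idx Idx F)) * ((P₁⁻¹ : GL Idx F) : Matrix Idx Idx F) := by
          rw [Matrix.mul_assoc, Matrix.mul_assoc, ← Units.val_mul P₁, mul_inv_cancel,
            Units.val_one, Matrix.mul_one]
      _ = _ := by rw [← f₁, ← Matrix.mul_assoc, hi, Matrix.one_mul]
  · intro i
    have r₁ : b₁ i = Pi.single (Sum.inl i) 1 ᵥ* (P₁ : Matrix Idx Idx F) := by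
      rw [single_one_vecMul, hP₁]; rfl
    have r₂ : b₂ i = Pi.single (Sum.inl i) 1 ᵥ* (P₂ : Matrix Idx Idx F) := by
      rw [single_one_vecMul, hP₂]; rfl
    rw [r₁, r₂, vecMul_vecMul, Units.val_mul, ← Matrix.mul_assoc, ← Units.val_mul P₁,
      mul_inv_cancel, Units.val_one, Matrix.one_mul]

theorem rootMul_vecMul {Δ : ℕ} {g : GL Idx F} (hg : g ∈ rootCentralizer Δ F) (x : Idx → F) :
    rootMul Δ F x ᵥ* (g : Matrix Idx Idx F) = rootMul Δ F (x ᵥ* (g : Matrix Idx Idx F)) := by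
  rw [rootMul_apply, rootMul_apply, vecMul_vecMul, vecMul_vecMul, mem_rootCentralizer.1 hg]

end Form

/-! ### Hensel lifting of unitary similitudes from 𝔽_p to ℤ_p -/

section Lift

variable (p : ℕ) [Fact p.Prime]

theorem toZMod_eq_zero_iff (x : ℤ_[p]) : PadicInt.toZMod x = 0 ↔ (p : ℤ_[p]) ∣ x := by
  rw [← RingHom.mem_ker, PadicInt.ker_toZMod, PadicInt.maximalIdeal_eq_span_p,
    Ideal.mem_span_singleton]

theorem toZMod_surjective : Function.Surjective (PadicInt.toZMod : ℤ_[p] →+* ZMod p) :=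
  ZMod.ringHom_surjective _

theorem isUnit_of_toZMod_ne_zero {x : ℤ_[p]} (hx : PadicInt.toZMod x ≠ 0) : IsUnit x := by
  by_contra h
  apply hx
  rw [← RingHom.mem_ker, PadicInt.ker_toZMod]
  exact (IsLocalRing.mem_maximalIdeal x).2 h

/-- A Newton step: an approximate unitary similitude modulo `q` with `p ∣ q` is corrected to one
modulo `q * q`. -/
theorem exists_newton_step {R : Type*} [CommRing R] [IsDomain R] {Δ : ℕ} {q c : R} (hq : q ≠ 0)
    (hc : IsUnit c) (h2 : IsUnit (2 : R)) {g X : Matrix Idx Idx R}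
    (hg : g * rootMat Δ R = rootMat Δ R * g)
    (hX : g * stdJ R * gᵀ = c • stdJ R + q • X) :
    ∃ u Y : Matrix Idx Idx R,
      ((1 + q • u) * g) * rootMat Δ R = rootMat Δ R * ((1 + q • u) * g) ∧
      ((1 + q • u) * g) * stdJ R * ((1 + q • u) * g)ᵀ = c • stdJ R + (q * q) • Y := by
  obtain ⟨c', hc'⟩ := hc.exists_left_inv
  obtain ⟨t, ht⟩ := h2.exists_left_inv
  -- The error `X` inherits antisymmetry and the relation with `rootMat` from `g * stdJ R * gᵀ`,
  -- because `q` can be cancelled in a domain.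
  have hXt : Xᵀ = -X := by
    have e := congrArg Matrix.transpose hX
    simp only [transpose_mul, transpose_add, transpose_smul, transpose_transpose, stdJ_transpose,
      Matrix.mul_neg, Matrix.neg_mul, smul_neg] at e
    rw [← Matrix.mul_assoc, hX] at e
    have e3 : q • (Xᵀ + X) = 0 := by
      rw [neg_add, add_right_inj] at e
      rw [smul_add, ← e, neg_add_cancel]
    have := (smul_eq_zero.1 e3).resolve_left hq
    exact eq_neg_of_add_eq_zero_left this
  have hXA : rootMat Δ R * X = -(X * (rootMat Δ R)ᵀ) := by
    have e1 : rootMat Δ R * (g * stdJ R * gᵀ) = -((g * stdJ R * gᵀ) * (rootMat Δ R)ᵀ) := by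
      have ht := congrArg Matrix.transpose hg
      rw [transpose_mul, transpose_mul] at ht
      calc _ = (rootMat Δ R * g) * stdJ R * gᵀ := by simp only [Matrix.mul_assoc]
        _ = g * (rootMat Δ R * stdJ R) * gᵀ := by rw [← hg]; simp only [Matrix.mul_assoc]
        _ = -(g * stdJ R * ((rootMat Δ R)ᵀ * gᵀ)) := by
            rw [rootMat_mul_stdJ]
            simp only [Matrix.mul_assoc, Matrix.mul_neg, Matrix.neg_mul]
        _ = _ := by rw [ht]; simp only [Matrix.mul_assoc]
    rw [hX, Matrix.mul_add, Matrix.add_mul, Matrix.mul_smul, Matrix.smul_mul, rootMat_mul_stdJ,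
      Matrix.mul_smul, Matrix.smul_mul] at e1
    have e3 : q • (rootMat Δ R * X + X * (rootMat Δ R)ᵀ) = 0 := by
      rw [smul_add]
      rw [smul_neg, neg_add, add_right_inj] at e1
      rw [e1, neg_add_cancel]
    exact eq_neg_of_add_eq_zero_left ((smul_eq_zero.1 e3).resolve_left hq)
  have hcomm : Commute (X * stdJ R) (rootMat Δ R) := by
    change _ = _
    rw [Matrix.mul_assoc, stdJ_mul_rootMat, ← Matrix.mul_assoc, hXA, Matrix.mul_neg,
      Matrix.neg_mul, Matrix.mul_assoc]
  -- This is `X * stdJ R` divided by `2c`. It solves the linearized equation c(uJ + Juᵗ) + X = 0,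
  -- with J for `stdJ R`, and it commutes with √(-Δ) by `hcomm`.
  set u : Matrix Idx Idx R := (t * c') • (X * stdJ R) with hu
  have huJ : c • (u * stdJ R) = -(t • X) := by
    rw [hu, Matrix.smul_mul, Matrix.mul_assoc, stdJ_mul_self, smul_smul, Matrix.mul_neg,
      Matrix.mul_one, smul_neg, show c * (t * c') = t by linear_combination t * hc']
  have hcu : Commute u (rootMat Δ R) := hcomm.smul_left _
  clear_value u
  have hJu : c • (stdJ R * uᵀ) = -(t • X) := by
    have := congrArg Matrix.transpose huJ
    rw [transpose_smul, transpose_mul, stdJ_transpose, transpose_neg, transpose_smul, hXt,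
      Matrix.neg_mul, smul_neg, smul_neg, neg_neg] at this
    rw [← this, neg_neg]
  refine ⟨u, u * X + X * uᵀ + c • (u * stdJ R * uᵀ) + q • (u * X * uᵀ), ?_, ?_⟩
  · have h1 : Commute (1 + q • u) (rootMat Δ R) :=
      (Commute.one_left _).add_left (hcu.smul_left _)
    exact (h1.mul_left hg : Commute _ _)
  · have e1 : ((1 + q • u) * g) * stdJ R * ((1 + q • u) * g)ᵀ
        = (1 + q • u) * (g * stdJ R * gᵀ) * (1 + q • u)ᵀ := by
      rw [transpose_mul]; simp only [Matrix.mul_assoc]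
    have e2 : c • (u * stdJ R) + c • (stdJ R * uᵀ) + X = 0 := by
      rw [huJ, hJu, ← neg_add, ← add_smul, show t + t = 1 by linear_combination ht, one_smul,
        neg_add_cancel]
    rw [e1, hX, transpose_add, transpose_smul, transpose_one]
    have e4 : (1 + q • u) * (c • stdJ R + q • X) * (1 + q • uᵀ)
        = c • stdJ R + q • (c • (u * stdJ R) + c • (stdJ R * uᵀ) + X)
          + (q * q) • (u * X + X * uᵀ + c • (u * stdJ R * uᵀ) + q • (u * X * uᵀ)) := by
      simp only [Matrix.add_mul, Matrix.mul_add, Matrix.one_mul, Matrix.mul_one, Matrix.smul_mul,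
        Matrix.mul_smul, smul_add, smul_smul]
      simp only [mul_comm c q, mul_assoc]
      abel
    rw [e4, e2, smul_zero, add_zero]

/-- A unitary similitude over `𝔽_p` lifts to one over `ℤ_p`. -/
theorem exists_lift_similitude (hp2 : p ≠ 2) {Δ : ℕ} {g : GL Idx (ZMod p)}
    (hg : g ∈ GSp (ZMod p) ⊓ rootCentralizer Δ (ZMod p)) :
    ∃ k ∈ GSp ℤ_[p] ⊓ rootCentralizer Δ ℤ_[p],
      GeneralLinearGroup.map PadicInt.toZMod k = g := by
  obtain ⟨⟨c₀, hc₀⟩, hcomm⟩ := hg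
  obtain ⟨c, hc⟩ := toZMod_surjective p c₀
  have hcu : IsUnit c := isUnit_of_toZMod_ne_zero p (by rw [hc]; exact c₀.ne_zero)
  have hprime : p.Prime := Fact.out
  have h2u : IsUnit (2 : ℤ_[p]) := by
    apply isUnit_of_toZMod_ne_zero p
    rw [map_ofNat]
    intro h
    have : ((2 : ℕ) : ZMod p) = 0 := by exact_mod_cast h
    rw [ZMod.natCast_eq_zero_iff] at this
    exact hp2 ((Nat.prime_dvd_prime_iff_eq hprime Nat.prime_two).1 this)
  obtain ⟨h, k, hgk⟩ := exists_eq_alphaMat (mem_rootCentralizer.1 hcomm)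
  obtain ⟨lift, hlift⟩ := (toZMod_surjective p).hasRightInverse
  -- Lifting `h` and `k` entry by entry keeps the commutation with √(-Δ) exact; only the similitude
  -- equation has to be improved.
  set g₀ : Matrix Idx Idx ℤ_[p] := alphaMat Δ (h.map lift) (k.map lift) with hg₀
  have hmap : g₀.map PadicInt.toZMod = g := by
    have e1 (m : Matrix (Fin 3) (Fin 3) (ZMod p)) : (m.map lift).map PadicInt.toZMod = m := by
      ext i j; simp [hlift _]
    have eE : (E21 ℤ_[p]).map PadicInt.toZMod = E21 (ZMod p) := E21_map _
    rw [hg₀, hgk, alphaMat, alphaMat, fromBlocks_map]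
    congr 1
    · exact e1 h
    · rw [Matrix.map_mul, e1, eE]
    · have e2 : (E21 ℤ_[p] * k.map lift).map PadicInt.toZMod = E21 (ZMod p) * k := by
        rw [Matrix.map_mul, e1, eE]
      ext i j
      have e3 := congrFun (congrFun e2 i) j
      rw [map_apply] at e3
      rw [map_apply, Matrix.neg_apply, Matrix.smul_apply, smul_eq_mul, map_neg, map_mul, e3,
        map_natCast]
      rfl
    · rw [Matrix.map_mul, Matrix.map_mul, e1, eE]
  -- approximate solutions
  let S : ℕ → Set (Matrix Idx Idx ℤ_[p]) := fun n =>
    {m | m * rootMat Δ ℤ_[p] = rootMat Δ ℤ_[p] * m ∧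
      (∀ i j, ‖(m - g₀) i j‖ ≤ (p : ℝ) ^ (-(1 : ℕ) : ℤ)) ∧
      ∀ i j, ‖(m * stdJ ℤ_[p] * mᵀ - c • stdJ ℤ_[p]) i j‖ ≤ (p : ℝ) ^ (-(n + 1 : ℕ) : ℤ)}
  have hnorm (x : ℤ_[p]) (n : ℕ) : ‖x‖ ≤ (p : ℝ) ^ (-(n : ℕ) : ℤ) ↔ (p : ℤ_[p]) ^ n ∣ x := by
    rw [PadicInt.norm_le_pow_iff_mem_span_pow, Ideal.mem_span_singleton]
  have hclosed (n : ℕ) : IsClosed (S n) := by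
    have c1 : IsClosed {m : Matrix Idx Idx ℤ_[p] |
        m * rootMat Δ ℤ_[p] = rootMat Δ ℤ_[p] * m} :=
      isClosed_eq (continuous_id.matrix_mul continuous_const)
        (continuous_const.matrix_mul continuous_id)
    have c2 : IsClosed {m : Matrix Idx Idx ℤ_[p] |
        ∀ i j, ‖(m - g₀) i j‖ ≤ (p : ℝ) ^ (-(1 : ℕ) : ℤ)} := by
      simp only [Set.ofPred_forall]
      refine isClosed_iInter fun i => isClosed_iInter fun j => isClosed_le ?_ continuous_const
      exact ((continuous_id.sub continuous_const).matrix_elem i j).norm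
    have c3 : IsClosed {m : Matrix Idx Idx ℤ_[p] | ∀ i j,
        ‖(m * stdJ ℤ_[p] * mᵀ - c • stdJ ℤ_[p]) i j‖ ≤ (p : ℝ) ^ (-(n + 1 : ℕ) : ℤ)} := by
      simp only [Set.ofPred_forall]
      refine isClosed_iInter fun i => isClosed_iInter fun j => isClosed_le ?_ continuous_const
      exact ((((continuous_id.matrix_mul continuous_const).matrix_mul
        continuous_id.matrix_transpose).sub continuous_const).matrix_elem i j).norm
    exact c1.inter (c2.inter c3)
  have hanti (n : ℕ) : S (n + 1) ⊆ S n := by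
    rintro m ⟨h1, h2, h3⟩
    refine ⟨h1, h2, fun i j => ?_⟩
    have := h3 i j
    rw [hnorm] at this ⊢
    exact (pow_dvd_pow _ (Nat.le_succ _)).trans this
  have hne (n : ℕ) : (S n).Nonempty := by
    induction n with
    | zero =>
      refine ⟨g₀, alphaMat_mul_rootMat _ _ _, fun i j => ?_, fun i j => ?_⟩
      · simp only [sub_self, Matrix.zero_apply, norm_zero]
        positivity
      · rw [hnorm, zero_add, pow_one, ← toZMod_eq_zero_iff]
        have e : (g₀ * stdJ ℤ_[p] * g₀ᵀ).map PadicInt.toZMod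
            = (c • stdJ ℤ_[p]).map PadicInt.toZMod := by
          rw [Matrix.map_mul, Matrix.map_mul, transpose_map, hmap, stdJ_map, hc₀, ← hc]
          ext i j
          have e := congrFun (congrFun (stdJ_map (PadicInt.toZMod : ℤ_[p] →+* ZMod p)) i) j
          rw [map_apply] at e
          simp [e]
        have := congrFun (congrFun e i) j
        simp only [map_apply] at this
        rw [Matrix.sub_apply, map_sub, this, sub_self]
    | succ n ih =>
      obtain ⟨m, h1, h2, h3⟩ := ih
      simp only [hnorm] at h2 h3
      choose X hX using h3
      have hq : (p : ℤ_[p]) ^ (n + 1) ≠ 0 :=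
        pow_ne_zero _ (by exact_mod_cast hprime.ne_zero)
      obtain ⟨u, Y, hu, hY⟩ := exists_newton_step (q := (p : ℤ_[p]) ^ (n + 1)) (X := Matrix.of X)
        hq hcu h2u h1 (by
          ext i j
          have := hX i j
          rw [Matrix.sub_apply] at this
          rw [Matrix.add_apply, Matrix.smul_apply (_ ^ _), of_apply, smul_eq_mul, ← this]
          ring)
      refine ⟨_, hu, fun i j => ?_, fun i j => ?_⟩
      · rw [hnorm, pow_one]
        have e : ((1 + (p : ℤ_[p]) ^ (n + 1) • u) * m - g₀) i j
            = (m - g₀) i j + (p : ℤ_[p]) ^ (n + 1) * (u * m) i j := by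
          simp [Matrix.add_mul]
          ring
        rw [e]
        refine dvd_add (by simpa using h2 i j) (Dvd.dvd.mul_right ?_ _)
        exact dvd_pow_self _ (Nat.succ_ne_zero _)
      · rw [hnorm, hY]
        simp only [add_sub_cancel_left, Matrix.smul_apply, smul_eq_mul]
        refine Dvd.dvd.mul_right ?_ _
        rw [← pow_add]
        -- The Newton step yields precision 2(n + 1), of which only n + 2 is needed.
        exact pow_dvd_pow _ (by omega)
  -- Compactness of the integral matrices replaces a convergence argument: the nested nonempty
  -- closed sets `S n` have a common point.
  have hcompact : IsCompact (Set.univ : Set (Matrix Idx Idx ℤ_[p])) :=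
    (isCompact_univ : IsCompact (Set.univ : Set (Idx → Idx → ℤ_[p])))
  obtain ⟨m, hm⟩ := IsCompact.nonempty_iInter_of_sequence_nonempty_isCompact_isClosed S hanti hne
    (hcompact.of_isClosed_subset (hclosed 0) (Set.subset_univ _)) hclosed
  rw [Set.mem_iInter] at hm
  have hm1 : m * rootMat Δ ℤ_[p] = rootMat Δ ℤ_[p] * m := (hm 0).1
  have hm2 : m.map PadicInt.toZMod = g := by
    rw [← hmap]
    ext i j
    have := (hm 0).2.1 i j
    rw [hnorm, pow_one, ← toZMod_eq_zero_iff, Matrix.sub_apply, map_sub, sub_eq_zero] at this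
    exact this
  have hm3 : m * stdJ ℤ_[p] * mᵀ = c • stdJ ℤ_[p] := by
    rw [← sub_eq_zero]
    ext i j
    rw [Matrix.zero_apply, ← norm_le_zero_iff]
    have hlim : Filter.Tendsto (fun n : ℕ => (p : ℝ) ^ (-(n + 1 : ℕ) : ℤ)) Filter.atTop
        (nhds 0) := by
      have : Filter.Tendsto (fun n : ℕ => ((p : ℝ)⁻¹) ^ (n + 1)) Filter.atTop (nhds 0) := by
        refine (tendsto_pow_atTop_nhds_zero_of_lt_one (by positivity) ?_).comp
          (Filter.tendsto_add_atTop_nat 1)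
        exact inv_lt_one_of_one_lt₀ (by exact_mod_cast hprime.one_lt)
      refine this.congr fun n => ?_
      rw [_root_.zpow_neg, zpow_natCast, inv_pow]
    exact ge_of_tendsto' hlim fun n => (hm n).2.2 i j
  have hdet : IsUnit m := by
    refine IsUnit.of_mul_eq_one (stdJ ℤ_[p] * mᵀ * (-((hcu.unit⁻¹ : ℤ_[p]ˣ) : ℤ_[p]) • stdJ ℤ_[p])) ?_
    rw [← Matrix.mul_assoc, ← Matrix.mul_assoc, hm3, Matrix.mul_smul, Matrix.smul_mul, smul_smul,
      stdJ_mul_self, neg_mul, IsUnit.val_inv_mul, neg_smul, one_smul, neg_neg]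
  obtain ⟨k, rfl⟩ := hdet
  exact ⟨k, ⟨⟨hcu.unit, hm3⟩, hm1⟩, Units.ext hm2⟩

end Lift

/-! ### Lagrangian subspaces and their largest √(-Δ)-stable subspace -/

section Lagrangian

variable {F : Type*} [Field F]

/-- A Lagrangian subspace of the space of row vectors. -/
structure IsLagrangian (W : Submodule F (Idx → F)) : Prop where
  finrank_eq : Module.finrank F W = 3
  isotropic : ∀ x ∈ W, ∀ y ∈ W, symForm F x y = 0

/-- A Lagrangian subspace is its own orthogonal complement, by comparison of dimensions. -/
theorem IsLagrangian.mem_of_forall {W : Submodule F (Idx → F)} (hW : IsLagrangian W)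
    {x : Idx → F} (hx : ∀ y ∈ W, symForm F y x = 0) : x ∈ W := by
  have hle : W ≤ (symForm F).orthogonal W := fun y hy =>
    LinearMap.BilinForm.mem_orthogonal_iff.2 fun n hn => hW.isotropic n hn y hy
  have heq := Submodule.eq_of_le_of_finrank_eq hle (by
    rw [LinearMap.BilinForm.finrank_orthogonal symForm_nondegenerate, hW.finrank_eq]
    simp)
  rw [heq]
  exact LinearMap.BilinForm.mem_orthogonal_iff.2 hx

/-- The symmetric form `x, y ↦ ω(√(-Δ) x, y)`. -/
def rootForm (Δ : ℕ) (F : Type*) [Field F] : LinearMap.BilinForm F (Idx → F) :=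
  (symForm F).compLeft (rootMul Δ F)

theorem rootForm_apply (Δ : ℕ) (x y : Idx → F) :
    rootForm Δ F x y = symForm F (rootMul Δ F x) y := rfl

theorem rootForm_comm (Δ : ℕ) (x y : Idx → F) : rootForm Δ F x y = rootForm Δ F y x :=
  symForm_rootMul_comm _ _ _

variable {Δ : ℕ}

theorem natCast_ne_zero_of_not_isSquare (hΔ : ¬ IsSquare (-(Δ : F))) : (Δ : F) ≠ 0 := by
  intro h
  exact hΔ (by rw [h, neg_zero]; exact IsSquare.zero)

theorem rootMul_injective (hΔ : ¬ IsSquare (-(Δ : F))) :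
    Function.Injective (rootMul Δ F) := by
  rw [injective_iff_map_eq_zero]
  intro x hx
  have h := rootMul_rootMul Δ x
  rw [hx, map_zero, eq_comm, neg_eq_zero] at h
  exact (smul_eq_zero.1 h).resolve_left (natCast_ne_zero_of_not_isSquare hΔ)

theorem eq_zero_of_rootMul_eq_smul (hΔ : ¬ IsSquare (-(Δ : F))) {x : Idx → F} {a : F}
    (hx : rootMul Δ F x = a • x) : x = 0 := by
  by_contra h0
  have h := rootMul_rootMul Δ x
  rw [hx, map_smul, hx, smul_smul, ← neg_smul] at h
  exact hΔ ⟨a, (smul_left_injective F h0 h).symm⟩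

/-- The determinant of √(-Δ) on `M` has square (-Δ) to the power dim M. For odd dimension this would
make -Δ a square. -/
theorem even_finrank_of_stable (hΔ : ¬ IsSquare (-(Δ : F))) {M : Submodule F (Idx → F)}
    (hM : ∀ x ∈ M, rootMul Δ F x ∈ M) : Even (Module.finrank F M) := by
  by_contra hodd
  obtain ⟨k, hk⟩ := Nat.not_even_iff_odd.1 hodd
  set f := (rootMul Δ F).restrict hM
  have hf : f * f = (-(Δ : F)) • LinearMap.id := by
    ext1 x
    apply Subtype.ext
    change rootMul Δ F (rootMul Δ F x) = (-(Δ : F)) • (x : Idx → F)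
    rw [rootMul_rootMul, neg_smul]
  have hd := congrArg LinearMap.det hf
  rw [map_mul, LinearMap.det_smul, LinearMap.det_id, mul_one, hk, pow_succ, mul_comm 2 k,
    pow_mul] at hd
  have h0 := neg_ne_zero.2 (natCast_ne_zero_of_not_isSquare hΔ)
  refine hΔ ⟨LinearMap.det f / (-(Δ : F)) ^ k, ?_⟩
  rw [div_mul_div_comm, hd]
  field_simp

/-- The largest subspace of `W` that is stable under `√(-Δ)`. -/
def stableCore (Δ : ℕ) (W : Submodule F (Idx → F)) : Submodule F (Idx → F) :=
  W ⊓ W.map (rootMul Δ F)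

theorem mem_stableCore (hΔ : ¬ IsSquare (-(Δ : F))) {W : Submodule F (Idx → F)} {x : Idx → F} :
    x ∈ stableCore Δ W ↔ x ∈ W ∧ rootMul Δ F x ∈ W := by
  rw [stableCore, Submodule.mem_inf]
  refine and_congr_right fun hx => ⟨?_, fun h => ?_⟩
  · rintro ⟨y, hy, rfl⟩
    rw [rootMul_rootMul]
    exact W.neg_mem (W.smul_mem _ hy)
  · refine ⟨(-(Δ : F))⁻¹ • rootMul Δ F x, W.smul_mem _ h, ?_⟩
    rw [map_smul, rootMul_rootMul, ← neg_smul, smul_smul,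
      inv_mul_cancel₀ (neg_ne_zero.2 (natCast_ne_zero_of_not_isSquare hΔ)), one_smul]

theorem rootMul_mem_stableCore (hΔ : ¬ IsSquare (-(Δ : F))) {W : Submodule F (Idx → F)}
    {x : Idx → F} (hx : x ∈ stableCore Δ W) : rootMul Δ F x ∈ stableCore Δ W := by
  rw [mem_stableCore hΔ] at hx ⊢
  exact ⟨hx.2, by rw [rootMul_rootMul]; exact W.neg_mem (W.smul_mem _ hx.1)⟩

/-- The dimension formula for W and √(-Δ)W, both of dimension 3. -/
theorem IsLagrangian.finrank_sup_add (hΔ : ¬ IsSquare (-(Δ : F))) {W : Submodule F (Idx → F)}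
    (hW : IsLagrangian W) :
    Module.finrank F (W ⊔ W.map (rootMul Δ F) : Submodule F (Idx → F))
      + Module.finrank F (stableCore Δ W) = 6 := by
  rw [stableCore, Submodule.finrank_sup_add_finrank_inf_eq,
    (Submodule.equivMapOfInjective _ (rootMul_injective hΔ) W).finrank_eq.symm, hW.finrank_eq]

theorem IsLagrangian.finrank_stableCore (hΔ : ¬ IsSquare (-(Δ : F)))
    {W : Submodule F (Idx → F)} (hW : IsLagrangian W) :
    Module.finrank F (stableCore Δ W) = 0 ∨ Module.finrank F (stableCore Δ W) = 2 := by
  obtain ⟨k, hk⟩ : Even (Module.finrank F (stableCore Δ W)) :=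
    even_finrank_of_stable hΔ fun x hx => rootMul_mem_stableCore hΔ hx
  have : Module.finrank F (stableCore Δ W) ≤ Module.finrank F W :=
    Submodule.finrank_mono inf_le_left
  rw [hW.finrank_eq] at this
  omega

theorem IsLagrangian.finrank_sup (hΔ : ¬ IsSquare (-(Δ : F)))
    {W : Submodule F (Idx → F)} (hW : IsLagrangian W) :
    Module.finrank F (W ⊔ W.map (rootMul Δ F) : Submodule F (Idx → F)) = 6 ∨
      Module.finrank F (W ⊔ W.map (rootMul Δ F) : Submodule F (Idx → F)) = 4 := by
  have h1 := hW.finrank_sup_add hΔ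
  have h2 := hW.finrank_stableCore hΔ
  omega

/-- The hypothesis says that √(-Δ)x is orthogonal to W, hence lies in W. So the radical of
`rootForm` on W is contained in the stable core, and a trivial core makes the form nondegenerate on
W. -/
theorem IsLagrangian.mem_stableCore_of_radical (hΔ : ¬ IsSquare (-(Δ : F)))
    {W : Submodule F (Idx → F)} (hW : IsLagrangian W) {x : Idx → F} (hx : x ∈ W)
    (h : ∀ y ∈ W, rootForm Δ F x y = 0) : x ∈ stableCore Δ W := by
  rw [mem_stableCore hΔ]
  refine ⟨hx, hW.mem_of_forall fun y hy => ?_⟩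
  rw [symForm_swap, ← rootForm_apply, h y hy, neg_zero]

/-- Three of the six rows of an invertible matrix are independent, so three rows inside W already
span it. -/
theorem IsFrame.eq_span {G : Matrix (Fin 3) (Fin 3) F} {c : F} {b : Fin 3 → Idx → F}
    (hb : IsFrame Δ G c b) (hG : Gᵀ = G) (hGG : G * G = 1) {W : Submodule F (Idx → F)}
    (hW : IsLagrangian W) {e : Fin 3 → Idx} (he : Function.Injective e)
    (hmem : ∀ i, (frameMat Δ b).row (e i) ∈ W) :
    W = Submodule.span F (Set.range fun i => (frameMat Δ b).row (e i)) := by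
  symm
  apply Submodule.eq_of_le_of_finrank_eq
  · rw [Submodule.span_le]
    rintro _ ⟨i, rfl⟩
    exact hmem i
  · have hli := (Matrix.linearIndependent_rows_iff_isUnit.2
      (hb.isUnit_frameMat hG hGG)).comp e he
    rw [hW.finrank_eq]
    exact (finrank_span_eq_card hli).trans (by simp)

/-- Two Lagrangian subspaces in the same position with respect to frames of the same type are
conjugate under the unitary similitudes. -/
theorem exists_similitude_map_eq {G : Matrix (Fin 3) (Fin 3) F} (hG : Gᵀ = G) (hGG : G * G = 1)
    {e : Fin 3 → Idx} (he : Function.Injective e) {W₁ W₂ : Submodule F (Idx → F)}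
    (hW₁ : IsLagrangian W₁) (hW₂ : IsLagrangian W₂)
    (h₁ : ∃ c b, IsFrame Δ G c b ∧ ∀ i, (frameMat Δ b).row (e i) ∈ W₁)
    (h₂ : ∃ c b, IsFrame Δ G c b ∧ ∀ i, (frameMat Δ b).row (e i) ∈ W₂) :
    ∃ g ∈ GSp F ⊓ rootCentralizer Δ F,
      W₁.map (Matrix.vecMulLinear (g : Matrix Idx Idx F)) = W₂ := by
  obtain ⟨c₁, b₁, f₁, m₁⟩ := h₁
  obtain ⟨c₂, b₂, f₂, m₂⟩ := h₂
  obtain ⟨g, hg, hgb⟩ := f₁.exists_similitude f₂ hG hGG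
  refine ⟨g, hg, ?_⟩
  rw [f₁.eq_span hG hGG hW₁ he m₁, f₂.eq_span hG hGG hW₂ he m₂, Submodule.map_span,
    ← Set.range_comp]
  congr 2
  funext i
  simp only [Function.comp_apply, Matrix.vecMulLinear_apply]
  rcases e i with j | j
  · rw [frameMat_row_inl, frameMat_row_inl, hgb]
  · rw [frameMat_row_inr, frameMat_row_inr, rootMul_vecMul hg.2, hgb]

end Lagrangian

/-! ### Normal forms of Lagrangian subspaces over a finite field of odd characteristic -/

section Frames

variable {F : Type*} [Field F] {Δ : ℕ}

/-- Counting: with q elements in the field, each of the sets of values of ax² and of d - by² has (q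
+ 1)/2 elements, so they meet. -/
theorem exists_mul_sq_add_mul_sq [Fintype F] (h2 : ringChar F ≠ 2) {a b : F} (ha : a ≠ 0) (hb : b ≠ 0)
    (d : F) : ∃ x y, a * x ^ 2 + b * y ^ 2 = d := by
  obtain ⟨x, y, h⟩ := FiniteField.exists_root_sum_quadratic
    (f := Polynomial.C a * Polynomial.X ^ 2)
    (g := Polynomial.C b * Polynomial.X ^ 2 - Polynomial.C d)
    (Polynomial.degree_C_mul_X_pow 2 ha)
    (by
      have h1 := Polynomial.degree_C_mul_X_pow 2 hb
      rw [Polynomial.degree_sub_C (by rw [h1]; norm_num), h1]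
      rfl)
    (FiniteField.odd_card_of_char_ne_two h2)
  refine ⟨x, y, ?_⟩
  simp at h
  linear_combination h

/-- A nondegenerate binary form represents every d. The vector orthogonal to a representing one is
explicit, and its norm is forced up to squares by the discriminant. -/
theorem exists_rotate [Fintype F] (h2 : ringChar F ≠ 2) {u v : Idx → F} {a b d : F} (ha : a ≠ 0)
    (hb : b ≠ 0) (hu : rootForm Δ F u u = a) (hv : rootForm Δ F v v = b)
    (huv : rootForm Δ F u v = 0) : ∃ x y, rootForm Δ F (x • u + y • v) (x • u + y • v) = d ∧
      rootForm Δ F (x • u + y • v) ((-(b * y)) • u + (a * x) • v) = 0 ∧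
      rootForm Δ F ((-(b * y)) • u + (a * x) • v) ((-(b * y)) • u + (a * x) • v)
        = a * b * d := by
  obtain ⟨x, y, h⟩ := exists_mul_sq_add_mul_sq h2 ha hb d
  have hvu : rootForm Δ F v u = 0 := by rw [rootForm_comm, huv]
  refine ⟨x, y, ?_, ?_, ?_⟩ <;>
    simp only [map_add, map_smul, LinearMap.add_apply, LinearMap.smul_apply, smul_eq_mul, hu, hv,
      huv, hvu]
  · linear_combination h
  · ring
  · linear_combination a * b * h

/-- A Lagrangian subspace that spans the whole space over `F(√(-Δ))` has a basis that is
orthogonal for the Hermitian form, with all norms equal. -/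
theorem IsLagrangian.exists_frame_of_eq_bot [Fintype F] (h2 : ringChar F ≠ 2) (hΔ : ¬ IsSquare (-(Δ : F)))
    {W : Submodule F (Idx → F)} (hW : IsLagrangian W) (hL : stableCore Δ W = ⊥) :
    ∃ c b, IsFrame Δ (1 : Matrix (Fin 3) (Fin 3) F) c b ∧
      ∀ i : Fin 3, (frameMat Δ b).row (Sum.inl i) ∈ W := by
  have : Invertible (2 : F) := invertibleOfNonzero (Ring.two_ne_zero h2)
  obtain ⟨v₀, hv₀⟩ := LinearMap.BilinForm.exists_orthogonal_basis
    (B := (rootForm Δ F).restrict W) ⟨fun x y => rootForm_comm Δ _ _⟩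
  let v := v₀.reindex (finCongr hW.finrank_eq)
  have hv (i j) (hij : i ≠ j) : rootForm Δ F (v i) (v j) = 0 := by
    have := hv₀ (i := (finCongr hW.finrank_eq).symm i) (j := (finCongr hW.finrank_eq).symm j)
      (by simpa using hij)
    simpa [v, Module.Basis.reindex_apply] using this
  have hne (i) : rootForm Δ F (v i) (v i) ≠ 0 := by
    intro h0
    have hrad : ∀ y ∈ W, rootForm Δ F (v i) y = 0 := by
      intro y hy
      have e : (rootForm Δ F (v i)) ∘ₗ W.subtype = 0 := by
        refine v.ext fun j => ?_
        by_cases hij : i = j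
        · subst hij; exact h0
        · exact hv i j hij
      exact LinearMap.congr_fun e ⟨y, hy⟩
    have := hW.mem_stableCore_of_radical hΔ (v i).2 hrad
    rw [hL, Submodule.mem_bot] at this
    exact v.ne_zero i (Subtype.ext this)
  set a := rootForm Δ F (v 0) (v 0) with ha
  set b := rootForm Δ F (v 1) (v 1) with hb
  set c := rootForm Δ F (v 2) (v 2) with hc
  -- The common norm has to be abc up to squares, since three equal norms d have discriminant d³.
  -- Two rotations turn the norms (a, b, c) into (d, abd, c) and then into (d, d, d³); dividing the
  -- last vector by d finishes.
  set d := a * b * c with hd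
  have hd0 : d ≠ 0 := mul_ne_zero (mul_ne_zero (hne 0) (hne 1)) (hne 2)
  obtain ⟨x, y, e1, e2, e3⟩ := exists_rotate (d := d) h2 (hne 0) (hne 1) ha.symm hb.symm
    (hv 0 1 (by decide))
  set b₀ := x • (v 0 : Idx → F) + y • (v 1 : Idx → F) with hb₀
  set u := (-(b * y)) • (v 0 : Idx → F) + (a * x) • (v 1 : Idx → F) with hu
  have hu2 : rootForm Δ F u (v 2) = 0 := by
    simp [hu, hv 0 2 (by decide), hv 1 2 (by decide)]
  have hb2 : rootForm Δ F b₀ (v 2) = 0 := by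
    simp [hb₀, hv 0 2 (by decide), hv 1 2 (by decide)]
  obtain ⟨z, t, f1, f2, f3⟩ := exists_rotate (d := d) h2
    (mul_ne_zero (mul_ne_zero (hne 0) (hne 1)) hd0) (hne 2) e3 hc.symm hu2
  set b₁ := z • u + t • (v 2 : Idx → F) with hb₁
  set w := (-(c * t)) • u + (a * b * d * z) • (v 2 : Idx → F) with hw
  have hm₀ : b₀ ∈ W := W.add_mem (W.smul_mem _ (v 0).2) (W.smul_mem _ (v 1).2)
  have hmu : u ∈ W := W.add_mem (W.smul_mem _ (v 0).2) (W.smul_mem _ (v 1).2)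
  have hm₁ : b₁ ∈ W := W.add_mem (W.smul_mem _ hmu) (W.smul_mem _ (v 2).2)
  have hmw : w ∈ W := W.add_mem (W.smul_mem _ hmu) (W.smul_mem _ (v 2).2)
  have g1 : rootForm Δ F b₀ b₁ = 0 := by
    simp only [hb₁, map_add, map_smul, e2, hb2, smul_zero, add_zero]
  have g2 : rootForm Δ F b₀ w = 0 := by
    simp only [hw, map_add, map_smul, e2, hb2, smul_zero, add_zero]
  let bb : Fin 3 → Idx → F := ![b₀, b₁, d⁻¹ • w]
  have hbb : ∀ i, bb i ∈ W := by
    intro i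
    fin_cases i
    · exact hm₀
    · exact hm₁
    · exact W.smul_mem _ hmw
  refine ⟨d, bb, ⟨hd0, fun i j => hW.isotropic _ (hbb i) _ (hbb j), fun i j => ?_⟩, hbb⟩
  rw [← rootForm_apply]
  have g1' : rootForm Δ F b₁ b₀ = 0 := by rw [rootForm_comm, g1]
  have g2' : rootForm Δ F w b₀ = 0 := by rw [rootForm_comm, g2]
  have f2' : rootForm Δ F w b₁ = 0 := by rw [rootForm_comm, f2]
  fin_cases i <;> fin_cases j <;> simp [bb, e1, f1, g1, g2, f2, g1', g2', f2']
  rw [f3]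
  field_simp
  rw [hd]

/-- The Gram matrix of a hyperbolic plane and an orthogonal unit vector. -/
def antidiag (F : Type*) [Field F] : Matrix (Fin 3) (Fin 3) F := !![0, 0, 1; 0, 1, 0; 1, 0, 0]

theorem antidiag_transpose : (antidiag F)ᵀ = antidiag F := by
  ext i j
  fin_cases i <;> fin_cases j <;> rfl

theorem antidiag_mul_self : antidiag F * antidiag F = 1 := by
  ext i j
  fin_cases i <;> fin_cases j <;>
    simp [antidiag, Matrix.mul_apply, Fin.sum_univ_three]

/-- A Lagrangian subspace that contains a line over `F(√(-Δ))` is spanned by that line and by a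
vector orthogonal to a hyperbolic plane that contains the line. -/
theorem IsLagrangian.exists_frame_of_ne_bot (h2 : ringChar F ≠ 2) (hΔ : ¬ IsSquare (-(Δ : F)))
    {W : Submodule F (Idx → F)} (hW : IsLagrangian W) (hL : stableCore Δ W ≠ ⊥) :
    ∃ c b, IsFrame Δ (antidiag F) c b ∧
      ∀ i : Fin 3, (frameMat Δ b).row (![Sum.inl 0, Sum.inr 0, Sum.inl 1] i) ∈ W := by
  obtain ⟨l, hl, hl0⟩ := Submodule.exists_mem_ne_zero_of_ne_bot hL
  have hlA := rootMul_mem_stableCore hΔ hl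
  have hdim := (hW.finrank_stableCore hΔ).resolve_left (by
    rw [Submodule.finrank_eq_zero]; exact hL)
  have hne : ¬ W ≤ stableCore Δ W := by
    intro h
    have := Submodule.finrank_mono h
    rw [hdim, hW.finrank_eq] at this
    omega
  obtain ⟨w, hw, hwL⟩ := Set.not_subset.1 hne
  have hlW := ((mem_stableCore hΔ).1 hl).1
  have hlAW := ((mem_stableCore hΔ).1 hl).2
  have hwA : rootMul Δ F w ∉ W := fun h => hwL ((mem_stableCore hΔ).2 ⟨hw, h⟩)
  have hwl : rootForm Δ F w l = 0 := by
    rw [rootForm_comm, rootForm_apply]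
    exact hW.isotropic _ hlAW _ hw
  have hll : rootForm Δ F l l = 0 := hW.isotropic _ hlAW _ hlW
  have hlfree (α : F) : rootMul Δ F l ≠ α • l := fun h =>
    hl0 (eq_zero_of_rootMul_eq_smul hΔ h)
  -- the plane is spanned by `l` and `√(-Δ) l`
  have hspan : stableCore Δ W = Submodule.span F (Set.range ![l, rootMul Δ F l]) := by
    symm
    apply Submodule.eq_of_le_of_finrank_eq
    · rw [Submodule.span_le]
      rintro _ ⟨i, rfl⟩
      fin_cases i
      · exact hl
      · exact hlA
    · rw [hdim]
      refine (finrank_span_eq_card ?_).trans (by simp)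
      rw [LinearIndependent.pair_iff' hl0]
      exact fun α h => hlfree α h.symm
  have hspanW : W = Submodule.span F {l, rootMul Δ F l, w} := by
    symm
    apply Submodule.eq_of_le_of_finrank_eq
    · rw [Submodule.span_le]
      rintro _ (rfl | rfl | rfl) <;> assumption
    · rw [hW.finrank_eq]
      apply le_antisymm
      · refine (Submodule.finrank_mono (t := W) ?_).trans hW.finrank_eq.le
        rw [Submodule.span_le]
        rintro _ (rfl | rfl | rfl) <;> assumption
      · have hlt : stableCore Δ W < Submodule.span F {l, rootMul Δ F l, w} := by
          refine lt_of_le_of_ne ?_ ?_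
          · rw [hspan]
            refine Submodule.span_mono ?_
            rintro _ ⟨i, rfl⟩
            fin_cases i <;> simp
          · intro h
            apply hwL
            rw [h]
            exact Submodule.subset_span (by simp)
        have := Submodule.finrank_lt_finrank_of_lt hlt
        omega
  -- `w` is orthogonal to the stable plane, so an isotropic `w` would lie in the radical and hence
  -- in the stable core.
  have hc : rootForm Δ F w w ≠ 0 := by
    intro h0
    refine hwL (hW.mem_stableCore_of_radical hΔ hw fun y hy => ?_)
    rw [hspanW] at hy
    have hle : Submodule.span F {l, rootMul Δ F l, w} ≤ LinearMap.ker (rootForm Δ F w) := by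
      rw [Submodule.span_le]
      rintro _ (rfl | rfl | rfl)
      · exact hwl
      · change rootForm Δ F w (rootMul Δ F l) = 0
        rw [rootForm_apply, symForm_rootMul_rootMul, hW.isotropic _ hw _ hlW, mul_zero]
      · exact h0
    exact hle hy
  set c := rootForm Δ F w w with hcdef
  -- a hyperbolic partner of `l`
  have hnot : rootMul Δ F l ∉ Submodule.span F {l, w, rootMul Δ F w} := by
    rw [Submodule.mem_span_triple]
    rintro ⟨α, β, γ, h⟩
    have hγ : γ = 0 := by
      by_contra hγ
      apply hwA
      have : rootMul Δ F w = γ⁻¹ • (rootMul Δ F l - α • l - β • w) := by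
        rw [← h, eq_inv_smul_iff₀ hγ]
        abel
      rw [this]
      exact W.smul_mem _ (W.sub_mem (W.sub_mem hlAW (W.smul_mem _ hlW)) (W.smul_mem _ hw))
    have hβ : β = 0 := by
      by_contra hβ
      apply hwL
      have : w = β⁻¹ • (rootMul Δ F l - α • l) := by
        rw [← h, hγ, eq_inv_smul_iff₀ hβ, zero_smul]
        abel
      rw [this]
      exact Submodule.smul_mem _ _ (Submodule.sub_mem _ hlA (Submodule.smul_mem _ _ hl))
    rw [hγ, hβ, zero_smul, zero_smul, add_zero, add_zero] at h
    exact hlfree α h.symm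
  -- A functional that separates `rootMul Δ F l` from `l`, `w` and `rootMul Δ F w` is represented,
  -- up to scale, by a vector `m₁` that pairs to `c` with the first and to 0 with the others.
  obtain ⟨f, hf, hker⟩ := Submodule.exists_le_ker_of_notMem hnot
  obtain ⟨m₁, hm₁⟩ := ((symForm F).toDual symForm_nondegenerate).surjective
    (-(c / f (rootMul Δ F l)) • f)
  have hm₁' (x) : symForm F x m₁ = c / f (rootMul Δ F l) * f x := by
    have := LinearMap.congr_fun hm₁ x
    rw [LinearMap.BilinForm.toDual_def, LinearMap.smul_apply, smul_eq_mul] at this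
    rw [symForm_swap, this]
    ring
  have k1 : symForm F (rootMul Δ F l) m₁ = c := by rw [hm₁', div_mul_cancel₀ _ hf]
  have k0 {x} (hx : x ∈ ({l, w, rootMul Δ F w} : Set (Idx → F))) : symForm F x m₁ = 0 := by
    rw [hm₁', show f x = 0 from hker (Submodule.subset_span hx), mul_zero]
  have k2 : symForm F l m₁ = 0 := k0 (by simp)
  have k3 : symForm F w m₁ = 0 := k0 (by simp)
  have k4 : symForm F (rootMul Δ F w) m₁ = 0 := k0 (by simp)
  -- Adding a multiple of `l` makes the partner isotropic; `s` solves rootForm(m₁, m₁) + 2cs = 0.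
  set s := -(rootForm Δ F m₁ m₁) / (2 * c) with hs
  have h20 : (2 : F) ≠ 0 := Ring.two_ne_zero h2
  set m := m₁ + s • l with hm
  have hself (x : Idx → F) : symForm F x x = 0 := by
    have := symForm_swap x x
    have h3 : 2 * symForm F x x = 0 := by linear_combination this
    exact (mul_eq_zero.1 h3).resolve_left h20
  have i1 : symForm F l m = 0 := by simp [hm, k2, hself]
  have i2 : symForm F w m = 0 := by simp [hm, k3, hW.isotropic _ hw _ hlW]
  have i3 : rootForm Δ F l m = c := by
    simp only [hm, map_add, map_smul, hll, smul_zero, add_zero]; exact k1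
  have i4 : rootForm Δ F w m = 0 := by
    simp only [hm, map_add, map_smul, hwl, smul_zero, add_zero]; exact k4
  have i5 : rootForm Δ F m m = 0 := by
    have e1 : rootForm Δ F l m₁ = c := k1
    have e2 : rootForm Δ F m₁ l = c := by rw [rootForm_comm, e1]
    simp only [hm, map_add, map_smul, LinearMap.add_apply, LinearMap.smul_apply, smul_eq_mul, e1,
      e2, hll, hs]
    field_simp
    ring
  have i1' : symForm F m l = 0 := by rw [symForm_swap, i1, neg_zero]
  have i2' : symForm F m w = 0 := by rw [symForm_swap, i2, neg_zero]
  have i3' : rootForm Δ F m l = c := by rw [rootForm_comm, i3]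
  have i4' : rootForm Δ F m w = 0 := by rw [rootForm_comm, i4]
  have hlw : rootForm Δ F l w = 0 := by rw [rootForm_comm, hwl]
  refine ⟨c, ![l, w, m], ⟨hc, fun i j => ?_, fun i j => ?_⟩, fun i => ?_⟩
  · fin_cases i <;> fin_cases j <;>
      simp [hself, i1, i2, i1', i2', hW.isotropic _ hw _ hlW, hW.isotropic _ hlW _ hw]
  · rw [← rootForm_apply]
    fin_cases i <;> fin_cases j <;>
      simp [antidiag, i3, i4, i5, i3', i4', hll, hwl, hlw, ← hcdef]
  · fin_cases i
    · exact hlW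
    · exact hlAW
    · exact hw

/-- Two Lagrangian subspaces that span subspaces of the same dimension over `F(√(-Δ))` are
conjugate under the unitary similitudes. -/
theorem IsLagrangian.exists_similitude [Fintype F] (h2 : ringChar F ≠ 2) (hΔ : ¬ IsSquare (-(Δ : F)))
    {W₁ W₂ : Submodule F (Idx → F)} (h₁ : IsLagrangian W₁) (h₂ : IsLagrangian W₂)
    (h : Module.finrank F (W₁ ⊔ W₁.map (rootMul Δ F) : Submodule F (Idx → F))
      = Module.finrank F (W₂ ⊔ W₂.map (rootMul Δ F) : Submodule F (Idx → F))) :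
    ∃ g ∈ GSp F ⊓ rootCentralizer Δ F,
      W₁.map (Matrix.vecMulLinear (g : Matrix Idx Idx F)) = W₂ := by
  have e₁ := h₁.finrank_sup_add hΔ
  have e₂ := h₂.finrank_sup_add hΔ
  have he : Module.finrank F (stableCore Δ W₁) = Module.finrank F (stableCore Δ W₂) := by omega
  by_cases hL : stableCore Δ W₁ = ⊥
  · have hL₂ : stableCore Δ W₂ = ⊥ := by
      rw [← Submodule.finrank_eq_zero (R := F), ← he, Submodule.finrank_eq_zero, hL]
    exact exists_similitude_map_eq transpose_one (Matrix.one_mul 1) Sum.inl_injective h₁ h₂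
      (h₁.exists_frame_of_eq_bot h2 hΔ hL) (h₂.exists_frame_of_eq_bot h2 hΔ hL₂)
  · have hL₂ : stableCore Δ W₂ ≠ ⊥ := by
      rwa [Ne, ← Submodule.finrank_eq_zero (R := F), ← he, Submodule.finrank_eq_zero]
    exact exists_similitude_map_eq antidiag_transpose antidiag_mul_self (by decide) h₁ h₂
      (h₁.exists_frame_of_ne_bot h2 hΔ hL) (h₂.exists_frame_of_ne_bot h2 hΔ hL₂)

end Frames

/-! ### The rational commutant of a generic complex structure -/

section Commutant

/-- The coefficients of the powers of `t` in the matrix `n E₂₁ - 2 wᵗ w`, where `w = (t, t³, 1)` and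
`n = t² + t⁶ - 1`. -/
def boostCoeff : Fin 6 → Matrix (Fin 3) (Fin 3) ℚ :=
  ![-1, !![0, 0, -2; 0, 0, 0; -2, 0, 0], !![-1, 0, 0; 0, 1, 0; 0, 0, -1],
    !![0, 0, 0; 0, 0, -2; 0, -2, 0], !![0, -2, 0; -2, 0, 0; 0, 0, 0],
    !![1, 0, 0; 0, -1, 0; 0, 0, -1]]

/-- The exponents that correspond to the coefficients in `boostCoeff`. -/
def boostExp : Fin 6 → ℕ := ![0, 1, 2, 3, 4, 6]

/-- The matrix `n E₂₁ - 2 wᵗ w`, where `w = (t, t³, 1)` and `n = t² + t⁶ - 1`. -/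
def boostSq (t : ℝ) : Matrix (Fin 3) (Fin 3) ℝ :=
  ∑ k, t ^ boostExp k • (boostCoeff k).map (Rat.castHom ℝ)

/-- The exponents in `boostExp` are distinct, so the sum is the value at `t` of a rational
polynomial with coefficients `c k`. The choice of t and t³ as velocities keeps the monomials of
`boostSq` apart. -/
theorem coeff_eq_zero {t : ℝ} (ht : Transcendental ℚ t) {c : Fin 6 → ℚ}
    (h : ∑ k, t ^ boostExp k * (c k : ℝ) = 0) (k : Fin 6) : c k = 0 := by
  have hinj : Function.Injective boostExp := by decide
  have hq : (∑ k, Polynomial.monomial (boostExp k) (c k)) = 0 := by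
    refine transcendental_iff.1 ht _ ?_
    rw [map_sum, ← h]
    refine Finset.sum_congr rfl fun i _ => ?_
    rw [Polynomial.aeval_monomial, mul_comm]
    rfl
  have := congrArg (fun q => Polynomial.coeff q (boostExp k)) hq
  simpa [Polynomial.finsetSum_coeff, Polynomial.coeff_monomial, hinj.eq_iff] using this

theorem matrix_coeff_eq_zero {t : ℝ} (ht : Transcendental ℚ t)
    {X : Fin 6 → Matrix (Fin 3) (Fin 3) ℚ}
    (h : ∑ k, t ^ boostExp k • (X k).map (Rat.castHom ℝ) = 0) (k : Fin 6) : X k = 0 := by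
  ext i j
  refine coeff_eq_zero ht (c := fun k => X k i j) ?_ k
  have := congrFun (congrFun h i) j
  simpa [Matrix.sum_apply] using this

theorem boostSq_mul_map (t : ℝ) (a : Matrix (Fin 3) (Fin 3) ℚ) :
    boostSq t * a.map (Rat.castHom ℝ)
      = ∑ k, t ^ boostExp k • (boostCoeff k * a).map (Rat.castHom ℝ) := by
  simp only [boostSq, Finset.sum_mul, Matrix.smul_mul, Matrix.map_mul]

theorem map_mul_boostSq (t : ℝ) (a : Matrix (Fin 3) (Fin 3) ℚ) :
    a.map (Rat.castHom ℝ) * boostSq t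
      = ∑ k, t ^ boostExp k • (a * boostCoeff k).map (Rat.castHom ℝ) := by
  simp only [boostSq, Finset.mul_sum, Matrix.mul_smul, Matrix.map_mul]

theorem mul_boostCoeff_eq {t : ℝ} (ht : Transcendental ℚ t) {a d : Matrix (Fin 3) (Fin 3) ℚ}
    (h : a.map (Rat.castHom ℝ) * boostSq t = boostSq t * d.map (Rat.castHom ℝ)) (k : Fin 6) :
    a * boostCoeff k = boostCoeff k * d := by
  rw [← sub_eq_zero]
  refine matrix_coeff_eq_zero ht (X := fun k => a * boostCoeff k - boostCoeff k * d) ?_ k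
  rw [← sub_eq_zero, map_mul_boostSq, boostSq_mul_map, ← Finset.sum_sub_distrib] at h
  rw [← h]
  refine Finset.sum_congr rfl fun i _ => ?_
  rw [← smul_sub]
  congr 1
  ext r s
  simp

/-- Comparison of coefficients turns one real equation into six rational ones. The constant term
gives a = d, the diagonal coefficients force a to be diagonal, and the coefficients of t and t³
identify its diagonal entries. -/
theorem eq_smul_one_of_mul_boostSq {t : ℝ} (ht : Transcendental ℚ t)
    {a d : Matrix (Fin 3) (Fin 3) ℚ}
    (h : a.map (Rat.castHom ℝ) * boostSq t = boostSq t * d.map (Rat.castHom ℝ)) :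
    a = d ∧ ∃ r : ℚ, a = r • 1 := by
  have key := mul_boostCoeff_eq ht h
  have h0 : a = d := by
    have := key 0
    simpa [boostCoeff] using this
  subst h0
  refine ⟨rfl, a 0 0, ?_⟩
  have e1 := key 1
  have e2 := key 2
  have e3 := key 3
  have e6 := key 5
  simp only [boostCoeff] at e1 e2 e3 e6
  rw [← Matrix.ext_iff] at e1 e2 e3 e6 ⊢
  simp [Fin.forall_fin_succ, Matrix.mul_apply, Fin.sum_univ_three] at e1 e2 e3 e6 ⊢
  refine ⟨⟨?_, ?_⟩, ⟨?_, ?_, ?_⟩, ?_, ?_, ?_⟩ <;> linarith [e1, e2, e3, e6]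

/-- A rational matrix that commutes with the complex structure attached to a generic boost lies
in `ℚ(√(-Δ))`. -/
theorem exists_eq_add_rootMat {Δ : ℕ} (hΔ : 0 < Δ) {t : ℝ} (ht : Transcendental ℚ t)
    {C : Matrix Idx Idx ℚ}
    (h : C.map (Rat.castHom ℝ) * fromBlocks 0 (boostSq t)
        (-((Δ : ℝ) • (E21 ℝ * boostSq t * E21 ℝ))) 0
      = fromBlocks 0 (boostSq t) (-((Δ : ℝ) • (E21 ℝ * boostSq t * E21 ℝ))) 0
        * C.map (Rat.castHom ℝ)) :
    ∃ r s : ℚ, C = r • 1 + s • rootMat Δ ℚ := by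
  have hΔ0 : (Δ : ℚ) ≠ 0 := by exact_mod_cast hΔ.ne'
  have eE : (E21 ℚ).map (Rat.castHom ℝ) = E21 ℝ := E21_map _
  rw [← fromBlocks_toBlocks C] at h ⊢
  rw [fromBlocks_map, fromBlocks_multiply, fromBlocks_multiply, fromBlocks_inj] at h
  simp only [Matrix.mul_zero, Matrix.zero_mul, zero_add, add_zero] at h
  obtain ⟨h11, h12, -, -⟩ := h
  obtain ⟨had, r, hr⟩ := eq_smul_one_of_mul_boostSq ht h12
  -- The equation between the off-diagonal blocks takes the same shape as the one for the diagonal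
  -- blocks after multiplication by `E21`.
  have h' : (-((Δ : ℚ) • (C.toBlocks₁₂ * E21 ℚ))).map (Rat.castHom ℝ) * boostSq t
      = boostSq t * (C.toBlocks₂₁ * E21 ℚ).map (Rat.castHom ℝ) := by
    have e : (-((Δ : ℚ) • (C.toBlocks₁₂ * E21 ℚ))).map (Rat.castHom ℝ)
        = -((Δ : ℝ) • (C.toBlocks₁₂.map (Rat.castHom ℝ) * E21 ℝ)) := by
      rw [← eE, ← Matrix.map_mul]
      ext i j
      simp
    rw [e, Matrix.map_mul, eE, ← Matrix.mul_assoc, ← h11]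
    simp only [Matrix.mul_assoc, Matrix.neg_mul, Matrix.mul_neg, Matrix.smul_mul, Matrix.mul_smul,
      E21_mul_self, Matrix.mul_one]
  obtain ⟨hbc, s, hs⟩ := eq_smul_one_of_mul_boostSq ht h'
  rw [hs] at hbc
  refine ⟨r, -s / Δ, ?_⟩
  rw [rootMat_eq, ← fromBlocks_one, fromBlocks_smul, fromBlocks_smul, fromBlocks_add]
  congr 1
  · rw [hr, smul_zero, add_zero]
  · have : C.toBlocks₁₂ = (-(Δ : ℚ)⁻¹) • (-((Δ : ℚ) • (C.toBlocks₁₂ * E21 ℚ))) * E21 ℚ := by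
      rw [smul_neg, neg_smul, neg_neg, smul_smul, inv_mul_cancel₀ hΔ0, one_smul,
        Matrix.mul_assoc, E21_mul_self, Matrix.mul_one]
    rw [this, hs, smul_smul, Matrix.smul_mul, Matrix.one_mul, smul_zero, zero_add]
    congr 1
    field_simp
  · have : C.toBlocks₂₁ = C.toBlocks₂₁ * E21 ℚ * E21 ℚ := by
      rw [Matrix.mul_assoc, E21_mul_self, Matrix.mul_one]
    rw [this, ← hbc, Matrix.smul_mul, Matrix.one_mul, smul_zero, zero_add, smul_neg, smul_smul,
      ← neg_smul]
    congr 1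
    field_simp
  · rw [← had, hr, smul_zero, add_zero]

end Commutant

/-! ### Lorentz boosts and a generic point of 𝒟_V -/

section Generic

theorem E21_eq (R : Type*) [CommRing R] : E21 R = !![1, 0, 0; 0, 1, 0; 0, 0, -1] := by
  ext i j
  fin_cases i <;> fin_cases j <;> simp [E21]

/-- The Lorentz boost with velocity `(x, y)` and Lorentz factor `γ`. -/
def boost (x y γ : ℝ) : Matrix (Fin 3) (Fin 3) ℝ :=
  !![1 + γ ^ 2 / (1 + γ) * x ^ 2, γ ^ 2 / (1 + γ) * x * y, γ * x;
    γ ^ 2 / (1 + γ) * x * y, 1 + γ ^ 2 / (1 + γ) * y ^ 2, γ * y;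
    γ * x, γ * y, γ]

theorem boost_transpose (x y γ : ℝ) : (boost x y γ)ᵀ = boost x y γ := by
  ext i j
  fin_cases i <;> fin_cases j <;> rfl

theorem boost_isometry {x y γ : ℝ} (h0 : 0 < γ) (h : γ ^ 2 * (1 - x ^ 2 - y ^ 2) = 1) :
    boost x y γ * E21 ℝ * boost x y γ = E21 ℝ := by
  have hγ : 1 + γ ≠ 0 := by positivity
  obtain ⟨κ, hκ⟩ : ∃ κ, κ = γ ^ 2 / (1 + γ) := ⟨_, rfl⟩
  have r2 : κ * (1 + γ) = γ ^ 2 := by rw [hκ, div_mul_cancel₀ _ hγ]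
  have r1 : κ * (x ^ 2 + y ^ 2) = γ - 1 := by
    apply mul_right_cancel₀ hγ
    linear_combination (x ^ 2 + y ^ 2) * r2 - h
  rw [boost, ← hκ, E21_eq]
  ext i j
  fin_cases i <;> fin_cases j <;>
    simp [Matrix.mul_apply, Fin.sum_univ_three]
  · linear_combination x ^ 2 * κ * r1 + x ^ 2 * r2
  · linear_combination x * y * κ * r1 + x * y * r2
  · linear_combination γ * x * r1
  · linear_combination x * y * κ * r1 + x * y * r2
  · linear_combination y ^ 2 * κ * r1 + y ^ 2 * r2
  · linear_combination γ * y * r1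
  · linear_combination γ * x * r1
  · linear_combination γ * y * r1
  · linear_combination -h

/-- The boost itself involves γ, but its square is polynomial in `t` up to the scalar -γ². Since
`hVMat` is conjugated to a matrix in h², only this square matters. -/
theorem boost_mul_self {t γ : ℝ} (h0 : 0 < γ)
    (h : γ ^ 2 * (1 - t ^ 2 - (t ^ 3) ^ 2) = 1) :
    boost t (t ^ 3) γ * boost t (t ^ 3) γ = (-γ ^ 2) • boostSq t := by
  have hγ : 1 + γ ≠ 0 := by positivity
  obtain ⟨κ, hκ⟩ : ∃ κ, κ = γ ^ 2 / (1 + γ) := ⟨_, rfl⟩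
  have r2 : κ * (1 + γ) = γ ^ 2 := by rw [hκ, div_mul_cancel₀ _ hγ]
  have r1 : κ * (t ^ 2 + (t ^ 3) ^ 2) = γ - 1 := by
    apply mul_right_cancel₀ hγ
    linear_combination (t ^ 2 + (t ^ 3) ^ 2) * r2 - h
  rw [boost, ← hκ]
  ext i j
  fin_cases i <;> fin_cases j <;>
    simp [boostSq, boostCoeff, boostExp, Matrix.mul_apply, Fin.sum_univ_succ]
  · linear_combination t ^ 2 * κ * r1 + t ^ 2 * r2 - h
  · linear_combination t * t ^ 3 * κ * r1 + t * t ^ 3 * r2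
  · linear_combination γ * t * r1
  · linear_combination t * t ^ 3 * κ * r1 + t * t ^ 3 * r2
  · linear_combination t ^ 6 * κ * r1 + t ^ 6 * r2 - h
  · linear_combination γ * t ^ 3 * r1
  · linear_combination γ * t * r1
  · linear_combination γ * t ^ 3 * r1
  · ring

/-- The element `α(h)` of the unitary group attached to a symmetric isometry `h`. -/
def symmIsometry (Δ : ℕ) (h : Matrix (Fin 3) (Fin 3) ℝ) (hh : h * E21 ℝ * h = E21 ℝ) :
    GL Idx ℝ where
  val := alphaMat Δ h 0
  inv := alphaMat Δ (E21 ℝ * h * E21 ℝ) 0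
  val_inv := by
    rw [alphaMat, alphaMat, fromBlocks_multiply, ← fromBlocks_one]
    have e : h * (E21 ℝ * h * E21 ℝ) = 1 := by
      rw [← Matrix.mul_assoc, ← Matrix.mul_assoc, hh, E21_mul_self]
    have e' : E21 ℝ * h * E21 ℝ * h = 1 := by
      rw [Matrix.mul_assoc, Matrix.mul_assoc, ← Matrix.mul_assoc h, hh, E21_mul_self]
    congr 1 <;> simp [Matrix.mul_assoc]
    all_goals first | simpa [Matrix.mul_assoc] using e | simpa [Matrix.mul_assoc] using e'
  inv_val := by
    rw [alphaMat, alphaMat, fromBlocks_multiply, ← fromBlocks_one]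
    have e : h * (E21 ℝ * h * E21 ℝ) = 1 := by
      rw [← Matrix.mul_assoc, ← Matrix.mul_assoc, hh, E21_mul_self]
    have e' : E21 ℝ * h * E21 ℝ * h = 1 := by
      rw [Matrix.mul_assoc, Matrix.mul_assoc, ← Matrix.mul_assoc h, hh, E21_mul_self]
    congr 1 <;> simp [Matrix.mul_assoc]
    all_goals first | simpa [Matrix.mul_assoc] using e | simpa [Matrix.mul_assoc] using e'

theorem hVMat_eq {Δ : ℕ} (hΔ : 0 < Δ) :
    hVMat Δ = fromBlocks 0 ((Real.sqrt Δ)⁻¹ • 1) (-(Real.sqrt Δ • 1)) 0 := by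
  have h0 : (0 : ℝ) < Δ := by exact_mod_cast hΔ
  have : (Δ : ℝ) * (Real.sqrt Δ)⁻¹ = Real.sqrt Δ := by
    rw [← div_eq_mul_inv, Real.div_sqrt]
  simp [hVMat, alphaMat, smul_smul, this]

/-- The dilation `diag(1, √Δ)`. -/
def dilation (Δ : ℕ) (hΔ : 0 < Δ) : GL Idx ℝ where
  val := fromBlocks 1 0 0 (Real.sqrt Δ • 1)
  inv := fromBlocks 1 0 0 ((Real.sqrt Δ)⁻¹ • 1)
  val_inv := by
    have : Real.sqrt Δ ≠ 0 := (Real.sqrt_pos.2 (by exact_mod_cast hΔ)).ne'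
    simp [fromBlocks_multiply, smul_smul, this]
  inv_val := by
    have : Real.sqrt Δ ≠ 0 := (Real.sqrt_pos.2 (by exact_mod_cast hΔ)).ne'
    simp [fromBlocks_multiply, smul_smul, this]

/-- This places the base point of 𝒟_V in the Siegel domain. -/
theorem dilation_mul_hX {Δ : ℕ} (hΔ : 0 < Δ) :
    ((dilation Δ hΔ * hX * (dilation Δ hΔ)⁻¹ : GL Idx ℝ) : Matrix Idx Idx ℝ) = hVMat Δ := by
  rw [hVMat_eq hΔ]
  change fromBlocks 1 0 0 (Real.sqrt Δ • 1) * fromBlocks 0 1 (-1) 0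
    * fromBlocks 1 0 0 ((Real.sqrt Δ)⁻¹ • 1) = _
  simp [fromBlocks_multiply]

theorem dilation_mem {Δ : ℕ} (hΔ : 0 < Δ) : dilation Δ hΔ ∈ GSpPos ℝ := by
  refine ⟨Real.sqrt Δ, Real.sqrt_pos.2 (by exact_mod_cast hΔ), ?_⟩
  change fromBlocks 1 0 0 (Real.sqrt Δ • 1) * stdJ ℝ * (fromBlocks 1 0 0 (Real.sqrt Δ • 1))ᵀ = _
  simp [stdJ, fromBlocks_multiply, fromBlocks_transpose, fromBlocks_smul]

theorem symmIsometry_mem {Δ : ℕ} {h : Matrix (Fin 3) (Fin 3) ℝ} (hh : h * E21 ℝ * h = E21 ℝ)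
    (ht : hᵀ = h) : symmIsometry Δ h hh ∈ GV Δ ℝ :=
  ⟨h, 0, 1, rfl, by simp [ht, hh], by simp⟩

theorem symmIsometry_mem_GSpPos {Δ : ℕ} {h : Matrix (Fin 3) (Fin 3) ℝ}
    (hh : h * E21 ℝ * h = E21 ℝ) (ht : hᵀ = h) : symmIsometry Δ h hh ∈ GSpPos ℝ :=
  ⟨1, one_pos, (alphaMat_similitude_iff Δ h 0 1).2 (by simp [ht, hh])⟩

theorem symmIsometry_conj {Δ : ℕ} (hΔ : 0 < Δ) {h : Matrix (Fin 3) (Fin 3) ℝ}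
    (hh : h * E21 ℝ * h = E21 ℝ) :
    (symmIsometry Δ h hh : Matrix Idx Idx ℝ) * hVMat Δ
        * ((symmIsometry Δ h hh)⁻¹ : GL Idx ℝ)
      = (Real.sqrt Δ)⁻¹ • fromBlocks 0 (h * h)
        (-((Δ : ℝ) • (E21 ℝ * (h * h) * E21 ℝ))) 0 := by
  have : (Real.sqrt Δ)⁻¹ * (Δ : ℝ) = Real.sqrt Δ := by
    rw [mul_comm, ← div_eq_mul_inv, Real.div_sqrt]
  rw [hVMat_eq hΔ]
  change alphaMat Δ h 0 * _ * alphaMat Δ (E21 ℝ * h * E21 ℝ) 0 = _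
  simp [alphaMat, fromBlocks_multiply, fromBlocks_smul, Matrix.mul_assoc, smul_smul, this]

theorem hVMat_commute (Δ : ℕ) : hVMat Δ * rootMat Δ ℝ = rootMat Δ ℝ * hVMat Δ :=
  alphaMat_mul_rootMat _ _ _

theorem commute_of_mem_picardDomain {Δ : ℕ} {J : GL Idx ℝ} (hJ : J ∈ picardDomain Δ) :
    Commute (J : Matrix Idx Idx ℝ) (rootMat Δ ℝ) := by
  obtain ⟨g, hg, e⟩ := hJ
  rw [mem_GV_iff] at hg
  have hg' : Commute (g : Matrix Idx Idx ℝ) (rootMat Δ ℝ) := hg.2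
  have hi : Commute ((g⁻¹ : GL Idx ℝ) : Matrix Idx Idx ℝ) (rootMat Δ ℝ) :=
    (rootCentralizer Δ ℝ).inv_mem hg.2
  rw [e]
  exact (hg'.mul_left (hVMat_commute Δ)).mul_left hi

/-- The trace is constant on the conjugacy class, and it is nonzero because `E21` has trace 1: the
signature (2, 1) is not balanced. Its sign distinguishes √(-Δ) from its conjugate. -/
theorem trace_of_mem_picardDomain {Δ : ℕ} (hΔ : 0 < Δ) {J : GL Idx ℝ}
    (hJ : J ∈ picardDomain Δ) :
    trace ((J : Matrix Idx Idx ℝ) * rootMat Δ ℝ) = -(2 * Real.sqrt Δ) := by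
  obtain ⟨g, hg, e⟩ := hJ
  rw [mem_GV_iff] at hg
  have h0 : (Real.sqrt Δ)⁻¹ * (Δ : ℝ) = Real.sqrt Δ := by
    rw [mul_comm, ← div_eq_mul_inv, Real.div_sqrt]
  have hi : Commute ((g⁻¹ : GL Idx ℝ) : Matrix Idx Idx ℝ) (rootMat Δ ℝ) :=
    (rootCentralizer Δ ℝ).inv_mem hg.2
  have hinv : ((g⁻¹ : GL Idx ℝ) : Matrix Idx Idx ℝ) * (g : Matrix Idx Idx ℝ) = 1 := by
    rw [← Units.val_mul, inv_mul_cancel, Units.val_one]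
  have e1 : trace ((J : Matrix Idx Idx ℝ) * rootMat Δ ℝ) = trace (hVMat Δ * rootMat Δ ℝ) := by
    rw [e, Matrix.mul_assoc, hi.eq, ← Matrix.mul_assoc, trace_mul_comm, ← Matrix.mul_assoc,
      ← Matrix.mul_assoc, hinv, Matrix.one_mul]
  rw [e1, hVMat_eq hΔ, rootMat_eq, fromBlocks_multiply]
  simp [E21, Matrix.trace, Fintype.sum_sum_type, Fin.sum_univ_three]
  linear_combination -h0

/-- A generic point of `𝒟_V`: a rational matrix that conjugates it into `𝒟_V` commutes with
`√(-Δ)`. -/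
theorem exists_generic_point {Δ : ℕ} (hΔ : 0 < Δ) :
    ∃ J ∈ picardDomain Δ, J ∈ siegelDomain ∧ ∀ δ : GL Idx ℚ,
      (realEmb δ)⁻¹ * J * realEmb δ ∈ picardDomain Δ → δ ∈ rootCentralizer Δ ℚ := by
  -- Algebraic numbers are countable, so transcendental ones are dense. The bound 1/2 keeps the
  -- velocity (t, t³) inside the unit disc.
  obtain ⟨t, ht, ht0, ht1⟩ : ∃ t : ℝ, Transcendental ℚ t ∧ 0 < t ∧ t < 1 / 2 := by
    have hc : {x : ℝ | IsAlgebraic ℚ x}.Countable := Algebraic.countable ℚ ℝ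
    obtain ⟨t, h1, h2, h3⟩ := (hc.dense_compl ℝ).exists_between
      (show (0 : ℝ) < 1 / 2 by norm_num)
    exact ⟨t, h1, h2, h3⟩
  have hn : 0 < 1 - t ^ 2 - (t ^ 3) ^ 2 := by
    have h1 : t ^ 2 < 1 / 4 := by nlinarith
    have h2 : t ^ 3 < 1 / 2 := by nlinarith [sq_nonneg t]
    have h3 : 0 < t ^ 3 := by positivity
    nlinarith
  obtain ⟨γ, hγ⟩ : ∃ γ, γ = (Real.sqrt (1 - t ^ 2 - (t ^ 3) ^ 2))⁻¹ := ⟨_, rfl⟩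
  have hγ0 : 0 < γ := by rw [hγ]; exact inv_pos.2 (Real.sqrt_pos.2 hn)
  have hγ1 : γ ^ 2 * (1 - t ^ 2 - (t ^ 3) ^ 2) = 1 := by
    rw [hγ, inv_pow, Real.sq_sqrt hn.le, inv_mul_cancel₀ hn.ne']
  have hh := boost_isometry hγ0 hγ1
  have hhh := boost_mul_self hγ0 hγ1
  set h := boost t (t ^ 3) γ
  have hht : hᵀ = h := boost_transpose _ _ _
  set g := symmIsometry Δ h hh with hg
  set D := dilation Δ hΔ with hD
  have hJmat : ((g * (D * hX * D⁻¹) * g⁻¹ : GL Idx ℝ) : Matrix Idx Idx ℝ)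
      = (g : Matrix Idx Idx ℝ) * hVMat Δ * ((g⁻¹ : GL Idx ℝ) : Matrix Idx Idx ℝ) := by
    rw [Units.val_mul, Units.val_mul, hD, dilation_mul_hX]
  have hJp : g * (D * hX * D⁻¹) * g⁻¹ ∈ picardDomain Δ := ⟨g, symmIsometry_mem hh hht, hJmat⟩
  refine ⟨g * (D * hX * D⁻¹) * g⁻¹, hJp, ⟨g * D,
    mul_mem (symmIsometry_mem_GSpPos hh hht) (dilation_mem hΔ), by group⟩, fun δ hδ => ?_⟩
  set J := g * (D * hX * D⁻¹) * g⁻¹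
  have hJ : (J : Matrix Idx Idx ℝ) = (-(γ ^ 2 * (Real.sqrt Δ)⁻¹)) • fromBlocks 0 (boostSq t)
      (-((Δ : ℝ) • (E21 ℝ * boostSq t * E21 ℝ))) 0 := by
    rw [hJmat, symmIsometry_conj hΔ, hhh, fromBlocks_smul, fromBlocks_smul]
    congr 1 <;> simp [smul_smul, mul_assoc, mul_comm]
  have hcoef : -(γ ^ 2 * (Real.sqrt Δ)⁻¹) ≠ 0 := by
    have : (0 : ℝ) < Real.sqrt Δ := Real.sqrt_pos.2 (by exact_mod_cast hΔ)
    exact neg_ne_zero.2 (by positivity)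
  -- the rational matrix `δ √(-Δ) δ⁻¹` commutes with `J`
  obtain ⟨A, hA⟩ : ∃ A : GL Idx ℚ, (A : Matrix Idx Idx ℚ) = rootMat Δ ℚ := by
    have hΔ0 : (Δ : ℚ) ≠ 0 := by exact_mod_cast hΔ.ne'
    have : IsUnit (rootMat Δ ℚ) := IsUnit.of_mul_eq_one (-((Δ : ℚ)⁻¹ • rootMat Δ ℚ)) (by
      rw [Matrix.mul_neg, Matrix.mul_smul, rootMat_mul_self, smul_neg, neg_neg, smul_smul,
        inv_mul_cancel₀ hΔ0, one_smul])
    exact this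
  have hAr : ((realEmb A : GL Idx ℝ) : Matrix Idx Idx ℝ) = rootMat Δ ℝ := by
    rw [← rootMat_map (Rat.castHom ℝ), ← hA]
    rfl
  have hcomm' : Commute ((realEmb δ)⁻¹ * J * realEmb δ) (realEmb A) := by
    apply Units.ext
    have := commute_of_mem_picardDomain hδ
    rw [← hAr] at this
    exact this
  have hcomm : Commute (realEmb (δ * A * δ⁻¹)) J := by
    have e : (realEmb δ)⁻¹ * J * realEmb δ * realEmb A
        = realEmb A * ((realEmb δ)⁻¹ * J * realEmb δ) := hcomm'
    have : realEmb δ * ((realEmb δ)⁻¹ * J * realEmb δ * realEmb A) * (realEmb δ)⁻¹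
        = realEmb δ * (realEmb A * ((realEmb δ)⁻¹ * J * realEmb δ)) * (realEmb δ)⁻¹ := by rw [e]
    change _ = _
    rw [map_mul, map_mul, map_inv]
    calc _ = realEmb δ * (realEmb A * ((realEmb δ)⁻¹ * J * realEmb δ)) * (realEmb δ)⁻¹ := by group
      _ = _ := by rw [← this]; group
  have hcommM : ((δ * A * δ⁻¹ : GL Idx ℚ) : Matrix Idx Idx ℚ).map (Rat.castHom ℝ)
      * (J : Matrix Idx Idx ℝ)
      = J * ((δ * A * δ⁻¹ : GL Idx ℚ) : Matrix Idx Idx ℚ).map (Rat.castHom ℝ) :=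
    congrArg Units.val hcomm
  rw [hJ, Matrix.mul_smul, Matrix.smul_mul] at hcommM
  obtain ⟨r, s, hrs⟩ := exists_eq_add_rootMat hΔ ht (smul_right_injective _ hcoef hcommM)
  have hsq : ((δ * A * δ⁻¹ : GL Idx ℚ) : Matrix Idx Idx ℚ)
      * ((δ * A * δ⁻¹ : GL Idx ℚ) : Matrix Idx Idx ℚ) = -((Δ : ℚ) • 1) := by
    have e1 : (δ * A * δ⁻¹) * (δ * A * δ⁻¹) = δ * (A * A) * δ⁻¹ := by group
    rw [← Units.val_mul, e1, Units.val_mul, Units.val_mul, Units.val_mul, hA, rootMat_mul_self,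
      Matrix.mul_neg, Matrix.mul_smul, Matrix.mul_one, Matrix.neg_mul, Matrix.smul_mul,
      ← Units.val_mul, mul_inv_cancel, Units.val_one]
  have hΔ0 : (0 : ℚ) < Δ := by exact_mod_cast hΔ
  -- With A for √(-Δ), the square of r + sA is again -Δ. This leaves r = 0 and s = ±1, because s = 0
  -- would require r² = -Δ.
  have hquad : (r ^ 2 - Δ * s ^ 2 + Δ) • (1 : Matrix Idx Idx ℚ) + (2 * r * s) • rootMat Δ ℚ
      = 0 := by
    rw [hrs, Matrix.add_mul, Matrix.mul_add, Matrix.mul_add] at hsq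
    simp only [Matrix.smul_mul, Matrix.mul_smul, Matrix.one_mul, Matrix.mul_one,
      rootMat_mul_self] at hsq
    rw [← sub_eq_zero] at hsq
    rw [← hsq]
    module
  have hq1 : r ^ 2 - Δ * s ^ 2 + Δ = 0 := by
    have := congrFun (congrFun hquad (Sum.inl 0)) (Sum.inl 0)
    simpa [rootMat_eq] using this
  have hq2 : r * s = 0 := by
    have := congrFun (congrFun hquad (Sum.inl 0)) (Sum.inr 0)
    simpa [rootMat_eq, E21] using this
  have hs : s ^ 2 = 1 ∧ r = 0 := by
    rcases mul_eq_zero.1 hq2 with h0 | h0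
    · refine ⟨?_, h0⟩
      rw [h0] at hq1
      have : (Δ : ℚ) * (s ^ 2 - 1) = 0 := by linear_combination -hq1
      have := (mul_eq_zero.1 this).resolve_left hΔ0.ne'
      linarith
    · rw [h0] at hq1
      nlinarith [sq_nonneg r]
  rw [hs.2, zero_smul, zero_add] at hrs
  have hδA : (δ : Matrix Idx Idx ℚ) * rootMat Δ ℚ = s • (rootMat Δ ℚ * δ) := by
    rw [← Matrix.smul_mul, ← hrs, ← hA, ← Units.val_mul, ← Units.val_mul]
    congr 1
    group
  have hs2 : (s - 1) * (s + 1) = 0 := by linear_combination hs.1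
  rcases mul_eq_zero.1 hs2 with h1 | h1
  · rw [sub_eq_zero.1 h1, one_smul] at hδA
    exact hδA
  -- Here s = -1, so `δ` anticommutes with √(-Δ) and conjugation by it would change the sign of the
  -- nonzero trace.
  · exfalso
    rw [eq_neg_of_add_eq_zero_left h1, neg_smul, one_smul] at hδA
    have e1 : ((realEmb δ : GL Idx ℝ) : Matrix Idx Idx ℝ) * rootMat Δ ℝ
        = -(rootMat Δ ℝ * (realEmb δ : GL Idx ℝ)) := by
      have := congrArg (fun m => m.map (Rat.castHom ℝ)) hδA
      simp only [Matrix.map_mul, rootMat_map] at this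
      rw [Matrix.map_neg _ (map_neg _), Matrix.map_mul, rootMat_map] at this
      exact this
    have t1 := trace_of_mem_picardDomain hΔ hδ
    have t2 := trace_of_mem_picardDomain hΔ hJp
    rw [Units.val_mul, Units.val_mul, Matrix.mul_assoc, e1, Matrix.mul_neg, trace_neg,
      Matrix.mul_assoc, trace_mul_comm, Matrix.mul_assoc, Matrix.mul_assoc, ← Units.val_mul,
      mul_inv_cancel, Units.val_one, Matrix.mul_one] at t1
    have : (0 : ℝ) < Real.sqrt Δ := Real.sqrt_pos.2 (by exact_mod_cast hΔ)
    linarith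

end Generic

/-! ### Unipotent symplectic matrices -/

section Unipotent

variable {R : Type*} [CommRing R]

/-- The upper triangular unipotent matrix with upper right block `s`. -/
def upperUni (s : Matrix (Fin 3) (Fin 3) R) : GL Idx R where
  val := fromBlocks 1 s 0 1
  inv := fromBlocks 1 (-s) 0 1
  val_inv := by simp [fromBlocks_multiply]
  inv_val := by simp [fromBlocks_multiply]

/-- The lower triangular unipotent matrix with lower left block `s`. -/
def lowerUni (s : Matrix (Fin 3) (Fin 3) R) : GL Idx R where
  val := fromBlocks 1 0 s 1
  inv := fromBlocks 1 0 (-s) 1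
  val_inv := by simp [fromBlocks_multiply]
  inv_val := by simp [fromBlocks_multiply]

theorem upperUni_symplectic {s : Matrix (Fin 3) (Fin 3) R} (hs : s.IsSymm) :
    (upperUni s : Matrix Idx Idx R) * stdJ R * (upperUni s : Matrix Idx Idx R)ᵀ = stdJ R := by
  change fromBlocks 1 s 0 1 * stdJ R * (fromBlocks 1 s 0 1)ᵀ = _
  simp [stdJ, fromBlocks_multiply, fromBlocks_transpose, hs.eq]

theorem lowerUni_symplectic {s : Matrix (Fin 3) (Fin 3) R} (hs : s.IsSymm) :
    (lowerUni s : Matrix Idx Idx R) * stdJ R * (lowerUni s : Matrix Idx Idx R)ᵀ = stdJ R := by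
  change fromBlocks 1 0 s 1 * stdJ R * (fromBlocks 1 0 s 1)ᵀ = _
  simp [stdJ, fromBlocks_multiply, fromBlocks_transpose, hs.eq]

theorem upperUni_map {S : Type*} [CommRing S] (f : R →+* S) (s : Matrix (Fin 3) (Fin 3) R) :
    GeneralLinearGroup.map f (upperUni s) = upperUni (s.map f) := by
  apply Units.ext
  change (fromBlocks 1 s 0 1).map f = fromBlocks 1 (s.map f) 0 1
  rw [fromBlocks_map, Matrix.map_one _ (map_zero f) (map_one f), Matrix.map_zero _ (map_zero f)]

theorem lowerUni_map {S : Type*} [CommRing S] (f : R →+* S) (s : Matrix (Fin 3) (Fin 3) R) :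
    GeneralLinearGroup.map f (lowerUni s) = lowerUni (s.map f) := by
  apply Units.ext
  change (fromBlocks 1 0 s 1).map f = fromBlocks 1 0 (s.map f) 1
  rw [fromBlocks_map, Matrix.map_one _ (map_zero f) (map_one f), Matrix.map_zero _ (map_zero f)]

theorem lowerUni_mul_neg (s : Matrix (Fin 3) (Fin 3) R) : lowerUni s * lowerUni (-s) = 1 := by
  apply Units.ext
  change fromBlocks 1 0 s 1 * fromBlocks 1 0 (-s) 1 = 1
  simp [fromBlocks_multiply]

end Unipotent

/-! ### Lagrangian subspaces as unipotent translates of the standard one -/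

section Transversal

variable {F : Type*} [Field F]

/-- Every subspace of `F^n` has a coordinate complement; here the complement is described by its
coordinates `I`, and maximality is expressed on the dual side. -/
theorem exists_coordinate_complement {n : Type*} [Fintype n] [DecidableEq n]
    (M : Submodule F (n → F)) : ∃ I : Finset n, (∀ v ∈ M, (∀ i ∉ I, v i = 0) → v = 0) ∧
      ∀ y : n → F, (∀ i ∈ I, y i = 0) → (∀ v ∈ M, v ⬝ᵥ y = 0) → y = 0 := by
  obtain ⟨I, hI, hmax⟩ := Set.Finite.exists_maximal
    (s := {I : Finset n | ∀ v ∈ M, (∀ i ∉ I, v i = 0) → v = 0}) (Set.toFinite _)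
    ⟨∅, fun v _ h => funext fun i => h i (by simp)⟩
  refine ⟨I, hI, fun y hy hM => ?_⟩
  funext j
  by_cases hj : j ∈ I
  · exact hy j hj
  -- By maximality of `I` some nonzero v in M is supported on `I` together with `j`, and `v j` is
  -- nonzero. Its pairing with y reduces to `v j * y j`.
  have hnot : ¬ ∀ v ∈ M, (∀ i ∉ insert j I, v i = 0) → v = 0 := by
    intro h
    exact hj (hmax h (Finset.subset_insert j I) (Finset.mem_insert_self j I))
  push Not at hnot
  obtain ⟨v, hv, hv0, hne⟩ := hnot
  have hvj : v j ≠ 0 := by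
    intro h0
    refine hne (hI v hv fun i hi => ?_)
    by_cases hij : i = j
    · rw [hij, h0]
    · exact hv0 i (by simp [hij, hi])
  have hdot := hM v hv
  rw [dotProduct, Finset.sum_eq_single j] at hdot
  · exact (mul_eq_zero.1 hdot).resolve_left hvj
  · intro i _ hij
    by_cases hi : i ∈ I
    · rw [hy i hi, mul_zero]
    · rw [hv0 i (by simp [hij, hi]), zero_mul]
  · simp

theorem symForm_eq (x y : Idx → F) : symForm F x y
    = (fun i => x (Sum.inl i)) ⬝ᵥ (fun i => y (Sum.inr i))
      - (fun i => x (Sum.inr i)) ⬝ᵥ (fun i => y (Sum.inl i)) := by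
  rw [symForm_apply, stdJ, fromBlocks_mulVec]
  simp only [dotProduct, Fintype.sum_sum_type]
  simp [sub_eq_add_neg, Function.comp_def, neg_mulVec]

/-- The standard Lagrangian subspace, the row space of the matrix `(1, 0)`. -/
def stdLagrangian (F : Type*) [Field F] : Submodule F (Idx → F) :=
  LinearMap.range (Matrix.vecMulLinear (fromBlocks 1 0 0 0 : Matrix Idx Idx F))

theorem mem_stdLagrangian {v : Idx → F} :
    v ∈ stdLagrangian F ↔ ∀ i, v (Sum.inr i) = 0 := by
  constructor
  · rintro ⟨w, rfl⟩ i
    simp [vecMul_fromBlocks]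
  · intro h
    refine ⟨v, ?_⟩
    rw [Matrix.vecMulLinear_apply, vecMul_fromBlocks]
    funext i
    rcases i with i | i
    · simp
    · simp [h i]

theorem stdLagrangian_eq_span : stdLagrangian F
    = Submodule.span F (Set.range fun i : Fin 3 => (Pi.single (Sum.inl i) 1 : Idx → F)) := by
  apply le_antisymm
  · intro v hv
    rw [mem_stdLagrangian] at hv
    have : v = ∑ i : Fin 3, v (Sum.inl i) • (Pi.single (Sum.inl i) 1 : Idx → F) := by
      conv_lhs => rw [pi_eq_sum_univ' v, Fintype.sum_sum_type]
      simp only [hv, zero_smul, Finset.sum_const_zero, add_zero]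
    rw [this]
    exact Submodule.sum_mem _ fun i _ => Submodule.smul_mem _ _ (Submodule.subset_span ⟨i, rfl⟩)
  · rw [Submodule.span_le]
    rintro _ ⟨i, rfl⟩
    exact mem_stdLagrangian.2 fun j => by simp

theorem isLagrangian_stdLagrangian : IsLagrangian (stdLagrangian F) where
  finrank_eq := by
    rw [stdLagrangian_eq_span]
    refine (finrank_span_eq_card ?_).trans (by simp)
    have := (Pi.basisFun F Idx).linearIndependent.comp _ (Sum.inl_injective (β := Fin 3))
    simpa [Function.comp_def] using this
  isotropic := by
    intro x hx y hy
    rw [mem_stdLagrangian] at hx hy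
    rw [symForm_eq]
    simp [hx, hy, dotProduct]

theorem vecMulLinear_injective (g : GL Idx F) :
    Function.Injective (Matrix.vecMulLinear (g : Matrix Idx Idx F)) :=
  Matrix.vecMul_injective_of_isUnit g.isUnit

theorem map_vecMulLinear_mul (W : Submodule F (Idx → F)) (a b : Matrix Idx Idx F) :
    W.map (Matrix.vecMulLinear (a * b))
      = (W.map (Matrix.vecMulLinear a)).map (Matrix.vecMulLinear b) := by
  rw [← Submodule.map_comp]
  congr 1
  refine LinearMap.ext fun v => ?_
  simp [vecMul_vecMul]

theorem IsLagrangian.map {W : Submodule F (Idx → F)} (hW : IsLagrangian W) {g : GL Idx F}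
    (hg : g ∈ GSp F) :
    IsLagrangian (W.map (Matrix.vecMulLinear (g : Matrix Idx Idx F))) where
  finrank_eq := by
    rw [← (Submodule.equivMapOfInjective _ (vecMulLinear_injective g) W).finrank_eq,
      hW.finrank_eq]
  isotropic := by
    obtain ⟨c, hc⟩ := hg
    rintro _ ⟨x, hx, rfl⟩ _ ⟨y, hy, rfl⟩
    have := hW.isotropic x hx y hy
    rw [symForm_apply] at this ⊢
    rw [Matrix.vecMulLinear_apply, Matrix.vecMulLinear_apply, ← dotProduct_mulVec,
      ← mulVec_transpose, mulVec_mulVec, mulVec_mulVec, hc, smul_mulVec,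
      dotProduct_smul, this, smul_zero]

/-- Every Lagrangian subspace is obtained from the standard one by the product of an upper and a
lower unipotent symplectic matrix. -/
theorem IsLagrangian.exists_unipotent {W : Submodule F (Idx → F)} (hW : IsLagrangian W) :
    ∃ t s : Matrix (Fin 3) (Fin 3) F, t.IsSymm ∧ s.IsSymm ∧
      (stdLagrangian F).map (Matrix.vecMulLinear
        ((upperUni t * lowerUni s : GL Idx F) : Matrix Idx Idx F)) = W := by
  let π : (Idx → F) →ₗ[F] (Fin 3 → F) := LinearMap.funLeft F F Sum.inl
  obtain ⟨I, hI1, hI2⟩ := exists_coordinate_complement (W.map π)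
  -- The lower unipotent matrix of this `s` sends (x, y) to (x + y_I, y), with y_I the part of y on
  -- `I`. If x + y_I = 0, then x lies in the projection of W and is supported on `I`, so x = 0 and y
  -- vanishes on `I`. By isotropy y is also orthogonal to the projection, hence y = 0.
  let s : Matrix (Fin 3) (Fin 3) F := diagonal fun i => if i ∈ I then 1 else 0
  have hs : s.IsSymm := diagonal_transpose _
  set W' := W.map (Matrix.vecMulLinear (lowerUni s : Matrix Idx Idx F)) with hW'
  have hl : lowerUni s ∈ GSp F := ⟨1, by rw [lowerUni_symplectic hs]; simp⟩
  have hLag : IsLagrangian W' := hW.map hl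
  have hinj : ∀ v ∈ W', π v = 0 → v = 0 := by
    rintro _ ⟨v, hv, rfl⟩ h0
    have hx (i) : v (Sum.inl i) = -(if i ∈ I then v (Sum.inr i) else 0) := by
      have := congrFun h0 i
      rw [Matrix.vecMulLinear_apply] at this
      change (v ᵥ* fromBlocks 1 0 s 1) (Sum.inl i) = 0 at this
      rw [vecMul_fromBlocks] at this
      simp [s, vecMul_diagonal] at this
      split_ifs with hi <;> simp [hi] at this
      · linear_combination this
      · rw [this, neg_zero]
    have hπ : π v = 0 := hI1 _ ⟨v, hv, rfl⟩ fun i hi => by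
      change v (Sum.inl i) = 0
      rw [hx, if_neg hi, neg_zero]
    have hl0 (i) : v (Sum.inl i) = 0 := congrFun hπ i
    have hr0 : (fun i => v (Sum.inr i)) = 0 := by
      refine hI2 _ (fun i hi => ?_) ?_
      · have := hx i
        rw [hl0, if_pos hi] at this
        exact neg_eq_zero.1 this.symm
      · rintro _ ⟨u, hu, rfl⟩
        have := hW.isotropic u hu v hv
        rw [symForm_eq] at this
        simp only [hl0] at this
        rw [← this]
        simp [π, LinearMap.funLeft, dotProduct]
    have : v = 0 := by
      funext i
      rcases i with i | i
      · exact hl0 i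
      · exact congrFun hr0 i
    rw [this, map_zero]
  -- So `W'` projects isomorphically to the first three coordinates and is the graph of a matrix
  -- `t`, which is symmetric because `W'` is isotropic.
  have hsurj : Function.Surjective (π ∘ₗ W'.subtype) := by
    have hi : Function.Injective (π ∘ₗ W'.subtype) := by
      rw [injective_iff_map_eq_zero]
      intro v hv
      exact Subtype.ext (hinj v v.2 hv)
    exact (LinearMap.injective_iff_surjective_of_finrank_eq_finrank (by
      rw [hLag.finrank_eq]; simp)).1 hi
  choose w hw using fun i : Fin 3 => hsurj (Pi.single i 1)
  let t : Matrix (Fin 3) (Fin 3) F := Matrix.of fun i j => (w i : Idx → F) (Sum.inr j)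
  have hwl (i j) : (w i : Idx → F) (Sum.inl j) = (Pi.single i 1 : Fin 3 → F) j := congrFun (hw i) j
  have ht : t.IsSymm := by
    ext i j
    have := hLag.isotropic _ (w i).2 _ (w j).2
    rw [symForm_eq] at this
    simp only [hwl] at this
    have e1 : (fun k => (Pi.single i 1 : Fin 3 → F) k) = Pi.single i 1 := rfl
    have e2 : (fun k => (Pi.single j 1 : Fin 3 → F) k) = Pi.single j 1 := rfl
    rw [e1, e2, single_one_dotProduct, dotProduct_single_one, sub_eq_zero] at this
    exact this
  have hmap : (stdLagrangian F).map (Matrix.vecMulLinear (upperUni t : Matrix Idx Idx F)) = W' := by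
    have hu : upperUni t ∈ GSp F := ⟨1, by rw [upperUni_symplectic ht]; simp⟩
    apply Submodule.eq_of_le_of_finrank_eq
    · rw [stdLagrangian_eq_span, Submodule.map_span, Submodule.span_le]
      rintro _ ⟨_, ⟨i, rfl⟩, rfl⟩
      refine (congrArg (· ∈ W') ?_).mpr (w i).2
      rw [Matrix.vecMulLinear_apply, single_one_vecMul]
      funext j
      change fromBlocks 1 t 0 1 (Sum.inl i) j = _
      rcases j with j | j
      · rw [hwl, fromBlocks_apply₁₁, one_apply, Pi.single_apply]
        simp [eq_comm]
      · rfl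
    · rw [(isLagrangian_stdLagrangian.map hu).finrank_eq, hLag.finrank_eq]
  refine ⟨t, -s, ht, by rw [Matrix.IsSymm, transpose_neg, hs.eq], ?_⟩
  rw [Units.val_mul, map_vecMulLinear_mul, hmap, hW', ← map_vecMulLinear_mul, ← Units.val_mul,
    lowerUni_mul_neg, Units.val_one]
  convert Submodule.map_id W
  refine LinearMap.ext fun v => ?_
  simp

end Transversal

/-! ### Cosets in the local Hecke double coset and Lagrangian subspaces modulo p -/

section Local

/-- `GL₆(ℤ_q) → GL₆(ℚ_q)`. -/
def embZ (q : Nat.Primes) : GL Idx ℤ_[q] →* GL Idx ℚ_[q] :=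
  GeneralLinearGroup.map PadicInt.Coe.ringHom

/-- Reduction `GL₆(ℤ_q) → GL₆(𝔽_q)`. -/
def redZ (q : Nat.Primes) : GL Idx ℤ_[q] →* GL Idx (ZMod q) :=
  GeneralLinearGroup.map PadicInt.toZMod

theorem mem_GSpZ {q : Nat.Primes} {g : GL Idx ℚ_[q]} :
    g ∈ GSpZ q ↔ ∃ k ∈ GSp ℤ_[q], embZ q k = g := Iff.rfl

theorem coe_injective_matrix (q : Nat.Primes) :
    Function.Injective fun M : Matrix Idx Idx ℤ_[q] => M.map (PadicInt.Coe.ringHom (p := q)) :=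
  Matrix.map_injective Subtype.coe_injective

/-- An integral matrix is determined by its image over ℚ_p, so the union over lifts in the
definition of `W` has only one term. -/
theorem W_of_map {p : Nat.Primes} {σ : GL Idx ℚ_[p]} {M : Matrix Idx Idx ℤ_[p]}
    (hM : M.map PadicInt.Coe.ringHom = (σ : Matrix Idx Idx ℚ_[p])) :
    W p σ = LinearMap.range (Matrix.vecMulLinear (M.map PadicInt.toZMod)) := by
  rw [range_vecMulLinear, W]
  congr 1
  ext v
  constructor
  · rintro ⟨M', hM', i, rfl⟩
    have : M' = M := coe_injective_matrix p (hM'.trans hM.symm)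
    subst this
    exact ⟨i, rfl⟩
  · rintro ⟨i, rfl⟩
    exact ⟨M, hM, i, rfl⟩

theorem W_embZ_mul {p : Nat.Primes} {σ : GL Idx ℚ_[p]} {M : Matrix Idx Idx ℤ_[p]}
    (hM : M.map PadicInt.Coe.ringHom = (σ : Matrix Idx Idx ℚ_[p])) (k : GL Idx ℤ_[p]) :
    W p (embZ p k * σ) = W p σ := by
  have h : ((k : Matrix Idx Idx ℤ_[p]) * M).map PadicInt.Coe.ringHom
      = ((embZ p k * σ : GL Idx ℚ_[p]) : Matrix Idx Idx ℚ_[p]) := by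
    rw [Matrix.map_mul, hM]; rfl
  rw [W_of_map h, W_of_map hM, Matrix.map_mul]
  have e : Matrix.vecMulLinear ((k : Matrix Idx Idx ℤ_[p]).map PadicInt.toZMod
        * M.map PadicInt.toZMod)
      = Matrix.vecMulLinear (M.map PadicInt.toZMod)
        ∘ₗ Matrix.vecMulLinear (redZ p k : Matrix Idx Idx (ZMod p)) := by
    refine LinearMap.ext fun v => ?_
    rw [LinearMap.comp_apply, vecMulLinear_apply, vecMulLinear_apply, vecMulLinear_apply,
      vecMul_vecMul]
    rfl
  rw [e, LinearMap.range_comp_of_range_eq_top]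
  rw [LinearMap.range_eq_top]
  exact Matrix.vecMul_surjective_iff_isUnit.2 (redZ p k).isUnit

theorem W_mul_embZ {p : Nat.Primes} {σ : GL Idx ℚ_[p]} {M : Matrix Idx Idx ℤ_[p]}
    (hM : M.map PadicInt.Coe.ringHom = (σ : Matrix Idx Idx ℚ_[p])) (k : GL Idx ℤ_[p]) :
    W p (σ * embZ p k)
      = (W p σ).map (Matrix.vecMulLinear (redZ p k : Matrix Idx Idx (ZMod p))) := by
  have h : (M * (k : Matrix Idx Idx ℤ_[p])).map PadicInt.Coe.ringHom
      = ((σ * embZ p k : GL Idx ℚ_[p]) : Matrix Idx Idx ℚ_[p]) := by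
    rw [Matrix.map_mul, hM]; rfl
  rw [W_of_map h, W_of_map hM, Matrix.map_mul, ← LinearMap.range_comp]
  congr 1
  refine LinearMap.ext fun v => ?_
  rw [LinearMap.comp_apply, vecMulLinear_apply, vecMulLinear_apply, vecMulLinear_apply,
    vecMul_vecMul]
  rfl

/-- The integral matrix `τ_p`. -/
def tauZ (p : Nat.Primes) : Matrix Idx Idx ℤ_[p] := fromBlocks 1 0 0 ((p : ℤ_[p]) • 1)

theorem tauZ_map (p : Nat.Primes) :
    (tauZ p).map PadicInt.Coe.ringHom = (tau p : Matrix Idx Idx ℚ_[p]) := by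
  change _ = fromBlocks 1 0 0 ((p : ℚ_[p]) • 1)
  ext i j
  rcases i with i | i <;> rcases j with j | j <;> by_cases h : i = j <;>
    simp [tauZ, one_apply, h]

theorem W_tau (p : Nat.Primes) : W p (tau p) = stdLagrangian (ZMod p) := by
  have e : (tauZ p).map (PadicInt.toZMod (p := p)) = fromBlocks 1 0 0 0 := by
    ext i j
    rcases i with i | i <;> rcases j with j | j <;> simp [tauZ, one_apply, apply_ite]
  rw [W_of_map (tauZ_map p), stdLagrangian, e]

theorem exists_integral {p : Nat.Primes} {σ : GL Idx ℚ_[p]} (hσ : σ ∈ heckeSet p) :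
    ∃ M : Matrix Idx Idx ℤ_[p], M.map PadicInt.Coe.ringHom = (σ : Matrix Idx Idx ℚ_[p]) := by
  obtain ⟨_, ⟨k₁, -, rfl⟩, _, ⟨k₂, -, rfl⟩, rfl⟩ := hσ
  refine ⟨(k₁ : Matrix Idx Idx ℤ_[p]) * tauZ p * (k₂ : Matrix Idx Idx ℤ_[p]), ?_⟩
  rw [Matrix.map_mul, Matrix.map_mul, tauZ_map]
  rfl

theorem W_hecke {p : Nat.Primes} (k₁ k₂ : GL Idx ℤ_[p]) :
    W p (embZ p k₁ * tau p * embZ p k₂)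
      = (stdLagrangian (ZMod p)).map
        (Matrix.vecMulLinear (redZ p k₂ : Matrix Idx Idx (ZMod p))) := by
  have h : (tauZ p * (k₂ : Matrix Idx Idx ℤ_[p])).map PadicInt.Coe.ringHom
      = ((tau p * embZ p k₂ : GL Idx ℚ_[p]) : Matrix Idx Idx ℚ_[p]) := by
    rw [Matrix.map_mul, tauZ_map]; rfl
  rw [mul_assoc, W_embZ_mul h, W_mul_embZ (tauZ_map p), W_tau]

theorem W_GSpZ_mul {p : Nat.Primes} {σ k : GL Idx ℚ_[p]} (hσ : σ ∈ heckeSet p)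
    (hk : k ∈ GSpZ p) : W p (k * σ) = W p σ := by
  obtain ⟨k, -, rfl⟩ := mem_GSpZ.1 hk
  obtain ⟨M, hM⟩ := exists_integral hσ
  exact W_embZ_mul hM k

theorem isLagrangian_W {p : Nat.Primes} {σ : GL Idx ℚ_[p]} (hσ : σ ∈ heckeSet p) :
    IsLagrangian (W p σ) := by
  obtain ⟨_, ⟨k₁, -, rfl⟩, _, ⟨k₂, hk₂, rfl⟩, rfl⟩ := hσ
  refine (W_hecke k₁ k₂) ▸ isLagrangian_stdLagrangian.map ?_
  exact map_mem_GSp _ hk₂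

theorem mul_mem_heckeSet {p : Nat.Primes} {σ a b : GL Idx ℚ_[p]} (hσ : σ ∈ heckeSet p)
    (ha : a ∈ GSpZ p) (hb : b ∈ GSpZ p) : a * σ * b ∈ heckeSet p := by
  obtain ⟨k₁, h₁, k₂, h₂, rfl⟩ := hσ
  exact ⟨a * k₁, mul_mem ha h₁, k₂ * b, mul_mem h₂ hb, by group⟩

theorem tau_mul_mem_heckeSet {p : Nat.Primes} {b : GL Idx ℚ_[p]} (hb : b ∈ GSpZ p) :
    tau p * b ∈ heckeSet p :=
  ⟨1, one_mem _, b, hb, by group⟩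

theorem exists_mem_GSp_of_similitude {R : Type*} [CommRing R] {m : Matrix Idx Idx R} {c : Rˣ}
    (h : m * stdJ R * mᵀ = (c : R) • stdJ R) :
    ∃ k ∈ GSp R, (k : Matrix Idx Idx R) = m := by
  have hdet : IsUnit m := by
    refine IsUnit.of_mul_eq_one (stdJ R * mᵀ * (-((c⁻¹ : Rˣ) : R) • stdJ R)) ?_
    rw [← Matrix.mul_assoc, ← Matrix.mul_assoc, h, Matrix.mul_smul, Matrix.smul_mul, smul_smul,
      stdJ_mul_self, neg_mul, Units.inv_mul, neg_smul, one_smul, neg_neg]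
  obtain ⟨k, rfl⟩ := hdet
  exact ⟨k, ⟨c, h⟩, rfl⟩

/-- The stabilizer of the standard Lagrangian subspace modulo `p` is `τ_p⁻¹ GSp₆(ℤ_p) τ_p`. -/
theorem exists_tau_mul_eq {p : Nat.Primes} {k : GL Idx ℤ_[p]} (hk : k ∈ GSp ℤ_[p])
    (hst : (stdLagrangian (ZMod p)).map
      (Matrix.vecMulLinear (redZ p k : Matrix Idx Idx (ZMod p))) ≤ stdLagrangian (ZMod p)) :
    ∃ k' ∈ GSpZ p, tau p * embZ p k = k' * tau p := by
  have hdvd (i j : Fin 3) : (p : ℤ_[p]) ∣ (k : Matrix Idx Idx ℤ_[p]) (Sum.inl i) (Sum.inr j) := by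
    rw [← toZMod_eq_zero_iff]
    have h1 : (Pi.single (Sum.inl i) 1 : Idx → ZMod p) ∈ stdLagrangian (ZMod p) :=
      mem_stdLagrangian.2 fun j => by simp
    have := mem_stdLagrangian.1 (hst ⟨_, h1, rfl⟩) j
    rw [Matrix.vecMulLinear_apply, single_one_vecMul] at this
    exact this
  choose B hB using hdvd
  obtain ⟨c, hc⟩ := hk
  have hp0 : (p : ℤ_[p]) ≠ 0 := by exact_mod_cast p.2.ne_zero
  set K := (k : Matrix Idx Idx ℤ_[p]) with hK
  have h12 : K.toBlocks₁₂ = (p : ℤ_[p]) • Matrix.of B := by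
    ext i j
    exact hB i j
  -- This is `k` conjugated by τ_p; the divisibility of the upper right block is what makes it
  -- integral.
  set m : Matrix Idx Idx ℤ_[p] :=
    fromBlocks K.toBlocks₁₁ (Matrix.of B) ((p : ℤ_[p]) • K.toBlocks₂₁) K.toBlocks₂₂ with hm
  have hmT : tauZ p * K = m * tauZ p := by
    conv_lhs => rw [← fromBlocks_toBlocks K]
    rw [hm, tauZ, fromBlocks_multiply, fromBlocks_multiply, h12]
    simp
  have hTJ : tauZ p * stdJ ℤ_[p] * (tauZ p)ᵀ = (p : ℤ_[p]) • stdJ ℤ_[p] := by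
    simp [tauZ, stdJ, fromBlocks_multiply, fromBlocks_transpose, fromBlocks_smul]
  have hmJ : m * stdJ ℤ_[p] * mᵀ = (c : ℤ_[p]) • stdJ ℤ_[p] := by
    have e : (p : ℤ_[p]) • (m * stdJ ℤ_[p] * mᵀ) = (p : ℤ_[p]) • ((c : ℤ_[p]) • stdJ ℤ_[p]) := by
      calc _ = m * (tauZ p * stdJ ℤ_[p] * (tauZ p)ᵀ) * mᵀ := by
            rw [hTJ, Matrix.mul_smul, Matrix.smul_mul]
        _ = (m * tauZ p) * stdJ ℤ_[p] * (m * tauZ p)ᵀ := by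
            rw [transpose_mul]; simp only [Matrix.mul_assoc]
        _ = tauZ p * (K * stdJ ℤ_[p] * Kᵀ) * (tauZ p)ᵀ := by
            rw [← hmT, transpose_mul]; simp only [Matrix.mul_assoc]
        _ = _ := by rw [hc, Matrix.mul_smul, Matrix.smul_mul, hTJ, smul_comm]
    exact smul_right_injective _ hp0 e
  obtain ⟨k', hk', hk'm⟩ := exists_mem_GSp_of_similitude hmJ
  refine ⟨embZ p k', ⟨k', hk', rfl⟩, Units.ext ?_⟩
  rw [← hk'm] at hmT
  have := congrArg (fun x => x.map (PadicInt.Coe.ringHom (p := p))) hmT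
  simp only [Matrix.map_mul, tauZ_map] at this
  exact this

/-- If `b₁` and `b₂` move the standard subspace to the same place modulo p, then `b₂ * b₁⁻¹`
stabilizes it, and it can be moved across τ_p to the left. -/
theorem exists_mul_eq_of_W_eq {p : Nat.Primes} {σ₁ σ₂ : GL Idx ℚ_[p]} (h₁ : σ₁ ∈ heckeSet p)
    (h₂ : σ₂ ∈ heckeSet p) (h : W p σ₁ = W p σ₂) : ∃ k ∈ GSpZ p, k * σ₁ = σ₂ := by
  obtain ⟨a₁, ha₁, _, ⟨b₁, hb₁, rfl⟩, rfl⟩ := h₁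
  obtain ⟨a₂, ha₂, _, ⟨b₂, hb₂, rfl⟩, rfl⟩ := h₂
  obtain ⟨c₁, hc₁, rfl⟩ := mem_GSpZ.1 ha₁
  obtain ⟨c₂, hc₂, rfl⟩ := mem_GSpZ.1 ha₂
  have e₁ := W_hecke c₁ b₁
  have e₂ := W_hecke c₂ b₂
  obtain ⟨k', hk', hk⟩ := exists_tau_mul_eq (mul_mem hb₂ (inv_mem hb₁) : b₂ * b₁⁻¹ ∈ GSp ℤ_[p]) (by
    rw [map_mul, Units.val_mul, map_vecMulLinear_mul]
    refine (congrArg (· ≤ stdLagrangian (ZMod p)) ?_).mpr le_rfl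
    have e : (stdLagrangian (ZMod p)).map
          (Matrix.vecMulLinear (redZ p b₂ : Matrix Idx Idx (ZMod p)))
        = (stdLagrangian (ZMod p)).map
          (Matrix.vecMulLinear (redZ p b₁ : Matrix Idx Idx (ZMod p))) :=
      e₂.symm.trans (h.symm.trans e₁)
    rw [e, ← map_vecMulLinear_mul, ← Units.val_mul, ← map_mul, mul_inv_cancel, map_one,
      Units.val_one]
    convert Submodule.map_id _
    refine LinearMap.ext fun v => ?_
    simp)
  rw [map_mul, map_inv] at hk
  refine ⟨embZ p c₂ * k' * (embZ p c₁)⁻¹, mul_mem (mul_mem ha₂ hk') (inv_mem ha₁), ?_⟩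
  change embZ p c₂ * k' * (embZ p c₁)⁻¹ * (embZ p c₁ * tau p * embZ p b₁)
    = embZ p c₂ * tau p * embZ p b₂
  calc _ = embZ p c₂ * (k' * tau p) * embZ p b₁ := by group
    _ = _ := by rw [← hk]; group

end Local

/-! ### Representatives in Γ -/

section StrongApproximation

theorem exists_int_lift {p : Nat.Primes} {N : ℕ} (hpN : ¬ (p : ℕ) ∣ N)
    {s : Matrix (Fin 3) (Fin 3) (ZMod p)} (hs : s.IsSymm) :
    ∃ S : Matrix (Fin 3) (Fin 3) ℤ, S.IsSymm ∧ S.map (Int.castRingHom (ZMod p)) = s ∧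
      S.map (Int.castRingHom (ZMod N)) = 0 := by
  have hN : (N : ZMod p) ≠ 0 := by rwa [Ne, ZMod.natCast_eq_zero_iff]
  -- An explicit Chinese remainder: `f a` is a multiple of N and is congruent to a modulo p.
  let f : ZMod p → ℤ := fun a => N * (((N : ZMod p)⁻¹ * a).val : ℤ)
  refine ⟨s.map f, ?_, ?_, ?_⟩
  · rw [Matrix.IsSymm, ← transpose_map, hs.eq]
  · ext i j
    simp [f, hN]
  · ext i j
    simp [f]

theorem mem_Gam_of_int {N : ℕ} {𝒦 : Subgroup ProdGL} (h𝒦 : IsLevelSubgroup N 𝒦)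
    {u : GL Idx ℤ} (hu : (u : Matrix Idx Idx ℤ) * stdJ ℤ * (u : Matrix Idx Idx ℤ)ᵀ = stdJ ℤ)
    (hN : GeneralLinearGroup.map (Int.castRingHom (ZMod N)) u = 1) :
    GeneralLinearGroup.map (Int.castRingHom ℚ) u ∈ Gam 𝒦 := by
  have hd (q : Nat.Primes) : diagEmb (GeneralLinearGroup.map (Int.castRingHom ℚ) u) q
      = embZ q (GeneralLinearGroup.map (Int.castRingHom ℤ_[q]) u) := by
    apply Units.ext
    ext i j
    change (Rat.castHom ℚ_[q]) (Int.castRingHom ℚ (u i j))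
      = PadicInt.Coe.ringHom (Int.castRingHom ℤ_[q] (u i j))
    simp
  constructor
  · refine ⟨1, one_pos, ?_⟩
    have := congrArg (fun m => m.map (Int.castRingHom ℚ)) hu
    simp only [Matrix.map_mul, transpose_map, stdJ_map] at this
    rw [one_smul]
    exact this
  · refine h𝒦.principal_le _ (fun q => ?_) fun q i j => ?_
    · rw [hd]
      exact ⟨_, map_mem_GSp _ ⟨1, by rw [hu]; simp⟩, rfl⟩
    · have h1 : (N : ℤ) ∣ ((u : Matrix Idx Idx ℤ) - 1) i j := by
        rw [← ZMod.intCast_zmod_eq_zero_iff_dvd]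
        have h2 := congrArg (fun m : GL Idx (ZMod N) => (m : Matrix Idx Idx (ZMod N)) i j) hN
        change ((u i j : ℤ) : ZMod N) = (1 : Matrix Idx Idx (ZMod N)) i j at h2
        rw [Matrix.sub_apply, Int.cast_sub, h2]
        by_cases h : i = j <;> simp [h, one_apply]
      obtain ⟨z, hz⟩ := h1
      have h2 : ((diagEmb (GeneralLinearGroup.map (Int.castRingHom ℚ) u) q
          : Matrix Idx Idx ℚ_[q]) - 1) i j = (N : ℚ_[q]) * (z : ℤ) := by
        have h3 : ((((u : Matrix Idx Idx ℤ) - 1) i j : ℤ) : ℚ_[q]) = (N : ℚ_[q]) * (z : ℤ) := by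
          rw [hz]; push_cast; rfl
        rw [← h3, Matrix.sub_apply, Matrix.sub_apply, Int.cast_sub]
        congr 1
        rw [one_apply, one_apply]
        split_ifs <;> simp
      rw [h2, norm_mul]
      exact mul_le_of_le_one_right (norm_nonneg _) (Padic.norm_int_le_one z)

theorem apply_mem_GSpZ {N : ℕ} {𝒦 : Subgroup ProdGL} (h𝒦 : IsLevelSubgroup N 𝒦) {r : GL Idx ℚ}
    (hr : r ∈ Gam 𝒦) (q : Nat.Primes) : diagEmb r q ∈ GSpZ q :=
  h𝒦.le_integral _ hr.2 q

/-- Strong approximation: every class of `S(3)` is represented by an element of `Γ`. -/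
theorem exists_corr {p : Nat.Primes} {N : ℕ} (hpN : ¬ (p : ℕ) ∣ N) {𝒦 : Subgroup ProdGL}
    (h𝒦 : IsLevelSubgroup N 𝒦) {σ : GL Idx ℚ_[p]} (hσ : σ ∈ heckeSet p) :
    ∃ r, Corr p 𝒦 σ r := by
  -- Unipotent factors depend on free symmetric matrices, so they lift to integers with congruences
  -- at p and at N imposed together.
  obtain ⟨t, s, ht, hs, hW⟩ := (isLagrangian_W hσ).exists_unipotent
  obtain ⟨T, hT, hTp, hTN⟩ := exists_int_lift hpN ht
  obtain ⟨S, hS, hSp, hSN⟩ := exists_int_lift hpN hs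
  have hu : upperUni T * lowerUni S ∈ GSp ℤ :=
    mul_mem ⟨1, by rw [upperUni_symplectic hT]; simp⟩ ⟨1, by rw [lowerUni_symplectic hS]; simp⟩
  have hr : GeneralLinearGroup.map (Int.castRingHom ℚ) (upperUni T * lowerUni S) ∈ Gam 𝒦 := by
    have e0 (m : Matrix (Fin 3) (Fin 3) (ZMod N)) (hm : m = 0) :
        upperUni m = 1 ∧ lowerUni m = 1 := by
      subst hm
      exact ⟨Units.ext fromBlocks_one, Units.ext fromBlocks_one⟩
    rw [map_mul]
    refine mul_mem (mem_Gam_of_int h𝒦 (upperUni_symplectic hT) ?_)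
      (mem_Gam_of_int h𝒦 (lowerUni_symplectic hS) ?_)
    · rw [upperUni_map]; exact (e0 _ hTN).1
    · rw [lowerUni_map]; exact (e0 _ hSN).2
  set u := upperUni T * lowerUni S with hudef
  refine ⟨_, hr, exists_mul_eq_of_W_eq hσ (tau_mul_mem_heckeSet (apply_mem_GSpZ h𝒦 hr p)) ?_⟩
  have hd : diagEmb (GeneralLinearGroup.map (Int.castRingHom ℚ) u) p
      = embZ p (GeneralLinearGroup.map (Int.castRingHom ℤ_[p]) u) := by
    apply Units.ext
    ext i j
    change (Rat.castHom ℚ_[p]) (Int.castRingHom ℚ (u i j))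
      = PadicInt.Coe.ringHom (Int.castRingHom ℤ_[p] (u i j))
    simp
  have hred : redZ p (GeneralLinearGroup.map (Int.castRingHom ℤ_[p]) u)
      = upperUni t * lowerUni s := by
    rw [← hTp, ← hSp, ← upperUni_map, ← lowerUni_map, ← map_mul]
    apply Units.ext
    ext i j
    change PadicInt.toZMod (Int.castRingHom ℤ_[p] (u i j)) = Int.castRingHom (ZMod p) (u i j)
    simp
  have e := W_hecke (1 : GL Idx ℤ_[p]) (GeneralLinearGroup.map (Int.castRingHom ℤ_[p]) u)
  rw [map_one, one_mul, ← hd, hred, hW] at e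
  exact e.symm

end StrongApproximation

/-! ### Level structure, the invariant d, and the components -/

section Global

variable {Δ : ℕ} {p : Nat.Primes} {N : ℕ} {𝒦 : Subgroup ProdGL}

theorem GSpZ_le_GSp (q : Nat.Primes) : GSpZ q ≤ GSp ℚ_[q] := by
  rintro _ ⟨k, hk, rfl⟩
  exact map_mem_GSp _ hk

theorem mem_GSpAf_of_integral {x : ProdGL} (hx : ∀ q, x q ∈ GSpZ q) : x ∈ GSpAf :=
  ⟨fun q => GSpZ_le_GSp q (hx q), Filter.Eventually.of_forall hx⟩

theorem IsLevelSubgroup.le_GSpAf (h𝒦 : IsLevelSubgroup N 𝒦) {x : ProdGL} (hx : x ∈ 𝒦) :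
    x ∈ GSpAf :=
  mem_GSpAf_of_integral (h𝒦.le_integral x hx)

/-- `α(G_V(𝔸_f))` as a subgroup. -/
def GVAfSubgroup (Δ : ℕ) : Subgroup ProdGL where
  carrier := GVAf Δ
  one_mem' := ⟨one_mem _, fun q => by
    rw [GV_eq]; exact one_mem (GSp ℚ_[q] ⊓ rootCentralizer Δ ℚ_[q])⟩
  mul_mem' := fun ha hb => ⟨mul_mem ha.1 hb.1, fun q => by
    have h1 := ha.2 q
    have h2 := hb.2 q
    rw [GV_eq] at h1 h2 ⊢
    exact mul_mem h1 h2⟩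
  inv_mem' := fun ha => ⟨inv_mem ha.1, fun q => by
    have h1 := ha.2 q
    rw [GV_eq] at h1 ⊢
    exact inv_mem h1⟩

theorem apply_mem_rootCentralizer {x : ProdGL} (hx : x ∈ GVAf Δ) (q : Nat.Primes) :
    x q ∈ rootCentralizer Δ ℚ_[q] :=
  (mem_GV_iff.1 (hx.2 q)).2

theorem tauA_apply_self (p : Nat.Primes) : tauA p p = tau p := Pi.mulSingle_eq_same _ _

theorem tauA_apply_of_ne {q : Nat.Primes} (h : q ≠ p) : tauA p q = 1 :=
  Pi.mulSingle_eq_of_ne h _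

theorem tau_mem_GSp (p : Nat.Primes) : tau p ∈ GSp ℚ_[p] := by
  have hp0 : (p : ℚ_[p]) ≠ 0 := by exact_mod_cast p.2.ne_zero
  refine ⟨Units.mk0 (p : ℚ_[p]) hp0, ?_⟩
  change fromBlocks 1 0 0 ((p : ℚ_[p]) • 1) * stdJ ℚ_[p]
    * (fromBlocks 1 0 0 ((p : ℚ_[p]) • 1))ᵀ = (p : ℚ_[p]) • stdJ ℚ_[p]
  simp [stdJ, fromBlocks_multiply, fromBlocks_transpose, fromBlocks_smul]

theorem tauA_mem_GSpAf (p : Nat.Primes) : tauA p ∈ GSpAf := by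
  refine ⟨fun q => ?_, ?_⟩
  · by_cases h : q = p
    · subst h
      rw [tauA_apply_self]
      exact tau_mem_GSp q
    · rw [tauA_apply_of_ne h]
      exact one_mem _
  · have : ∀ᶠ q in Filter.cofinite, q ≠ p := (Set.finite_singleton p).compl_mem_cofinite
    filter_upwards [this] with q hq
    rw [tauA_apply_of_ne hq]
    exact one_mem _

/-- The congruence condition modulo N is empty at p, and it holds trivially at the other places. -/
theorem IsLevelSubgroup.mulSingle_mem (h𝒦 : IsLevelSubgroup N 𝒦) (hpN : ¬ (p : ℕ) ∣ N)
    {a : GL Idx ℚ_[p]} (ha : a ∈ GSpZ p) : (Pi.mulSingle p a : ProdGL) ∈ 𝒦 := by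
  refine h𝒦.principal_le _ (fun q => ?_) fun q i j => ?_
  · by_cases h : q = p
    · subst h
      rwa [Pi.mulSingle_eq_same]
    · rw [Pi.mulSingle_eq_of_ne h]
      exact one_mem _
  · by_cases h : q = p
    · subst h
      rw [Pi.mulSingle_eq_same]
      have hN : ‖(N : ℚ_[q])‖ = 1 := by
        rw [Padic.norm_natCast_eq_one_iff]
        exact (Nat.Prime.coprime_iff_not_dvd q.2).2 hpN
      rw [hN]
      obtain ⟨k, -, rfl⟩ := ha
      have e : ((embZ q k : Matrix Idx Idx ℚ_[q]) - 1) i j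
          = (((k : Matrix Idx Idx ℤ_[q]) - 1) i j : ℤ_[q]) := by
        rw [Matrix.sub_apply, Matrix.sub_apply, PadicInt.coe_sub]
        congr 1
        rw [one_apply, one_apply]
        split_ifs <;> simp
      exact (congrArg norm e).trans_le (PadicInt.norm_le_one _)
    · rw [Pi.mulSingle_eq_of_ne h]
      simp

theorem mem_levelP {k : ProdGL} :
    k ∈ levelP p 𝒦 ↔ k ∈ 𝒦 ∧ tauA p * k * (tauA p)⁻¹ ∈ 𝒦 := Iff.rfl

theorem realEmb_mem {γ : GL Idx ℚ} (hγ : γ ∈ GSpPos ℚ) : realEmb γ ∈ GSpPos ℝ := by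
  obtain ⟨c, hc0, hc⟩ := hγ
  refine ⟨(c : ℝ), by exact_mod_cast hc0, ?_⟩
  have := congrArg (fun m => m.map (Rat.castHom ℝ)) hc
  simp only [Matrix.map_mul, transpose_map, stdJ_map] at this
  refine Eq.trans this ?_
  ext i j
  have e := congrFun (congrFun (stdJ_map (Rat.castHom ℝ)) i) j
  rw [map_apply] at e
  simp [← e]

theorem conj_mem_siegelDomain {g J : GL Idx ℝ} (hg : g ∈ GSpPos ℝ) (hJ : J ∈ siegelDomain) :
    g * J * g⁻¹ ∈ siegelDomain := by
  obtain ⟨h, hh, rfl⟩ := hJ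
  exact ⟨g * h, mul_mem hg hh, by group⟩

/-- The dimension of `𝔽_{p²} W_σ` over `𝔽_p`. -/
def spanDim (Δ : ℕ) (p : Nat.Primes) (σ : GL Idx ℚ_[p]) : ℕ :=
  Module.finrank (ZMod p) (FW Δ p σ)

theorem FW_eq (σ : GL Idx ℚ_[p]) :
    FW Δ p σ = W p σ ⊔ (W p σ).map (rootMul Δ (ZMod p)) := rfl

theorem spanDim_GSpZ_mul {σ k : GL Idx ℚ_[p]} (hσ : σ ∈ heckeSet p) (hk : k ∈ GSpZ p) :
    spanDim Δ p (k * σ) = spanDim Δ p σ := by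
  rw [spanDim, spanDim, FW_eq, FW_eq, W_GSpZ_mul hσ hk]

/-- The reduction of `a` modulo p is an automorphism that commutes with √(-Δ), and it carries one
𝔽_{p²}-span onto the other. -/
theorem spanDim_mul {σ a : GL Idx ℚ_[p]} (hσ : σ ∈ heckeSet p) (ha : a ∈ GSpZ p)
    (hc : a ∈ rootCentralizer Δ ℚ_[p]) : spanDim Δ p (σ * a) = spanDim Δ p σ := by
  obtain ⟨k, -, rfl⟩ := mem_GSpZ.1 ha
  obtain ⟨M, hM⟩ := exists_integral hσ
  have hk : k ∈ rootCentralizer Δ ℤ_[p] := by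
    apply coe_injective_matrix p
    have := mem_rootCentralizer.1 hc
    simp only [Matrix.map_mul, rootMat_map]
    exact this
  have hr : redZ p k ∈ rootCentralizer Δ (ZMod p) := map_mem_rootCentralizer _ hk
  have e : FW Δ p (σ * embZ p k)
      = (FW Δ p σ).map (Matrix.vecMulLinear (redZ p k : Matrix Idx Idx (ZMod p))) := by
    rw [FW_eq, FW_eq, W_mul_embZ hM, Submodule.map_sup, ← Submodule.map_comp,
      ← Submodule.map_comp]
    congr 2
    refine LinearMap.ext fun v => ?_
    exact (rootMul_vecMul hr v).symm
  rw [spanDim, spanDim, e]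
  exact (Submodule.equivMapOfInjective _ (vecMulLinear_injective _) _).finrank_eq.symm

theorem spanDim_eq_or (hΔ : ¬ IsSquare (-(Δ : ZMod p))) {σ : GL Idx ℚ_[p]}
    (hσ : σ ∈ heckeSet p) : spanDim Δ p σ = 6 ∨ spanDim Δ p σ = 4 :=
  (isLagrangian_W hσ).finrank_sup hΔ

theorem spanDim_of_corr {σ : GL Idx ℚ_[p]} (hσ : σ ∈ heckeSet p) {r : GL Idx ℚ}
    (h : Corr p 𝒦 σ r) : spanDim Δ p (tau p * diagEmb r p) = spanDim Δ p σ := by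
  obtain ⟨-, k, hk, e⟩ := h
  rw [← e, spanDim_GSpZ_mul hσ hk]

/-- Two elements of `Γ` with the same invariant lie in the same double coset of `𝒦_p` and
`α(G_V(𝔸_f))`. -/
theorem exists_levelP_of_spanDim_eq (hp2 : (p : ℕ) ≠ 2) (hΔ : ¬ IsSquare (-(Δ : ZMod p)))
    (hpN : ¬ (p : ℕ) ∣ N) (h𝒦 : IsLevelSubgroup N 𝒦) {r₁ r₂ : GL Idx ℚ} (h₁ : r₁ ∈ Gam 𝒦)
    (h₂ : r₂ ∈ Gam 𝒦)
    (h : spanDim Δ p (tau p * diagEmb r₁ p) = spanDim Δ p (tau p * diagEmb r₂ p)) :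
    ∃ k ∈ levelP p 𝒦, (diagEmb r₂)⁻¹ * k * diagEmb r₁ ∈ GVAf Δ := by
  have i₁ := tau_mul_mem_heckeSet (apply_mem_GSpZ h𝒦 h₁ p)
  have i₂ := tau_mul_mem_heckeSet (apply_mem_GSpZ h𝒦 h₂ p)
  -- The similitude moves the subspace of `r₂` to that of `r₁`. After lifting, the two cosets at p
  -- differ only by `k₀` on the left.
  obtain ⟨g, hg, hgW⟩ := (isLagrangian_W i₂).exists_similitude
    (by rwa [ZMod.ringChar_zmod_n]) hΔ (isLagrangian_W i₁) h.symm
  obtain ⟨κ, hκ, hκg⟩ := exists_lift_similitude p hp2 hg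
  have hκZ : embZ p κ ∈ GSpZ p := ⟨κ, hκ.1, rfl⟩
  have i₂' : tau p * diagEmb r₂ p * embZ p κ ∈ heckeSet p := by
    have := mul_mem_heckeSet i₂ (one_mem _) hκZ
    rwa [one_mul] at this
  obtain ⟨M, hM⟩ := exists_integral i₂
  obtain ⟨k₀, hk₀, e₀⟩ := exists_mul_eq_of_W_eq i₁ i₂' (by
    rw [W_mul_embZ hM, ← hgW, ← hκg]
    rfl)
  set x : ProdGL := Pi.mulSingle p (embZ p κ) with hx
  have hxK : x ∈ 𝒦 := h𝒦.mulSingle_mem hpN hκZ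
  have hxV : x ∈ GVAf Δ := by
    refine ⟨h𝒦.le_GSpAf hxK, fun q => ?_⟩
    rw [GV_eq]
    by_cases hq : q = p
    · subst hq
      rw [hx, Pi.mulSingle_eq_same]
      exact ⟨map_mem_GSp _ hκ.1, map_mem_rootCentralizer _ hκ.2⟩
    · rw [hx, Pi.mulSingle_eq_of_ne hq]
      exact one_mem (GSp ℚ_[q] ⊓ rootCentralizer Δ ℚ_[q])
  -- Conjugation by τ_p gives `k₀` at p and leaves r₂r₁⁻¹ at the other places, so the result stays
  -- in 𝒦.
  refine ⟨diagEmb r₂ * x * (diagEmb r₁)⁻¹,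
    mem_levelP.2 ⟨mul_mem (mul_mem h₂.2 hxK) (inv_mem h₁.2), ?_⟩, ?_⟩
  · have e : tauA p * (diagEmb r₂ * x * (diagEmb r₁)⁻¹) * (tauA p)⁻¹
        = diagEmb (r₂ * r₁⁻¹) * Pi.mulSingle p ((diagEmb (r₂ * r₁⁻¹) p)⁻¹ * k₀) := by
      funext q
      by_cases hq : q = p
      · subst hq
        simp only [Pi.mul_apply, Pi.inv_apply, tauA_apply_self, hx, Pi.mulSingle_eq_same,
          mul_inv_cancel_left]
        rw [eq_comm, eq_mul_inv_iff_mul_eq, ← mul_assoc, ← mul_assoc, eq_mul_inv_iff_mul_eq,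
          mul_assoc k₀]
        exact e₀
      · simp only [Pi.mul_apply, Pi.inv_apply, tauA_apply_of_ne hq, hx,
          Pi.mulSingle_eq_of_ne hq, map_mul, map_inv, mul_one, one_mul, inv_one]
    rw [e]
    have hr : r₂ * r₁⁻¹ ∈ Gam 𝒦 := mul_mem h₂ (inv_mem h₁)
    exact mul_mem hr.2
      (h𝒦.mulSingle_mem hpN (mul_mem (inv_mem (apply_mem_GSpZ h𝒦 hr p)) hk₀))
  · have e : (diagEmb r₂)⁻¹ * (diagEmb r₂ * x * (diagEmb r₁)⁻¹) * diagEmb r₁ = x := by group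
    rw [e]
    exact hxV

theorem exists_equiv_point (h𝒦 : IsLevelSubgroup N 𝒦) {U : Subgroup ProdGL} (hU : U ≤ 𝒦)
    (P : Pts) {k : ProdGL} (hk : k ∈ U) {γ : GL Idx ℚ} (hγ : γ ∈ Gam 𝒦) :
    ∃ Q : Pts, (Q.1 : GL Idx ℝ) = (realEmb γ)⁻¹ * P.1 * realEmb γ ∧
      (Q.2 : ProdGL) = k * P.2 * diagEmb γ ∧
      Quotient.mk (shSetoid U) P = Quotient.mk (shSetoid U) Q := by
  have h1 : (realEmb γ)⁻¹ * P.1 * realEmb γ ∈ siegelDomain := by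
    have := conj_mem_siegelDomain (inv_mem (realEmb_mem hγ.1)) P.1.2
    rwa [inv_inv] at this
  have h2 : k * P.2 * diagEmb γ ∈ GSpAf :=
    mul_mem (mul_mem (h𝒦.le_GSpAf (hU hk)) P.2.2) (h𝒦.le_GSpAf hγ.2)
  exact ⟨(⟨_, h1⟩, ⟨_, h2⟩), rfl, rfl, Quotient.sound ⟨k, hk, γ, hγ.1, rfl, rfl⟩⟩

/-- Acting by `k` on the left and by rs⁻¹ on the right turns (rJr⁻¹, 1) into (sJs⁻¹, s(s⁻¹kr)s⁻¹).
-/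
theorem irrComp_subset_subVps (h𝒦 : IsLevelSubgroup N 𝒦) {r s : GL Idx ℚ} (hr : r ∈ Gam 𝒦)
    (hs : s ∈ Gam 𝒦) {k : ProdGL} (hk : k ∈ levelP p 𝒦)
    (h : (diagEmb s)⁻¹ * k * diagEmb r ∈ GVAf Δ) : irrComp Δ p 𝒦 r ⊆ subVps Δ p 𝒦 s := by
  rintro _ ⟨P, ⟨J, hJ, eP⟩, rfl⟩
  obtain ⟨Q, e1, e2, e⟩ := exists_equiv_point h𝒦 inf_le_left P hk (mul_mem hr (inv_mem hs))
  obtain ⟨eP1, eP2⟩ := Prod.mk.inj eP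
  refine ⟨Q, ⟨J, hJ, _, h, Prod.ext ?_ ?_⟩, e⟩
  · rw [e1, eP1, map_mul, map_inv]
    group
  · rw [e2, eP2, map_mul, map_inv]
    group

theorem heckeSubvariety_subset (h𝒦 : IsLevelSubgroup N 𝒦) {r s : GL Idx ℚ} (hr : r ∈ Gam 𝒦)
    (hs : s ∈ Gam 𝒦) {k : ProdGL} (hk : k ∈ levelP p 𝒦)
    (h : (diagEmb s)⁻¹ * k * diagEmb r ∈ GVAf Δ) :
    heckeSubvariety Δ p 𝒦 r ⊆ heckeSubvariety Δ p 𝒦 s := by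
  rintro _ ⟨P, ⟨_, ⟨J, hJ, g, hg, rfl⟩, eP⟩, rfl⟩
  obtain ⟨Q, e1, e2, e⟩ := exists_equiv_point h𝒦 le_rfl P (mem_levelP.1 hk).2
    (mul_mem hr (inv_mem hs))
  obtain ⟨eP1, eP2⟩ := Prod.mk.inj eP
  refine ⟨Q, ⟨_, ⟨J, hJ, _, (GVAfSubgroup Δ).mul_mem h hg, rfl⟩, Prod.ext ?_ ?_⟩, e⟩
  · rw [e1, eP1, map_mul, map_inv]
    group
  · rw [e2, eP2, map_mul, map_inv]
    group

theorem diagEmb_mem_rootCentralizer {δ : GL Idx ℚ} (hδ : δ ∈ rootCentralizer Δ ℚ)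
    (q : Nat.Primes) : diagEmb δ q ∈ rootCentralizer Δ ℚ_[q] :=
  map_mem_rootCentralizer _ hδ

/-- The generic point of the component makes δ = r⁻¹γs commute with √(-Δ). Then a = s⁻¹kr = gδ⁻¹
commutes with it at p and is integral, and τ_p s a differs from τ_p r by an integral similitude on
the left. -/
theorem spanDim_eq_of_irrComp_subset (hΔ0 : 0 < Δ) (h𝒦 : IsLevelSubgroup N 𝒦)
    {r s : GL Idx ℚ} (hr : r ∈ Gam 𝒦) (hs : s ∈ Gam 𝒦)
    (h : irrComp Δ p 𝒦 r ⊆ subVps Δ p 𝒦 s) :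
    spanDim Δ p (tau p * diagEmb r p) = spanDim Δ p (tau p * diagEmb s p) := by
  obtain ⟨J, hJ, hJs, hgen⟩ := exists_generic_point hΔ0
  let P : Pts := (⟨realEmb r * J * (realEmb r)⁻¹,
    conj_mem_siegelDomain (realEmb_mem hr.1) hJs⟩, 1)
  obtain ⟨Q, ⟨J', hJ', g, hg, eQ⟩, e⟩ := h ⟨P, ⟨J, hJ, rfl⟩, rfl⟩
  obtain ⟨eQ1, eQ2⟩ := Prod.mk.inj eQ
  obtain ⟨k, hk, γ, -, e1, e2⟩ := Quotient.exact e
  clear e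
  rw [eQ1] at e1
  rw [eQ2] at e2
  change _ = (realEmb γ)⁻¹ * (realEmb r * J * (realEmb r)⁻¹) * realEmb γ at e1
  change _ = k * 1 * diagEmb γ at e2
  have hδ : r⁻¹ * γ * s ∈ rootCentralizer Δ ℚ := by
    apply hgen
    have : (realEmb (r⁻¹ * γ * s))⁻¹ * J * realEmb (r⁻¹ * γ * s) = J' := by
      rw [map_mul, map_mul, map_inv]
      calc _ = (realEmb s)⁻¹ * ((realEmb γ)⁻¹ * (realEmb r * J * (realEmb r)⁻¹) * realEmb γ)
            * realEmb s := by group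
        _ = J' := by rw [← e1]; group
    rw [this]
    exact hJ'
  set a : ProdGL := (diagEmb s)⁻¹ * k * diagEmb r with ha
  have hag : a = g * (diagEmb (r⁻¹ * γ * s))⁻¹ := by
    have : k = diagEmb s * g * (diagEmb s)⁻¹ * (diagEmb γ)⁻¹ := by rw [e2]; group
    rw [ha, this, map_mul, map_mul, map_inv]
    group
  have hac : a p ∈ rootCentralizer Δ ℚ_[p] := by
    rw [hag]
    exact mul_mem (apply_mem_rootCentralizer hg p)
      (inv_mem (diagEmb_mem_rootCentralizer hδ p))
  have haK : a ∈ 𝒦 := mul_mem (mul_mem (inv_mem hs.2) (mem_levelP.1 hk).1) hr.2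
  have hτ := h𝒦.le_integral _ (mem_levelP.1 hk).2 p
  rw [Pi.mul_apply, Pi.mul_apply, Pi.inv_apply, tauA_apply_self] at hτ
  have e : tau p * k p * (tau p)⁻¹ * (tau p * diagEmb r p) = tau p * diagEmb s p * a p := by
    simp only [ha, Pi.mul_apply, Pi.inv_apply]
    group
  rw [← spanDim_mul (tau_mul_mem_heckeSet (apply_mem_GSpZ h𝒦 hs p))
    (h𝒦.le_integral _ haK p) hac,
    ← spanDim_GSpZ_mul (tau_mul_mem_heckeSet (apply_mem_GSpZ h𝒦 hr p)) hτ, e]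

/-- A component of `T_p(V)` is never `V` itself. -/
theorem heckeSubvariety_ne_subV (hΔ0 : 0 < Δ) (hΔ : ¬ IsSquare (-(Δ : ZMod p)))
    (h𝒦 : IsLevelSubgroup N 𝒦) {r : GL Idx ℚ} (hr : r ∈ Gam 𝒦) :
    heckeSubvariety Δ p 𝒦 r ≠ subV Δ 𝒦 := by
  intro hV
  obtain ⟨J, hJ, hJs, hgen⟩ := exists_generic_point hΔ0
  let P : Pts := (⟨realEmb r * J * (realEmb r)⁻¹,
    conj_mem_siegelDomain (realEmb_mem hr.1) hJs⟩, ⟨tauA p, tauA_mem_GSpAf p⟩)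
  have hP : Quotient.mk (shSetoid 𝒦) P ∈ heckeSubvariety Δ p 𝒦 r := by
    refine ⟨P, ⟨_, ⟨J, hJ, 1, (GVAfSubgroup Δ).one_mem, rfl⟩, Prod.ext rfl ?_⟩, rfl⟩
    change tauA p = tauA p * (diagEmb r * 1 * (diagEmb r)⁻¹)
    group
  rw [hV] at hP
  obtain ⟨Q, ⟨hQ1, hQ2⟩, e⟩ := hP
  obtain ⟨k, hk, γ, -, e1, e2⟩ := Quotient.exact e
  change _ = (realEmb γ)⁻¹ * (realEmb r * J * (realEmb r)⁻¹) * realEmb γ at e1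
  change _ = k * tauA p * diagEmb γ at e2
  have hδ : r⁻¹ * γ ∈ rootCentralizer Δ ℚ := by
    apply hgen
    have : (realEmb (r⁻¹ * γ))⁻¹ * J * realEmb (r⁻¹ * γ) = Q.1 := by
      rw [e1, map_mul, map_inv]
      group
    rw [this]
    exact hQ1
  set σ : GL Idx ℚ_[p] := k p * (tau p * diagEmb r p) with hσdef
  have hτr := tau_mul_mem_heckeSet (apply_mem_GSpZ h𝒦 hr p)
  have hσ : σ ∈ heckeSet p := by
    have := mul_mem_heckeSet hτr (h𝒦.le_integral k hk p) (one_mem _)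
    rwa [mul_one] at this
  have hσc : σ ∈ rootCentralizer Δ ℚ_[p] := by
    have : σ = (Q.2 : ProdGL) p * (diagEmb (r⁻¹ * γ) p)⁻¹ := by
      rw [e2, map_mul, map_inv, hσdef]
      simp only [Pi.mul_apply, Pi.inv_apply, tauA_apply_self]
      group
    rw [this]
    exact mul_mem (apply_mem_rootCentralizer hQ2 p)
      (inv_mem (diagEmb_mem_rootCentralizer hδ p))
  obtain ⟨M, hM⟩ := exists_integral hσ
  have hMc : M * rootMat Δ ℤ_[p] = rootMat Δ ℤ_[p] * M := by
    apply coe_injective_matrix p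
    have := mem_rootCentralizer.1 hσc
    simp only [Matrix.map_mul, rootMat_map, hM]
    exact this
  -- A matrix that commutes with √(-Δ) has a row space stable under it. The dimension would be 3,
  -- against `spanDim_eq_or`.
  have hle : (W p σ).map (rootMul Δ (ZMod p)) ≤ W p σ := by
    have hMr := congrArg (fun m => m.map (PadicInt.toZMod (p := p))) hMc
    simp only [Matrix.map_mul, rootMat_map] at hMr
    rw [W_of_map hM]
    rintro _ ⟨_, ⟨v, rfl⟩, rfl⟩
    refine ⟨rootMul Δ (ZMod p) v, ?_⟩
    rw [rootMul_apply, rootMul_apply, vecMulLinear_apply, vecMulLinear_apply, vecMul_vecMul,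
      vecMul_vecMul, hMr]
  have hdim : spanDim Δ p σ = 3 := by
    rw [spanDim, FW_eq, sup_eq_left.2 hle, (isLagrangian_W hσ).finrank_eq]
  have := spanDim_eq_or hΔ hσ
  omega

/-- The D-partition of `S(3)` is the partition by the dimension of `𝔽_{p²} W_σ`. -/
theorem dEquiv_iff (hp2 : (p : ℕ) ≠ 2) (hΔ0 : 0 < Δ) (hΔ : ¬ IsSquare (-(Δ : ZMod p)))
    (hpN : ¬ (p : ℕ) ∣ N) (h𝒦 : IsLevelSubgroup N 𝒦) {σ₁ σ₂ : GL Idx ℚ_[p]}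
    (h₁ : σ₁ ∈ heckeSet p) (h₂ : σ₂ ∈ heckeSet p) :
    DEquiv Δ p 𝒦 σ₁ σ₂ ↔ spanDim Δ p σ₁ = spanDim Δ p σ₂ := by
  constructor
  · rintro ⟨r₁, r₂, c₁, c₂, s, hs, i₁, i₂⟩
    rw [← spanDim_of_corr h₁ c₁, ← spanDim_of_corr h₂ c₂,
      spanDim_eq_of_irrComp_subset hΔ0 h𝒦 c₁.1 hs i₁,
      spanDim_eq_of_irrComp_subset hΔ0 h𝒦 c₂.1 hs i₂]
  · intro h
    obtain ⟨r₁, c₁⟩ := exists_corr hpN h𝒦 h₁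
    obtain ⟨r₂, c₂⟩ := exists_corr hpN h𝒦 h₂
    obtain ⟨k, hk, hkV⟩ := exists_levelP_of_spanDim_eq hp2 hΔ hpN h𝒦 c₁.1 c₂.1
      (by rw [spanDim_of_corr h₁ c₁, spanDim_of_corr h₂ c₂, h])
    refine ⟨r₁, r₂, c₁, c₂, r₂, c₂.1, irrComp_subset_subVps h𝒦 c₁.1 c₂.1 hk hkV,
      irrComp_subset_subVps h𝒦 c₂.1 c₂.1 (one_mem _) ?_⟩
    rw [mul_one, inv_mul_cancel]
    exact (GVAfSubgroup Δ).one_mem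

theorem heckeSubvariety_eq (hp2 : (p : ℕ) ≠ 2) (hΔ : ¬ IsSquare (-(Δ : ZMod p)))
    (hpN : ¬ (p : ℕ) ∣ N) (h𝒦 : IsLevelSubgroup N 𝒦) {σ₁ σ₂ : GL Idx ℚ_[p]}
    (h₁ : σ₁ ∈ heckeSet p) (h₂ : σ₂ ∈ heckeSet p) (h : spanDim Δ p σ₁ = spanDim Δ p σ₂)
    {r₁ r₂ : GL Idx ℚ} (c₁ : Corr p 𝒦 σ₁ r₁) (c₂ : Corr p 𝒦 σ₂ r₂) :
    heckeSubvariety Δ p 𝒦 r₁ = heckeSubvariety Δ p 𝒦 r₂ := by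
  rw [← spanDim_of_corr h₁ c₁, ← spanDim_of_corr h₂ c₂] at h
  obtain ⟨k, hk, hkV⟩ := exists_levelP_of_spanDim_eq hp2 hΔ hpN h𝒦 c₁.1 c₂.1 h
  obtain ⟨l, hl, hlV⟩ := exists_levelP_of_spanDim_eq hp2 hΔ hpN h𝒦 c₂.1 c₁.1 h.symm
  exact Set.Subset.antisymm (heckeSubvariety_subset h𝒦 c₁.1 c₂.1 hk hkV)
    (heckeSubvariety_subset h𝒦 c₂.1 c₁.1 hl hlV)

/-! ### Both values of d occur; enumeration of parts and components -/

theorem frakD_six_nonempty (hΔ : ¬ IsSquare (-(Δ : ZMod p))) : (frakD Δ p 6).Nonempty := by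
  have h : tau p ∈ heckeSet p := ⟨1, one_mem _, 1, one_mem _, by group⟩
  refine ⟨tau p, h, ?_⟩
  have hsum := (isLagrangian_W h).finrank_sup_add hΔ
  have hbot : stableCore Δ (W p (tau p)) = ⊥ := by
    rw [eq_bot_iff]
    intro v hv
    rw [mem_stableCore hΔ, W_tau, mem_stdLagrangian, mem_stdLagrangian] at hv
    rw [Submodule.mem_bot]
    have e := hv.2
    simp only [rootMul_apply, rootMat_eq, vecMul_fromBlocks] at e
    funext i
    rcases i with i | i
    · have := e i
      fin_cases i <;> simpa [E21, vecMul_diagonal] using this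
    · exact hv.1 i
  rw [hbot, finrank_bot, add_zero] at hsum
  exact hsum

theorem frakD_four_nonempty (hp2 : (p : ℕ) ≠ 2) (hΔ : ¬ IsSquare (-(Δ : ZMod p))) :
    (frakD Δ p 4).Nonempty := by
  have hΔ0 := natCast_ne_zero_of_not_isSquare hΔ
  have h2 : (2 : ZMod p) ≠ 0 := Ring.two_ne_zero (by rwa [ZMod.ringChar_zmod_n])
  -- The equation says that √(-Δ) maps the first row of (1, s), for the matrix `s` below, into the
  -- row space. It is solvable because `E21` has opposite signs in the first and third coordinates:
  -- take a - b = 1 and a + b = -1/Δ.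
  obtain ⟨a, b, hab⟩ : ∃ a b : ZMod p, (Δ : ZMod p) * (a ^ 2 - b ^ 2) = -1 := by
    refine ⟨(1 - (Δ : ZMod p)⁻¹) / 2, (1 - (Δ : ZMod p)⁻¹) / 2 - 1, ?_⟩
    field_simp
    ring
  obtain ⟨a', ha⟩ := toZMod_surjective p a
  obtain ⟨b', hb⟩ := toZMod_surjective p b
  let S : Matrix (Fin 3) (Fin 3) ℤ_[p] := !![a', 0, b'; 0, 0, 0; b', 0, a']
  have hS : S.IsSymm := by
    ext i j
    fin_cases i <;> fin_cases j <;> rfl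
  let s : Matrix (Fin 3) (Fin 3) (ZMod p) := !![a, 0, b; 0, 0, 0; b, 0, a]
  have hSs : S.map PadicInt.toZMod = s := by
    ext i j
    fin_cases i <;> fin_cases j <;> simp [S, s, ha, hb]
  have hu : embZ p (upperUni S) ∈ GSpZ p := ⟨_, ⟨1, by rw [upperUni_symplectic hS]; simp⟩, rfl⟩
  have h := tau_mul_mem_heckeSet hu
  refine ⟨_, h, ?_⟩
  have hW : W p (tau p * embZ p (upperUni S)) = (stdLagrangian (ZMod p)).map
      (Matrix.vecMulLinear (upperUni s : Matrix Idx Idx (ZMod p))) := by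
    rw [W_mul_embZ (tauZ_map p), W_tau, redZ, upperUni_map, hSs]
  have hmem (x : Fin 3 → ZMod p) : Sum.elim x (x ᵥ* s) ∈ W p (tau p * embZ p (upperUni S)) := by
    rw [hW]
    refine ⟨Sum.elim x 0, mem_stdLagrangian.2 fun i => rfl, ?_⟩
    rw [vecMulLinear_apply]
    change Sum.elim x 0 ᵥ* fromBlocks 1 s 0 1 = _
    rw [vecMul_fromBlocks]
    funext i
    rcases i with i | i <;> simp [Function.comp_def]
  have hne : stableCore Δ (W p (tau p * embZ p (upperUni S))) ≠ ⊥ := by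
    intro h0
    have hv : (Sum.elim ![1, 0, 0] (![1, 0, 0] ᵥ* s) : Idx → ZMod p)
        ∈ stableCore Δ (W p (tau p * embZ p (upperUni S))) := by
      rw [mem_stableCore hΔ]
      refine ⟨hmem _, ?_⟩
      have e : rootMul Δ (ZMod p) (Sum.elim ![1, 0, 0] (![1, 0, 0] ᵥ* s))
          = Sum.elim ![-(Δ * a), 0, Δ * b] (![-(Δ * a), 0, Δ * b] ᵥ* s) := by
        rw [rootMul_apply, rootMat_eq, vecMul_fromBlocks, E21_eq]
        funext i
        rcases i with i | i <;> fin_cases i <;>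
          simp [s]
        · ring
        · ring
        · linear_combination hab
        · ring
      rw [e]
      exact hmem _
    rw [h0, Submodule.mem_bot] at hv
    have := congrFun hv (Sum.inl 0)
    simp at this
  have hsum := (isLagrangian_W h).finrank_sup_add hΔ
  have hcore := (isLagrangian_W h).finrank_stableCore hΔ
  rw [Submodule.finrank_eq_zero] at hcore
  rw [hcore.resolve_left hne] at hsum
  change _ + 2 = 4 + 2 at hsum
  exact Nat.add_right_cancel hsum

theorem mem_frakD {j : ℕ} {σ : GL Idx ℚ_[p]} :
    σ ∈ frakD Δ p j ↔ σ ∈ heckeSet p ∧ spanDim Δ p σ = j := Iff.rfl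

theorem eq_of_frakD_subset {i j : ℕ} (hi : (frakD Δ p i).Nonempty)
    (h : frakD Δ p i ⊆ frakD Δ p j) : i = j := by
  obtain ⟨σ, hσ⟩ := hi
  rw [← (mem_frakD.1 hσ).2, ← (mem_frakD.1 (h hσ)).2]

theorem mem_DParts_iff (hp2 : (p : ℕ) ≠ 2) (hΔ0 : 0 < Δ) (hΔ : ¬ IsSquare (-(Δ : ZMod p)))
    (hpN : ¬ (p : ℕ) ∣ N) (h𝒦 : IsLevelSubgroup N 𝒦) {A : Set (GL Idx ℚ_[p])} :
    A ∈ DParts Δ p 𝒦 ↔ A = frakD Δ p 6 ∨ A = frakD Δ p 4 := by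
  have key {σ} (hσ : σ ∈ heckeSet p) :
      {σ' | σ' ∈ heckeSet p ∧ DEquiv Δ p 𝒦 σ σ'} = frakD Δ p (spanDim Δ p σ) := by
    ext σ'
    refine and_congr_right fun hσ' => ?_
    rw [dEquiv_iff hp2 hΔ0 hΔ hpN h𝒦 hσ hσ', eq_comm]
    rfl
  constructor
  · rintro ⟨σ, hσ, rfl⟩
    rw [key hσ]
    rcases spanDim_eq_or hΔ hσ with h | h
    · exact Or.inl (by rw [h])
    · exact Or.inr (by rw [h])
  · rintro (rfl | rfl)
    · obtain ⟨σ, hσ⟩ := frakD_six_nonempty hΔ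
      exact ⟨σ, hσ.1, by rw [key hσ.1, (mem_frakD.1 hσ).2]⟩
    · obtain ⟨σ, hσ⟩ := frakD_four_nonempty hp2 hΔ
      exact ⟨σ, hσ.1, by rw [key hσ.1, (mem_frakD.1 hσ).2]⟩

theorem isGoodPart_iff (hp2 : (p : ℕ) ≠ 2) (hΔ0 : 0 < Δ) (hΔ : ¬ IsSquare (-(Δ : ZMod p)))
    (hpN : ¬ (p : ℕ) ∣ N) (h𝒦 : IsLevelSubgroup N 𝒦) {A : Set (GL Idx ℚ_[p])} :
    IsGoodPart Δ p 𝒦 A ↔ A = frakD Δ p 6 := by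
  rw [IsGoodPart, mem_DParts_iff hp2 hΔ0 hΔ hpN h𝒦]
  constructor
  · rintro ⟨rfl | rfl, h⟩
    · rfl
    · exact absurd (eq_of_frakD_subset (frakD_four_nonempty hp2 hΔ) h) (by norm_num)
  · rintro rfl
    exact ⟨Or.inl rfl, subset_rfl⟩

theorem isBadPart_iff (hp2 : (p : ℕ) ≠ 2) (hΔ0 : 0 < Δ) (hΔ : ¬ IsSquare (-(Δ : ZMod p)))
    (hpN : ¬ (p : ℕ) ∣ N) (h𝒦 : IsLevelSubgroup N 𝒦) {A : Set (GL Idx ℚ_[p])} :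
    IsBadPart Δ p 𝒦 A ↔ A = frakD Δ p 4 := by
  rw [IsBadPart, mem_DParts_iff hp2 hΔ0 hΔ hpN h𝒦]
  constructor
  · rintro ⟨rfl | rfl, j, -, h6, h⟩
    · exact absurd (eq_of_frakD_subset (frakD_six_nonempty hΔ) h).symm h6
    · rfl
  · rintro rfl
    exact ⟨Or.inr rfl, 4, by norm_num, by norm_num, subset_rfl⟩

theorem not_isTrivialPart (hp2 : (p : ℕ) ≠ 2) (hΔ0 : 0 < Δ) (hΔ : ¬ IsSquare (-(Δ : ZMod p)))
    (hpN : ¬ (p : ℕ) ∣ N) (h𝒦 : IsLevelSubgroup N 𝒦) {A : Set (GL Idx ℚ_[p])} :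
    ¬ IsTrivialPart Δ p 𝒦 A := by
  rw [IsTrivialPart, mem_DParts_iff hp2 hΔ0 hΔ hpN h𝒦]
  rintro ⟨rfl | rfl, h⟩
  · exact absurd (eq_of_frakD_subset (frakD_six_nonempty hΔ) h) (by norm_num)
  · exact absurd (eq_of_frakD_subset (frakD_four_nonempty hp2 hΔ) h) (by norm_num)

/-- All representatives of one part give the same Hecke subvariety, so the component does not depend
on the choices of σ and r. -/
theorem existsUnique_component (hp2 : (p : ℕ) ≠ 2) (hΔ : ¬ IsSquare (-(Δ : ZMod p)))
    (hpN : ¬ (p : ℕ) ∣ N) (h𝒦 : IsLevelSubgroup N 𝒦) {j : ℕ} (hj : (frakD Δ p j).Nonempty) :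
    ∃! Y, IsComponentOf Δ p 𝒦 (frakD Δ p j) Y := by
  obtain ⟨σ, hσ⟩ := hj
  obtain ⟨r, hr⟩ := exists_corr hpN h𝒦 hσ.1
  refine ⟨_, ⟨σ, hσ, r, hr, rfl⟩, ?_⟩
  rintro _ ⟨σ', hσ', r', hr', rfl⟩
  exact heckeSubvariety_eq hp2 hΔ hpN h𝒦 hσ'.1 hσ.1
    ((mem_frakD.1 hσ').2.trans (mem_frakD.1 hσ).2.symm) hr' hr

end Global

end PicardHecke

end

/-! ### The theorem -/

open PicardHecke
theorem theorem3p3p4 (p : Nat.Primes) (hp2 : (p : ℕ) ≠ 2) (Δ : ℕ) (hΔ : 0 < Δ)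
    (hinert : legendreSym p (-(Δ : ℤ)) = -1) (N : ℕ) (hpN : ¬ (p : ℕ) ∣ N)
    (𝒦 : Subgroup ProdGL) (h𝒦 : IsLevelSubgroup N 𝒦) :
    -- any two elements of the open part of `𝔇_4` are D-equivalent
    (∀ s₁ s₂ : Matrix (Fin 3) (Fin 3) ℤ, s₁.IsSymm → s₂.IsSymm →
      sigmaOpen p s₁ ∈ frakD Δ p 4 → sigmaOpen p s₂ ∈ frakD Δ p 4 →
      DEquiv Δ p 𝒦 (sigmaOpen p s₁) (sigmaOpen p s₂)) ∧
    -- the D-partition: exactly one good part, exactly one bad part, no trivial part, no others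
    (∃! A, IsGoodPart Δ p 𝒦 A) ∧
    (∃! A, IsBadPart Δ p 𝒦 A) ∧
    (¬ ∃ A, IsTrivialPart Δ p 𝒦 A) ∧
    (∀ A ∈ DParts Δ p 𝒦, IsGoodPart Δ p 𝒦 A ∨ IsBadPart Δ p 𝒦 A) ∧
    -- the components of `T_p(V)`: one good, one bad, and none equal to `V` itself
    (∃! Y, ∃ A, IsGoodPart Δ p 𝒦 A ∧ IsComponentOf Δ p 𝒦 A Y) ∧
    (∃! Y, ∃ A, IsBadPart Δ p 𝒦 A ∧ IsComponentOf Δ p 𝒦 A Y) ∧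
    (∀ A ∈ DParts Δ p 𝒦, ¬ IsComponentOf Δ p 𝒦 A (subV Δ 𝒦)) := by
  -- Inertness enters only in this form. It also excludes that p divides Δ, because 0 is a square.
  have hsq : ¬ IsSquare (-(Δ : ZMod p)) := by
    have := (legendreSym.eq_neg_one_iff p).1 hinert
    push_cast at this
    exact this
  have hgood (A) := isGoodPart_iff (A := A) hp2 hΔ hsq hpN h𝒦
  have hbad (A) := isBadPart_iff (A := A) hp2 hΔ hsq hpN h𝒦
  simp only [hgood, hbad, exists_eq_left]
  refine ⟨fun s₁ s₂ _ _ h₁ h₂ => ?_, existsUnique_eq, existsUnique_eq, ?_, ?_,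
    existsUnique_component hp2 hsq hpN h𝒦 (frakD_six_nonempty hsq),
    existsUnique_component hp2 hsq hpN h𝒦 (frakD_four_nonempty hp2 hsq), ?_⟩
  · exact (dEquiv_iff hp2 hΔ hsq hpN h𝒦 h₁.1 h₂.1).2
      ((mem_frakD.1 h₁).2.trans (mem_frakD.1 h₂).2.symm)
  · rintro ⟨A, hA⟩
    exact not_isTrivialPart hp2 hΔ hsq hpN h𝒦 hA
  · exact fun A hA => (mem_DParts_iff hp2 hΔ hsq hpN h𝒦).1 hA
  · rintro A - ⟨σ, -, r, hr, h⟩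
    exact heckeSubvariety_ne_subV hΔ hsq h𝒦 hr.1 h.symm
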